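/- **Forward gradient estimation by quantum-accelerated Monte Carlo, Gaussian direction loaded in superposition.** *Setting.* Let $f(\theta,x)\in\mathbb{R}$ be the scalar loss of a model with $n_\theta$ trainable parameters $\theta\in\mathbb{R}^{n_\theta}$ and input $x\in\mathbb{R}^d$. Let $X$ be a random input that takes the values $X_i\in\mathbb{R}^d$ with probabilities $p_{X,i}$, $i\in\{0,1\}^m$, such that $f(\cdot,x)$ is differentiable at $\theta$ for each value $x$ that $X$ takes; write $\nabla f(x)=\nabla_\theta f(\theta,x)$ and $g_{\max}=\max_{i:\,p_{X,i}>0}\|\nabla f(X_i)\|_\infty^2$. Let $v\sim\mathcal N(0,I_{n_\theta})$ be independent of $X$. The forward gradient is $(\nabla f(X)\cdot v)\,v\in\mathbb{R}^{n_\theta}$. *(1) Variance.* Every coordinate of $(\nabla f(X)\cdot v)\,v$ is square integrable and has variance at most $(n_\theta+2)\,g_{\max}$. *(2) Query complexity.* Real numbers are stored in a fixed-point encoding with a sign bit, $c_1$ integer bits and $c_2$ fractional bits. Access is given to the unitary $$U'_{\mathrm{NN},q}:\ |i\rangle|w\rangle|y\rangle\mapsto|i\rangle|w\rangle|y\oplus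 F(i,w)\rangle ,$$ where, for each $i$ with $p_{X,i}>0$, every coordinate of $F(i,w)$ agrees up to $2^{-c_2}$ with that of $(\nabla f(X_i)\cdot w)\,w$ whenever the latter is in the range of the encoding; and to unitaries (and their inverses) that map $|0\cdots0\rangle$ to $\sum_i\sqrt{p_{X,i}}\,|i\rangle$ and to $\sum_w\sqrt{p_{v,w}}\,|w\rangle$, where $p_v$ is the law of $v$ rounded coordinatewise to the fixed-point grid. There is a universal constant $C$ such that for all $d\ge1$, $n_\theta\ge 0$, $g\ge0$, $\epsilon>0$, all sufficiently large $c_1,c_2$ (depending on $d,n_\theta,g,\epsilon$ only) and all $m$, there is a quantum algorithm that makes at most $$C\,\frac{n_\theta\sqrt{d\,g}}{\epsilon}$$ queries to $U'_{\mathrm{NN},q}$ and that, for all $f,\theta,X$ as above with $g_{\max}\le g$ and all unitaries as above, outputs $\tilde\mu\in\mathbb{R}^{n_\theta}$ with $$\big\|\tilde\mu-\mathbb{E}_{X,v}\big[(\nabla f(X)\cdot v)\,v\big]\big\|_\infty\le\epsilon$$ with probability at least $0.99$. In particular (with $g=g_{\max}$) the mean of the forward gradient is estimated with $O(n_\theta\sqrt{d\,g_{\max}}/\epsilon)$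 queries. -/

import Mathlib

open MeasureTheory ProbabilityTheory

noncomputable section

namespace FwdGrad

/-! ### Fixed-point numbers -/

/-- Computational basis labels of a register of `k` qubits. -/
abbrev BitString (k : ℕ) : Type := Fin k → Bool

/-- Fixed-point numbers: `c₁` integer bits `a`, `c₂` fractional bits `b`, and a sign bit `s`. -/
abbrev FixedPoint (c₁ c₂ : ℕ) : Type := BitString c₁ × BitString c₂ × Bool

variable {c₁ c₂ : ℕ}

/-- The real number `(-1)^s (∑ₖ aₖ 2ᵏ + ∑ₖ bₖ 2^{-(k+1)})` encoded by `q = (a, b, s)`. -/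
def fpVal (q : FixedPoint c₁ c₂) : ℝ :=
  (if q.2.2 then -1 else 1) *
    ((∑ k : Fin c₁, if q.1 k then (2 : ℝ) ^ (k : ℕ) else 0) +
      ∑ k : Fin c₂, if q.2.1 k then ((2 : ℝ) ^ ((k : ℕ) + 1))⁻¹ else 0)

/-- Bitwise exclusive or. -/
def fpXor (q r : FixedPoint c₁ c₂) : FixedPoint c₁ c₂ :=
  (fun k => xor (q.1 k) (r.1 k), fun k => xor (q.2.1 k) (r.2.1 k), xor q.2.2 r.2.2)

/-- The all-zero bit string. -/
def fpZero : FixedPoint c₁ c₂ := (fun _ => false, fun _ => false, false)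

/-- The largest number `2^{c₁} - 2^{-c₂}` that can be encoded. -/
def fpRange (c₁ c₂ : ℕ) : ℝ := 2 ^ c₁ - (2 ^ c₂)⁻¹

/-- Rounding towards zero to a multiple of `2^{-c₂}`, saturating at `± fpRange c₁ c₂`. -/
def fpRound (c₁ c₂ : ℕ) (t : ℝ) : FixedPoint c₁ c₂ :=
  let k : ℕ := min ⌊|t| * 2 ^ c₂⌋₊ (2 ^ (c₁ + c₂) - 1)
  (fun j => k.testBit (c₂ + j), fun j => k.testBit (c₂ - 1 - j), decide (t < 0))

/-! ### The forward gradient and its law -/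

/-- The gradient of the loss with respect to the trainable parameters, at the parameters `θ`
and the input `x`. -/
def grad {n d : ℕ} (f : EuclideanSpace ℝ (Fin n) → EuclideanSpace ℝ (Fin d) → ℝ)
    (θ : EuclideanSpace ℝ (Fin n)) (x : EuclideanSpace ℝ (Fin d)) : EuclideanSpace ℝ (Fin n) :=
  gradient (fun ϑ => f ϑ x) θ

/-- The forward gradient `(∇f(x) · v) v`. -/
def fwdGrad {n d : ℕ} (f : EuclideanSpace ℝ (Fin n) → EuclideanSpace ℝ (Fin d) → ℝ)
    (θ : EuclideanSpace ℝ (Fin n)) (x : EuclideanSpace ℝ (Fin d)) (v : Fin n → ℝ) : Fin n → ℝ :=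
  fun j => inner ℝ (grad f θ x) (WithLp.toLp 2 v) * v j

/-- The law of a vector with `n` iid standard normal components. -/
def stdGauss (n : ℕ) : Measure (Fin n → ℝ) := Measure.pi fun _ => gaussianReal 0 1

/-- The joint law of the index `i` of the input value `X i` and of an independent standard
Gaussian direction `v`. -/
def jointLaw {m : ℕ} (p : PMF (BitString m)) (n : ℕ) : Measure (BitString m × (Fin n → ℝ)) :=
  p.toMeasure.prod (stdGauss n)

/-- The `j`-th coordinate of the forward gradient at a random input and a random direction. -/
def fwdGradCoord {n d m : ℕ} (f : EuclideanSpace ℝ (Fin n) → EuclideanSpace ℝ (Fin d) → ℝ)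
    (θ : EuclideanSpace ℝ (Fin n)) (X : BitString m → EuclideanSpace ℝ (Fin d)) (j : Fin n) :
    BitString m × (Fin n → ℝ) → ℝ :=
  fun z => fwdGrad f θ (X z.1) z.2 j

/-- The mean of the forward gradient with respect to the input and the direction. -/
def fwdGradMean {n d m : ℕ} (f : EuclideanSpace ℝ (Fin n) → EuclideanSpace ℝ (Fin d) → ℝ)
    (θ : EuclideanSpace ℝ (Fin n)) (X : BitString m → EuclideanSpace ℝ (Fin d))
    (p : PMF (BitString m)) : Fin n → ℝ :=
  fun j => ∫ z, fwdGradCoord f θ X j z ∂(jointLaw p n)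

/-- `g_max`: the square of the largest absolute value of a partial derivative of the loss with
respect to a parameter, over all values that the input takes with positive probability
(the norm on `Fin n → ℝ` is the `ℓ∞` norm). -/
def gMax {n d m : ℕ} (f : EuclideanSpace ℝ (Fin n) → EuclideanSpace ℝ (Fin d) → ℝ)
    (θ : EuclideanSpace ℝ (Fin n)) (X : BitString m → EuclideanSpace ℝ (Fin d))
    (p : PMF (BitString m)) : ℝ :=
  (⨆ i : p.support, ‖(fun j => grad f θ (X i) j : Fin n → ℝ)‖) ^ 2

/-- The loss is differentiable with respect to the parameters at `θ`, for every value that the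
input takes. -/
def DiffAtParams {n d m : ℕ} (f : EuclideanSpace ℝ (Fin n) → EuclideanSpace ℝ (Fin d) → ℝ)
    (θ : EuclideanSpace ℝ (Fin n)) (X : BitString m → EuclideanSpace ℝ (Fin d))
    (p : PMF (BitString m)) : Prop :=
  ∀ i ∈ p.support, DifferentiableAt ℝ (fun ϑ => f ϑ (X i)) θ

/-! ### Quantum access -/

/-- The Boolean function `F` computes the forward gradient in fixed-point arithmetic: each
coordinate of the result that is in range is exact up to one unit in the last place. -/
def Computes {n d m : ℕ} (F : BitString m → (Fin n → FixedPoint c₁ c₂) → Fin n → FixedPoint c₁ c₂)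
    (f : EuclideanSpace ℝ (Fin n) → EuclideanSpace ℝ (Fin d) → ℝ)
    (θ : EuclideanSpace ℝ (Fin n)) (X : BitString m → EuclideanSpace ℝ (Fin d))
    (p : PMF (BitString m)) : Prop :=
  ∀ i ∈ p.support, ∀ (w : Fin n → FixedPoint c₁ c₂) (j : Fin n),
    |fwdGrad f θ (X i) (fun k => fpVal (w k)) j| ≤ fpRange c₁ c₂ →
      |fpVal (F i w j) - fwdGrad f θ (X i) (fun k => fpVal (w k)) j| ≤ (2 ^ c₂)⁻¹

/-- The unitary `P` maps `|0…0⟩` to `∑ᵢ √pᵢ |i⟩`. -/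
def LoadsInput {m : ℕ} (P : Matrix.unitaryGroup (BitString m) ℂ) (p : PMF (BitString m)) : Prop :=
  ∀ i, P.1 i (fun _ => false) = (√((p i).toReal) : ℝ)

/-- The unitary `V` maps `|0…0⟩` to `∑_w √p_w |w⟩`, where `p_w` is the probability that the
rounding of a standard Gaussian vector is `w`. -/
def LoadsGauss {n : ℕ} (V : Matrix.unitaryGroup (Fin n → FixedPoint c₁ c₂) ℂ) : Prop :=
  ∀ w, V.1 w (fun _ => fpZero) =
    (√((stdGauss n).real {v | ∀ j, fpRound c₁ c₂ (v j) = w j}) : ℝ)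

/-! ### Quantum query algorithms -/

/-- Computational basis labels `|i⟩|w⟩|y⟩|z⟩`: an input register, a direction register, a result
register, and a workspace of `K` qubits. -/
abbrev Basis (n m c₁ c₂ K : ℕ) : Type :=
  BitString m × (Fin n → FixedPoint c₁ c₂) × (Fin n → FixedPoint c₁ c₂) × BitString K

instance instDecidableEqBasis (n m c₁ c₂ K : ℕ) : DecidableEq (Basis n m c₁ c₂ K) :=
  @instDecidableEqProd _ _ inferInstance
    (@instDecidableEqProd _ _ inferInstance (@instDecidableEqProd _ _ inferInstance inferInstance))

/-- The elementary steps of a query algorithm: a fixed unitary on all registers; a query to the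
unitary that evaluates the forward gradient (it is its own inverse); and the loading unitaries of
the input and of the direction, with their inverses. -/
inductive Step (n m c₁ c₂ K : ℕ) : Type
  | free (U : Matrix.unitaryGroup (Basis n m c₁ c₂ K) ℂ)
  | query
  | loadX
  | loadXInv
  | loadV
  | loadVInv

/-- The action of a step on the amplitudes of a state. As `⊕` is an involution, the line for a query is
`|i⟩|w⟩|y⟩|z⟩ ↦ |i⟩|w⟩|y ⊕ F(i,w)⟩|z⟩`. -/
def Step.apply {n m K : ℕ}
    (F : BitString m → (Fin n → FixedPoint c₁ c₂) → Fin n → FixedPoint c₁ c₂)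
    (P : Matrix.unitaryGroup (BitString m) ℂ)
    (V : Matrix.unitaryGroup (Fin n → FixedPoint c₁ c₂) ℂ) :
    Step n m c₁ c₂ K → (Basis n m c₁ c₂ K → ℂ) → Basis n m c₁ c₂ K → ℂ
  | .free U, ψ => U.1.mulVec ψ
  | .query, ψ => fun (i, w, y, z) => ψ (i, w, fun j => fpXor (y j) (F i w j), z)
  | .loadX, ψ => fun (i, w, y, z) => ∑ i', P.1 i i' * ψ (i', w, y, z)
  | .loadXInv, ψ => fun (i, w, y, z) => ∑ i', star (P.1 i' i) * ψ (i', w, y, z)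
  | .loadV, ψ => fun (i, w, y, z) => ∑ w', V.1 w w' * ψ (i, w', y, z)
  | .loadVInv, ψ => fun (i, w, y, z) => ∑ w', star (V.1 w' w) * ψ (i, w', y, z)

/-- A quantum query algorithm: a list of steps, carried out in this order on `|0…0⟩`, then a
measurement in the computational basis, whose outcome is turned into a vector of `n` reals. -/
structure QueryAlgorithm (n m c₁ c₂ : ℕ) where
  workspace : ℕ
  steps : List (Step n m c₁ c₂ workspace)
  output : Basis n m c₁ c₂ workspace → Fin n → ℝ

/-- The number of queries of a step to the unitary that evaluates the forward gradient. -/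
def Step.cost {n m K : ℕ} : Step n m c₁ c₂ K → ℕ
  | .query => 1
  | _ => 0

namespace QueryAlgorithm

variable {n m : ℕ} (A : QueryAlgorithm n m c₁ c₂)

/-- The number of queries to the unitary that evaluates the forward gradient. -/
def queries : ℕ := (A.steps.map Step.cost).sum

/-- The state `|0…0⟩`. -/
def initState : Basis n m c₁ c₂ A.workspace → ℂ :=
  Pi.single (fun _ => false, fun _ => fpZero, fun _ => fpZero, fun _ => false) 1

/-- The state before the measurement. -/
def finalState (F : BitString m → (Fin n → FixedPoint c₁ c₂) → Fin n → FixedPoint c₁ c₂)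
    (P : Matrix.unitaryGroup (BitString m) ℂ)
    (V : Matrix.unitaryGroup (Fin n → FixedPoint c₁ c₂) ℂ) :
    Basis n m c₁ c₂ A.workspace → ℂ :=
  A.steps.foldl (fun ψ s => s.apply F P V ψ) A.initState

/-- The probability that the output lies in `S`. -/
def prob (F : BitString m → (Fin n → FixedPoint c₁ c₂) → Fin n → FixedPoint c₁ c₂)
    (P : Matrix.unitaryGroup (BitString m) ℂ)
    (V : Matrix.unitaryGroup (Fin n → FixedPoint c₁ c₂) ℂ) (S : Set (Fin n → ℝ)) : ℝ :=
  ∑ b, (A.output ⁻¹' S).indicator (fun b => ‖A.finalState F P V b‖ ^ 2) b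

end QueryAlgorithm

end FwdGrad

end

noncomputable section

namespace FwdGrad

/-! ### Moments of the forward gradient -/

/-! Variance. For a fixed input with gradient `a`, the moments `E[v_k v_l v_j²]` of independent
standard normals give `E[((a · v) v_j)²] = ‖a‖² + 2 a_j²`, which is at most `(n + 2) * gMax`. The
variance is at most the second moment, and averaging over the input preserves the bound.

Queries. Since `E[v vᵀ] = 1`, the mean of the forward gradient is the mean gradient
(`fwdGradMean_eq_sum`), so it suffices to estimate the latter. The oracle is evaluated at integer
directions `w`: one nonzero coordinate of `(∇f · w) w`, divided by `w_j`, gives back `∇f · w`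
(`abs_decodeInner_sub_le`). If a superposition of grid points `w`, with a smooth product window as
amplitudes, acquires the phase `∑ φ_k w_k`, where `φ` is the rescaled mean gradient, then a Fourier
transform concentrates on characters whose values on the unit vectors are near `exp (i φ_k)`
(`sum_far_fourier_phaseState_le`).

The phase is produced coherently for each `w`. The positive part of `∇f(X_i) · w`, divided by a
bound `Λ = n M / 2` in rescaled units, is encoded as the probability of a flag, whose mean over the
input is `p`. The Grover operator `Q` satisfies `(Q + Q⁻¹) Ψ = 2 (1 - 2p) Ψ` on the prepared state
(`groverOp_add_inv`). On a clock of size `M'` that holds `Q ^ t Ψ` under a smooth window, the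
symmetrized shift therefore acts almost as the scalar `1 - 2p`, and a Lipschitz function of that
shift acts almost as `exp (i Λ p)` (`phaseUnitary_sub_phase_le`,
`sum_norm_sq_conjKernelOp_sub_phase_le`). A second stage with `-Λ` treats the negative part. No
spectral decomposition of `Q` is needed.

Cost. The squared error of the phase is of order `Λ² (h⁴ + p h²)` with `h = 2π / M'`. Under the
window the coordinates of `w` are independent and centred, so `|∇f · w|` is typically of order `√n
M`, and the average of `p` is of order `n ^ (-1/2)` (`sum_pointWindow_sq_mul_abs_le`). Hence `M' ~ n
^ (3/4) M` suffices. The readout has a fourth-power tail in each of the `n` coordinates, so `M ~ n ^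
(1/4) √g / ε` suffices. The number of queries is of order `M' ~ n √g / ε`, and `d ≥ 1` gives the
stated bound. If `n = 0` or `ε ≥ √g`, the estimate `0` is already good enough. -/

theorem integral_sq_gaussianReal_std : ∫ x, x ^ 2 ∂gaussianReal 0 1 = 1 := by
  have h := variance_fun_id_gaussianReal (μ := 0) (v := 1)
  rw [variance_eq_integral measurable_id'.aemeasurable] at h
  simpa using h

/-- The fourth moment is the fourth derivative at `0` of the moment generating function `exp (t² /
2)`, computed one derivative at a time. -/
theorem integral_pow_four_gaussianReal_std : ∫ x, x ^ 4 ∂gaussianReal 0 1 = 3 := by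
  have h0 : ∫ ω, ω ^ 4 ∂(gaussianReal 0 1)
      = iteratedDeriv 4 (mgf (fun x ↦ x) (gaussianReal 0 1)) 0 := by
    rw [iteratedDeriv_mgf_zero] <;> simp
  rw [h0, mgf_fun_id_gaussianReal]
  have e : ∀ t : ℝ, HasDerivAt (fun t : ℝ => Real.exp (t ^ 2 / 2)) (t * Real.exp (t ^ 2 / 2)) t := by
    intro t
    have h : HasDerivAt (fun t : ℝ => t ^ 2 / 2) t t := by
      simpa using (hasDerivAt_pow 2 t).div_const 2
    simpa [mul_comm] using h.exp
  have d1 : deriv (fun t : ℝ => Real.exp (t ^ 2 / 2)) = fun t => t * Real.exp (t ^ 2 / 2) :=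
    funext fun t => (e t).deriv
  have d2 : deriv (fun t : ℝ => t * Real.exp (t ^ 2 / 2))
      = fun t => (1 + t ^ 2) * Real.exp (t ^ 2 / 2) := by
    funext t
    refine ((hasDerivAt_id' t).fun_mul (e t)).deriv.trans ?_
    ring
  have d3 : deriv (fun t : ℝ => (1 + t ^ 2) * Real.exp (t ^ 2 / 2))
      = fun t => (3 * t + t ^ 3) * Real.exp (t ^ 2 / 2) := by
    funext t
    refine (((hasDerivAt_pow 2 t).const_add 1).fun_mul (e t)).deriv.trans ?_
    simp; ring
  have d4 : deriv (fun t : ℝ => (3 * t + t ^ 3) * Real.exp (t ^ 2 / 2)) 0 = 3 := by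
    refine ((((hasDerivAt_id' (0 : ℝ)).const_mul 3).fun_add (hasDerivAt_pow 3 (0 : ℝ))).fun_mul
      (e 0)).deriv.trans ?_
    simp
  have : (fun t : ℝ => Real.exp (0 * t + ((1 : NNReal) : ℝ) * t ^ 2 / 2))
      = fun t => Real.exp (t ^ 2 / 2) := by
    funext t; simp
  rw [this, iteratedDeriv_succ, iteratedDeriv_succ, iteratedDeriv_succ, iteratedDeriv_one,
    d1, d2, d3, d4]

theorem integrable_pow_gaussianReal_std (k : ℕ) :
    Integrable (fun x : ℝ => x ^ k) (gaussianReal 0 1) := by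
  have h := memLp_id_gaussianReal' (μ := 0) (v := 1) (k : ENNReal) (by simp)
  have := h.integrable_norm_pow'
  refine (integrable_norm_iff (by fun_prop)).1 ?_
  simpa using this

instance (n : ℕ) : IsProbabilityMeasure (stdGauss n) := by
  unfold stdGauss; infer_instance

instance {m : ℕ} (p : PMF (BitString m)) (n : ℕ) : IsProbabilityMeasure (jointLaw p n) := by
  unfold jointLaw; infer_instance

theorem integrable_prod_pow_stdGauss {n : ℕ} (e : Fin n → ℕ) :
    Integrable (fun v : Fin n → ℝ => ∏ i, v i ^ e i) (stdGauss n) :=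
  Integrable.fintype_prod (f := fun i (x : ℝ) => x ^ e i)
    fun i => integrable_pow_gaussianReal_std (e i)

theorem integral_prod_pow_stdGauss {n : ℕ} (e : Fin n → ℕ) :
    ∫ v, ∏ i, v i ^ e i ∂stdGauss n = ∏ i, ∫ x, x ^ e i ∂gaussianReal 0 1 :=
  integral_fintype_prod_eq_prod (fun i (x : ℝ) => x ^ e i)

theorem prod_pow_two_deg {n : ℕ} (v : Fin n → ℝ) (k j : Fin n) :
    ∏ i, v i ^ ((if k = i then 1 else 0) + (if j = i then 1 else 0)) = v k * v j := by
  simp only [pow_add, Finset.prod_mul_distrib]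
  simp

/-- Puts the mixed moment in the form of a monomial over all coordinates, so that the integral over
the product measure factors. Coinciding indices then need no separate treatment. -/
theorem prod_pow_four_deg {n : ℕ} (v : Fin n → ℝ) (k l j : Fin n) :
    ∏ i, v i ^ ((if k = i then 1 else 0) + (if l = i then 1 else 0)
      + ((if j = i then 1 else 0) + (if j = i then 1 else 0))) = v k * v l * v j ^ 2 := by
  simp only [pow_add, Finset.prod_mul_distrib]
  simp [pow_two]

theorem integrable_mul_stdGauss {n : ℕ} (k j : Fin n) :
    Integrable (fun v : Fin n → ℝ => v k * v j) (stdGauss n) := by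
  simpa only [prod_pow_two_deg] using integrable_prod_pow_stdGauss
    (fun i : Fin n => (if k = i then 1 else 0) + (if j = i then 1 else 0))

theorem integrable_mul_mul_sq_stdGauss {n : ℕ} (k l j : Fin n) :
    Integrable (fun v : Fin n → ℝ => v k * v l * v j ^ 2) (stdGauss n) := by
  simpa only [prod_pow_four_deg] using integrable_prod_pow_stdGauss
    (fun i : Fin n => (if k = i then 1 else 0) + (if l = i then 1 else 0)
      + ((if j = i then 1 else 0) + (if j = i then 1 else 0)))

theorem integral_mul_stdGauss {n : ℕ} (k j : Fin n) :
    ∫ v, v k * v j ∂stdGauss n = if k = j then 1 else 0 := by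
  have h := integral_prod_pow_stdGauss
    (fun i : Fin n => (if k = i then 1 else 0) + (if j = i then 1 else 0))
  simp only [prod_pow_two_deg] at h
  rw [h]
  split_ifs with hkj
  · subst hkj
    refine Finset.prod_eq_one fun i _ => ?_
    split_ifs <;> simp [integral_sq_gaussianReal_std]
  · refine Finset.prod_eq_zero (Finset.mem_univ k) ?_
    simp [Ne.symm hkj]

/-- If `k ≠ l`, one of them differs from `j` and enters with exponent one, so its factor has mean
zero. If `k = l`, the factors are second moments, except for one fourth moment when all three
indices agree. -/
theorem integral_mul_mul_sq_stdGauss {n : ℕ} (k l j : Fin n) :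
    ∫ v, v k * v l * v j ^ 2 ∂stdGauss n =
      if k = l then (if k = j then 3 else 1) else 0 := by
  have h := integral_prod_pow_stdGauss
    (fun i : Fin n => (if k = i then 1 else 0) + (if l = i then 1 else 0)
      + ((if j = i then 1 else 0) + (if j = i then 1 else 0)))
  simp only [prod_pow_four_deg] at h
  rw [h]
  by_cases hkl : k = l
  · subst hkl
    by_cases hkj : k = j
    · subst hkj
      rw [Finset.prod_eq_single k]
      · simp [integral_pow_four_gaussianReal_std]
      · intro b _ hb; simp [Ne.symm hb]
      · simp
    · rw [if_pos rfl, if_neg hkj]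
      refine Finset.prod_eq_one fun i _ => ?_
      by_cases h1 : k = i
      · subst h1
        simp [integral_sq_gaussianReal_std, Ne.symm hkj]
      · by_cases h2 : j = i <;> simp [h1, h2, integral_sq_gaussianReal_std]
  · rw [if_neg hkl]
    by_cases hkj : k = j
    · subst hkj
      refine Finset.prod_eq_zero (Finset.mem_univ l) ?_
      simp [hkl]
    · refine Finset.prod_eq_zero (Finset.mem_univ k) ?_
      simp [Ne.symm hkl, Ne.symm hkj]

theorem inner_toLp_eq_sum {n : ℕ} (a : EuclideanSpace ℝ (Fin n)) (v : Fin n → ℝ) :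
    inner ℝ a (WithLp.toLp 2 v) = ∑ k, a k * v k := by
  simp [PiLp.inner_apply, mul_comm]

theorem fwdGrad_eq_sum {n d : ℕ} (f : EuclideanSpace ℝ (Fin n) → EuclideanSpace ℝ (Fin d) → ℝ)
    (θ : EuclideanSpace ℝ (Fin n)) (x : EuclideanSpace ℝ (Fin d)) (v : Fin n → ℝ) (j : Fin n) :
    fwdGrad f θ x v j = ∑ k, grad f θ x k * (v k * v j) := by
  simp only [fwdGrad, inner_toLp_eq_sum, Finset.sum_mul, mul_assoc]

theorem fwdGrad_sq_eq_sum {n d : ℕ} (f : EuclideanSpace ℝ (Fin n) → EuclideanSpace ℝ (Fin d) → ℝ)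
    (θ : EuclideanSpace ℝ (Fin n)) (x : EuclideanSpace ℝ (Fin d)) (v : Fin n → ℝ) (j : Fin n) :
    fwdGrad f θ x v j ^ 2 =
      ∑ k, ∑ l, grad f θ x k * grad f θ x l * (v k * v l * v j ^ 2) := by
  rw [fwdGrad_eq_sum, pow_two, Finset.sum_mul_sum]
  exact Finset.sum_congr rfl fun k _ => Finset.sum_congr rfl fun l _ => by ring

theorem integrable_fwdGrad {n d : ℕ} (f : EuclideanSpace ℝ (Fin n) → EuclideanSpace ℝ (Fin d) → ℝ)
    (θ : EuclideanSpace ℝ (Fin n)) (x : EuclideanSpace ℝ (Fin d)) (j : Fin n) :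
    Integrable (fun v => fwdGrad f θ x v j) (stdGauss n) := by
  simp only [fwdGrad_eq_sum]
  exact integrable_finsetSum _ fun k _ => (integrable_mul_stdGauss k j).const_mul _

theorem integrable_fwdGrad_sq {n d : ℕ}
    (f : EuclideanSpace ℝ (Fin n) → EuclideanSpace ℝ (Fin d) → ℝ)
    (θ : EuclideanSpace ℝ (Fin n)) (x : EuclideanSpace ℝ (Fin d)) (j : Fin n) :
    Integrable (fun v => fwdGrad f θ x v j ^ 2) (stdGauss n) := by
  simp only [fwdGrad_sq_eq_sum]
  exact integrable_finsetSum _ fun k _ => integrable_finsetSum _ fun l _ =>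
    (integrable_mul_mul_sq_stdGauss k l j).const_mul _

theorem integral_fwdGrad {n d : ℕ} (f : EuclideanSpace ℝ (Fin n) → EuclideanSpace ℝ (Fin d) → ℝ)
    (θ : EuclideanSpace ℝ (Fin n)) (x : EuclideanSpace ℝ (Fin d)) (j : Fin n) :
    ∫ v, fwdGrad f θ x v j ∂stdGauss n = grad f θ x j := by
  simp only [fwdGrad_eq_sum]
  rw [integral_finsetSum _ fun k _ => (integrable_mul_stdGauss k j).const_mul _]
  simp [integral_const_mul, integral_mul_stdGauss]

theorem integral_fwdGrad_sq {n d : ℕ}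
    (f : EuclideanSpace ℝ (Fin n) → EuclideanSpace ℝ (Fin d) → ℝ)
    (θ : EuclideanSpace ℝ (Fin n)) (x : EuclideanSpace ℝ (Fin d)) (j : Fin n) :
    ∫ v, fwdGrad f θ x v j ^ 2 ∂stdGauss n =
      ∑ k, grad f θ x k ^ 2 + 2 * grad f θ x j ^ 2 := by
  simp only [fwdGrad_sq_eq_sum]
  rw [integral_finsetSum _ fun k _ => integrable_finsetSum _ fun l _ =>
    (integrable_mul_mul_sq_stdGauss k l j).const_mul _]
  have : ∀ k, ∫ v : Fin n → ℝ, ∑ l, grad f θ x k * grad f θ x l * (v k * v l * v j ^ 2) ∂stdGauss n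
      = grad f θ x k ^ 2 + if k = j then 2 * grad f θ x k ^ 2 else 0 := by
    intro k
    rw [integral_finsetSum _ fun l _ => (integrable_mul_mul_sq_stdGauss k l j).const_mul _]
    simp only [integral_const_mul, integral_mul_mul_sq_stdGauss]
    simp only [mul_ite, mul_zero, Finset.sum_ite_eq, Finset.mem_univ, if_true]
    split_ifs <;> ring
  simp [this, Finset.sum_add_distrib]

theorem integrable_jointLaw {n m : ℕ} (p : PMF (BitString m))
    (G : BitString m × (Fin n → ℝ) → ℝ)
    (hG : ∀ i, Integrable (fun v => G (i, v)) (stdGauss n)) (hm : Measurable G) :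
    Integrable G (jointLaw p n) := by
  unfold jointLaw
  rw [integrable_prod_iff hm.aestronglyMeasurable]
  exact ⟨Filter.Eventually.of_forall hG, Integrable.of_finite⟩

theorem integral_jointLaw {n m : ℕ} (p : PMF (BitString m))
    (G : BitString m × (Fin n → ℝ) → ℝ)
    (hG : ∀ i, Integrable (fun v => G (i, v)) (stdGauss n)) (hm : Measurable G) :
    ∫ z, G z ∂jointLaw p n = ∑ i, (p i).toReal * ∫ v, G (i, v) ∂stdGauss n := by
  have h := integrable_jointLaw p G hG hm
  unfold jointLaw at h ⊢
  rw [integral_prod _ h, PMF.integral_eq_sum]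
  rfl

theorem measurable_fwdGradCoord {n d m : ℕ}
    (f : EuclideanSpace ℝ (Fin n) → EuclideanSpace ℝ (Fin d) → ℝ)
    (θ : EuclideanSpace ℝ (Fin n)) (X : BitString m → EuclideanSpace ℝ (Fin d)) (j : Fin n) :
    Measurable (fwdGradCoord f θ X j) := by
  refine measurable_from_prod_countable_right fun i => ?_
  simp only [fwdGradCoord, fwdGrad_eq_sum]
  fun_prop

theorem sq_grad_le_gMax {n d m : ℕ} (f : EuclideanSpace ℝ (Fin n) → EuclideanSpace ℝ (Fin d) → ℝ)
    (θ : EuclideanSpace ℝ (Fin n)) (X : BitString m → EuclideanSpace ℝ (Fin d))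
    (p : PMF (BitString m)) {i : BitString m} (hi : i ∈ p.support) (k : Fin n) :
    grad f θ (X i) k ^ 2 ≤ gMax f θ X p := by
  unfold gMax
  have h1 : |grad f θ (X i) k| ≤ ‖(fun j => grad f θ (X i) j : Fin n → ℝ)‖ :=
    norm_le_pi_norm (fun j => grad f θ (X i) j : Fin n → ℝ) k
  have h2 := le_ciSup (f := fun i : p.support => ‖(fun j => grad f θ (X i) j : Fin n → ℝ)‖)
    (Set.finite_range _).bddAbove ⟨i, hi⟩
  rw [← sq_abs]
  exact pow_le_pow_left₀ (abs_nonneg _) (h1.trans h2) 2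

theorem sum_toReal_pmf {m : ℕ} (p : PMF (BitString m)) : ∑ i, (p i).toReal = 1 := by
  rw [← ENNReal.toReal_sum fun i _ => p.apply_ne_top i, ← tsum_fintype (L := .unconditional _),
    p.tsum_coe]
  simp

theorem memLp_fwdGradCoord {n d m : ℕ}
    (f : EuclideanSpace ℝ (Fin n) → EuclideanSpace ℝ (Fin d) → ℝ)
    (θ : EuclideanSpace ℝ (Fin n)) (X : BitString m → EuclideanSpace ℝ (Fin d))
    (p : PMF (BitString m)) (j : Fin n) :
    MemLp (fwdGradCoord f θ X j) 2 (jointLaw p n) := by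
  have hm := measurable_fwdGradCoord f θ X j
  rw [memLp_two_iff_integrable_sq hm.aestronglyMeasurable]
  exact integrable_jointLaw p _ (fun i => integrable_fwdGrad_sq f θ (X i) j) (hm.pow_const 2)

/-- Variance is bounded by the second moment, input by input. `gMax` controls only the inputs of
positive probability; the others have weight zero. -/
theorem variance_fwdGradCoord_le {n d m : ℕ}
    (f : EuclideanSpace ℝ (Fin n) → EuclideanSpace ℝ (Fin d) → ℝ)
    (θ : EuclideanSpace ℝ (Fin n)) (X : BitString m → EuclideanSpace ℝ (Fin d))
    (p : PMF (BitString m)) (j : Fin n) :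
    variance (fwdGradCoord f θ X j) (jointLaw p n) ≤ ((n : ℝ) + 2) * gMax f θ X p := by
  have hm := measurable_fwdGradCoord f θ X j
  refine (variance_le_expectation_sq hm.aestronglyMeasurable).trans ?_
  simp only [Pi.pow_apply]
  rw [integral_jointLaw p _ (fun i => integrable_fwdGrad_sq f θ (X i) j) (hm.pow_const 2)]
  have key : ∀ i, (p i).toReal * ∫ v, fwdGradCoord f θ X j (i, v) ^ 2 ∂stdGauss n
      ≤ (p i).toReal * (((n : ℝ) + 2) * gMax f θ X p) := by
    intro i
    by_cases hi : i ∈ p.support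
    · refine mul_le_mul_of_nonneg_left ?_ ENNReal.toReal_nonneg
      have := integral_fwdGrad_sq f θ (X i) j
      simp only [fwdGradCoord]
      rw [this]
      have h1 : ∑ k, grad f θ (X i) k ^ 2 ≤ ∑ _k : Fin n, gMax f θ X p :=
        Finset.sum_le_sum fun k _ => sq_grad_le_gMax f θ X p hi k
      have h2 := sq_grad_le_gMax f θ X p hi j
      simp at h1
      linarith
    · have : p i = 0 := by simpa [PMF.mem_support_iff] using hi
      simp [this]
  refine (Finset.sum_le_sum fun i _ => key i).trans ?_
  rw [← Finset.sum_mul, sum_toReal_pmf, one_mul]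

/-- The mean of the forward gradient is the mean of the gradient. -/
theorem fwdGradMean_eq_sum {n d m : ℕ}
    (f : EuclideanSpace ℝ (Fin n) → EuclideanSpace ℝ (Fin d) → ℝ)
    (θ : EuclideanSpace ℝ (Fin n)) (X : BitString m → EuclideanSpace ℝ (Fin d))
    (p : PMF (BitString m)) (j : Fin n) :
    fwdGradMean f θ X p j = ∑ i, (p i).toReal * grad f θ (X i) j := by
  unfold fwdGradMean
  rw [integral_jointLaw p _ (fun i => integrable_fwdGrad f θ (X i) j)
    (measurable_fwdGradCoord f θ X j)]
  simp only [fwdGradCoord, integral_fwdGrad]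

/-! ### Fourier analysis on a finite abelian group -/

section Fourier

open Complex

variable {B : Type*} [Fintype B]

theorem ofReal_sum_norm_sq_eq_dotProduct (v : B → ℂ) :
    ((∑ b, ‖v b‖ ^ 2 : ℝ) : ℂ) = star v ⬝ᵥ v := by
  simp [dotProduct, Complex.conj_mul']

variable [DecidableEq B]

theorem sum_norm_sq_unitary_mulVec (U : Matrix.unitaryGroup B ℂ) (v : B → ℂ) :
    ∑ b, ‖U.1.mulVec v b‖ ^ 2 = ∑ b, ‖v b‖ ^ 2 := by
  have h : star U.1 * U.1 = 1 := Matrix.mem_unitaryGroup_iff'.1 U.2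
  rw [← Complex.ofReal_inj, ofReal_sum_norm_sq_eq_dotProduct, ofReal_sum_norm_sq_eq_dotProduct,
    Matrix.star_mulVec, Matrix.dotProduct_mulVec, Matrix.vecMul_vecMul,
    ← Matrix.star_eq_conjTranspose, h, Matrix.vecMul_one]

theorem unitary_inv_mulVec_mulVec (U : Matrix.unitaryGroup B ℂ) (v : B → ℂ) :
    (U⁻¹).1.mulVec (U.1.mulVec v) = v := by
  rw [Matrix.mulVec_mulVec, ← Submonoid.coe_mul, inv_mul_cancel]
  simp

theorem unitary_mulVec_inv_mulVec (U : Matrix.unitaryGroup B ℂ) (v : B → ℂ) :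
    U.1.mulVec ((U⁻¹).1.mulVec v) = v := by
  rw [Matrix.mulVec_mulVec, ← Submonoid.coe_mul, mul_inv_cancel]
  simp

/-- The diagonal unitary with the given phases. -/
def diagUnitary (d : B → ℂ) (hd : ∀ b, ‖d b‖ = 1) : Matrix.unitaryGroup B ℂ :=
  ⟨Matrix.diagonal d, by
    rw [Matrix.mem_unitaryGroup_iff, Matrix.star_eq_conjTranspose, Matrix.diagonal_conjTranspose,
      Matrix.diagonal_mul_diagonal, ← Matrix.diagonal_one]
    congr 1
    funext b
    simp [Complex.mul_conj', hd]⟩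

theorem diagUnitary_mulVec (d : B → ℂ) (hd : ∀ b, ‖d b‖ = 1) (v : B → ℂ) (b : B) :
    (diagUnitary d hd).1.mulVec v b = d b * v b := by
  simp [diagUnitary, Matrix.mulVec_diagonal]

variable {G : Type*} [AddCommGroup G] [Fintype G] [DecidableEq G]

/-- The matrix of the Fourier transform of a finite abelian group, for a given labelling of the
characters by the elements of the group. -/
def fourierUnitary (e : G ≃ AddChar G ℂ) : Matrix.unitaryGroup G ℂ :=
  ⟨Matrix.of fun y g => (√(Fintype.card G : ℝ) : ℂ)⁻¹ * star (e y g), by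
    rw [Matrix.mem_unitaryGroup_iff']
    ext g g'
    have h1 : ∑ y, e y g * star (e y g') = ∑ ψ : AddChar G ℂ, ψ (g - g') := by
      rw [← Equiv.sum_comp e]
      refine Finset.sum_congr rfl fun y _ => ?_
      rw [AddChar.map_sub_eq_div, div_eq_mul_inv, ← AddChar.map_neg_eq_inv,
        AddChar.map_neg_eq_conj]
      rfl
    have h2 : (√(Fintype.card G : ℝ) : ℂ)⁻¹ * (√(Fintype.card G : ℝ) : ℂ)⁻¹
        = (Fintype.card G : ℂ)⁻¹ := by
      rw [← mul_inv, ← Complex.ofReal_mul, Real.mul_self_sqrt (by positivity)]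
      simp
    have h3 : (star (Matrix.of fun y g => (√(Fintype.card G : ℝ) : ℂ)⁻¹ * star (e y g)) *
        (Matrix.of fun y g => (√(Fintype.card G : ℝ) : ℂ)⁻¹ * star (e y g))) g g'
        = (Fintype.card G : ℂ)⁻¹ * ∑ y, e y g * star (e y g') := by
      rw [← h2, Finset.mul_sum, Matrix.mul_apply]
      refine Finset.sum_congr rfl fun y _ => ?_
      simp
      ring
    rw [h3, h1, AddChar.sum_apply_eq_ite, Matrix.one_apply]
    simp only [sub_eq_zero]
    split_ifs <;> simp⟩

theorem fourierUnitary_mulVec (e : G ≃ AddChar G ℂ) (v : G → ℂ) (y : G) :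
    (fourierUnitary e).1.mulVec v y
      = (√(Fintype.card G : ℝ) : ℂ)⁻¹ * ∑ g, star (e y g) * v g := by
  simp [fourierUnitary, Matrix.mulVec, dotProduct, Finset.mul_sum, mul_assoc]

theorem fourierUnitary_mulVec_shift (e : G ≃ AddChar G ℂ) (v : G → ℂ) (a y : G) :
    (fourierUnitary e).1.mulVec (fun g => v (g + a)) y
      = e y a * (fourierUnitary e).1.mulVec v y := by
  rw [fourierUnitary_mulVec, fourierUnitary_mulVec, mul_left_comm]
  congr 1
  rw [Finset.mul_sum]
  rw [← Equiv.sum_comp (Equiv.addRight a) (fun g => e y a * (star (e y g) * v g))]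
  refine Finset.sum_congr rfl fun g _ => ?_
  have h : e y a * star (e y a) = 1 := by
    have := Complex.mul_conj' (e y a)
    rw [AddChar.norm_apply] at this
    simpa using this
  simp only [Equiv.coe_addRight, AddChar.map_add_eq_mul, star_mul]
  linear_combination (-(star (e y g) * v (g + a))) * h

theorem fourierUnitary_mulVec_shift_neg (e : G ≃ AddChar G ℂ) (v : G → ℂ) (a y : G) :
    (fourierUnitary e).1.mulVec (fun g => v (g - a)) y
      = star (e y a) * (fourierUnitary e).1.mulVec v y := by
  have := fourierUnitary_mulVec_shift e v (-a) y
  simp only [← sub_eq_add_neg] at this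
  rw [this, AddChar.map_neg_eq_conj]
  rfl

/-- A function of the symmetrized shift by `a`, at which the phase `exp (i Λ (1 - c) / 2)` is
attached to the eigenvalue `c`. -/
def phaseUnitary (e : G ≃ AddChar G ℂ) (a : G) (Λ : ℝ) : Matrix.unitaryGroup G ℂ :=
  (fourierUnitary e)⁻¹ * diagUnitary (fun y => exp ((Λ * (1 - (e y a).re) / 2 : ℝ) * I))
    (fun _ => Complex.norm_exp_ofReal_mul_I _) * fourierUnitary e

theorem norm_exp_mul_I_sub_le (x y : ℝ) : ‖exp (x * I) - exp (y * I)‖ ≤ |x - y| := by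
  have h : exp (x * I) - exp (y * I) = exp (y * I) * (exp (I * (x - y : ℝ)) - 1) := by
    rw [mul_sub, ← Complex.exp_add]
    push_cast
    ring_nf
  rw [h, norm_mul, Complex.norm_exp_ofReal_mul_I, one_mul]
  simpa using Real.norm_exp_I_mul_ofReal_sub_one_le (x := x - y)

/-- The Fourier transform diagonalizes the shift by `a`, and the symmetrized shift has the real
eigenvalues `(e y a).re`. The phase is a `|Λ| / 2`-Lipschitz function of the eigenvalue, so if `v`
is nearly an eigenvector with value `c`, the phase of `c` is nearly the one applied. -/
theorem phaseUnitary_sub_phase_le (e : G ≃ AddChar G ℂ) (a : G) (Λ c : ℝ) (v : G → ℂ) :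
    ∑ t, ‖(phaseUnitary e a Λ).1.mulVec v t - exp ((Λ * (1 - c) / 2 : ℝ) * I) * v t‖ ^ 2
      ≤ (Λ / 2) ^ 2 * ∑ t, ‖(v (t + a) + v (t - a)) / 2 - c * v t‖ ^ 2 := by
  set F := fourierUnitary e
  have hl : ∑ t, ‖(phaseUnitary e a Λ).1.mulVec v t - exp ((Λ * (1 - c) / 2 : ℝ) * I) * v t‖ ^ 2
      = ∑ y, ‖(exp ((Λ * (1 - (e y a).re) / 2 : ℝ) * I) - exp ((Λ * (1 - c) / 2 : ℝ) * I))
          * F.1.mulVec v y‖ ^ 2 := by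
    rw [← sum_norm_sq_unitary_mulVec F]
    refine Finset.sum_congr rfl fun y _ => ?_
    have h1 : (fun t => (phaseUnitary e a Λ).1.mulVec v t - exp ((Λ * (1 - c) / 2 : ℝ) * I) * v t)
        = (phaseUnitary e a Λ).1.mulVec v - exp ((Λ * (1 - c) / 2 : ℝ) * I) • v := by
      funext t; simp
    rw [h1, Matrix.mulVec_sub, Matrix.mulVec_smul, phaseUnitary, Submonoid.coe_mul,
      Submonoid.coe_mul, ← Matrix.mulVec_mulVec, ← Matrix.mulVec_mulVec,
      unitary_mulVec_inv_mulVec]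
    simp only [Pi.sub_apply, diagUnitary_mulVec, Pi.smul_apply, smul_eq_mul]
    rw [sub_mul]
  have hr : ∑ t, ‖(v (t + a) + v (t - a)) / 2 - c * v t‖ ^ 2
      = ∑ y, ‖(((e y a).re - c : ℝ) : ℂ) * F.1.mulVec v y‖ ^ 2 := by
    rw [← sum_norm_sq_unitary_mulVec F]
    refine Finset.sum_congr rfl fun y _ => ?_
    have h1 : (fun t => (v (t + a) + v (t - a)) / 2 - c * v t)
        = (1 / 2 : ℂ) • ((fun t => v (t + a)) + fun t => v (t - a)) - (c : ℂ) • v := by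
      funext t; simp; ring
    rw [h1, Matrix.mulVec_sub, Matrix.mulVec_smul, Matrix.mulVec_smul, Matrix.mulVec_add]
    simp only [Pi.sub_apply, Pi.smul_apply, Pi.add_apply, smul_eq_mul, F,
      fourierUnitary_mulVec_shift, fourierUnitary_mulVec_shift_neg]
    have h2 : ((e y a).re : ℂ) = (e y a + star (e y a)) / 2 := Complex.re_eq_add_conj _
    push_cast
    rw [h2]
    congr 2
    ring
  rw [hl, hr, Finset.mul_sum]
  refine Finset.sum_le_sum fun y _ => ?_
  rw [norm_mul, norm_mul, mul_pow, mul_pow, ← mul_assoc]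
  refine mul_le_mul_of_nonneg_right ?_ (by positivity)
  rw [Complex.norm_real, ← sq_abs (Λ / 2), ← mul_pow]
  refine pow_le_pow_left₀ (norm_nonneg _) ((norm_exp_mul_I_sub_le _ _).trans (le_of_eq ?_)) 2
  rw [Real.norm_eq_abs, ← abs_mul, ← abs_neg]
  congr 1
  ring

/-- The twisted second difference is diagonal in the Fourier basis, with eigenvalue `-‖χ a - exp (φ
i)‖²` at the character `χ`. Parseval thus turns its squared norm into a fourth moment of the chord
length. -/
theorem sum_chord_pow_four_fourier (e : G ≃ AddChar G ℂ) (a : G) (φ : ℝ) (v : G → ℂ) :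
    ∑ y, ‖e y a - exp (φ * I)‖ ^ 4 * ‖(fourierUnitary e).1.mulVec v y‖ ^ 2
      = ∑ u, ‖exp (-(φ * I)) * v (u + a) + exp (φ * I) * v (u - a) - 2 * v u‖ ^ 2 := by
  symm
  rw [← sum_norm_sq_unitary_mulVec (fourierUnitary e)]
  refine Finset.sum_congr rfl fun y _ => ?_
  have h1 : (fun u => exp (-(φ * I)) * v (u + a) + exp (φ * I) * v (u - a) - 2 * v u)
      = exp (-(φ * I)) • (fun u => v (u + a)) + exp (φ * I) • (fun u => v (u - a))
        - (2 : ℂ) • v := by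
    funext u; simp
  rw [h1, Matrix.mulVec_sub, Matrix.mulVec_add, Matrix.mulVec_smul, Matrix.mulVec_smul,
    Matrix.mulVec_smul]
  simp only [Pi.sub_apply, Pi.smul_apply, Pi.add_apply, smul_eq_mul,
    fourierUnitary_mulVec_shift, fourierUnitary_mulVec_shift_neg]
  set w := (fourierUnitary e).1.mulVec v y
  set χ := e y a
  have hχ : χ * star χ = 1 := by
    have := Complex.mul_conj' χ
    rw [AddChar.norm_apply] at this
    simpa using this
  have hz : star (exp (φ * I)) = exp (-(φ * I)) := by
    rw [Complex.star_def, ← Complex.exp_conj]; simp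
  have hz1 : exp (φ * I) * exp (-(φ * I)) = 1 := by
    rw [← Complex.exp_add]; simp
  have h2 : ((‖χ - exp (φ * I)‖ ^ 2 : ℝ) : ℂ)
      = 2 - exp (-(φ * I)) * χ - exp (φ * I) * star χ := by
    push_cast
    rw [← Complex.mul_conj', map_sub]
    change (χ - exp (φ * I)) * (star χ - star (exp (φ * I))) = _
    rw [hz]
    linear_combination hχ + hz1
  have h3 : exp (-(φ * I)) * (χ * w) + exp (φ * I) * (star χ * w) - 2 * w
      = -((‖χ - exp (φ * I)‖ ^ 2 : ℝ) : ℂ) * w := by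
    rw [h2]; ring
  rw [h3, norm_mul, norm_neg, Complex.norm_real, mul_pow, Real.norm_eq_abs, sq_abs]
  ring

end Fourier

/-! ### A smooth window on a cyclic group -/

section Window

open Real

variable (M : ℕ)

/-- The unnormalized window `sin² (π t / M)`. -/
def rawWindow (t : ZMod M) : ℝ := (1 - cos (2 * π * t.val / M)) / 2

theorem rawWindow_zero : rawWindow M 0 = 0 := by simp [rawWindow]

theorem rawWindow_nonneg (t : ZMod M) : 0 ≤ rawWindow M t := by
  have := cos_le_one (2 * π * t.val / M)
  unfold rawWindow; linarith

variable [NeZero M]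

/-- The window `sin² (π t / M)`, normalized in `ℓ²`. -/
def window (t : ZMod M) : ℝ := rawWindow M t / √(∑ s, rawWindow M s ^ 2)

theorem rawWindow_intCast (k : ℤ) : rawWindow M (k : ZMod M) = (1 - cos (2 * π * k / M)) / 2 := by
  have hM : (M : ℝ) ≠ 0 := Nat.cast_ne_zero.2 (NeZero.ne M)
  have h1 : (((k : ZMod M).val : ℤ) : ℝ) = ((k % M : ℤ) : ℝ) := by rw [ZMod.val_intCast]
  have h2 : (k : ℝ) = ((k % M : ℤ) : ℝ) + (M : ℝ) * ((k / M : ℤ) : ℝ) := by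
    exact_mod_cast (Int.emod_add_mul_ediv k M).symm
  have h3 : 2 * π * (k : ℝ) / M
      = 2 * π * ((k : ZMod M).val : ℝ) / M + ((k / M : ℤ) : ℝ) * (2 * π) := by
    rw [h2, ← h1]
    push_cast
    field_simp
  rw [rawWindow, h3, cos_add_int_mul_two_pi]

theorem rawWindow_add_int (t : ZMod M) (k : ℤ) :
    rawWindow M (t + k) = (1 - cos (2 * π * t.val / M + k * (2 * π / M))) / 2 := by
  have : t + k = ((t.val + k : ℤ) : ZMod M) := by push_cast; simp
  rw [this, rawWindow_intCast]
  push_cast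
  ring_nf

theorem rawWindow_succ (t : ZMod M) :
    rawWindow M (t + 1) = (1 - cos (2 * π * t.val / M + 2 * π / M)) / 2 := by
  simpa using rawWindow_add_int M t 1

theorem rawWindow_pred (t : ZMod M) :
    rawWindow M (t - 1) = (1 - cos (2 * π * t.val / M - 2 * π / M)) / 2 := by
  have := rawWindow_add_int M t (-1)
  simpa [← sub_eq_add_neg] using this

theorem rawWindow_neg (t : ZMod M) : rawWindow M (-t) = rawWindow M t := by
  have : -t = ((-(t.val : ℤ) : ℤ) : ZMod M) := by push_cast; simp
  rw [this, rawWindow_intCast, rawWindow]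
  push_cast
  rw [mul_neg, neg_div, cos_neg]

/-- Pair `t` with `t + M / 2`: the cosine changes sign, and the two squares add up to `(1 + cos²) /
2 ≥ 1 / 2`. -/
theorem le_sum_rawWindow_sq (hM : Even M) : (M : ℝ) / 4 ≤ ∑ s, rawWindow M s ^ 2 := by
  obtain ⟨k, rfl⟩ := hM
  have hk : (k : ℝ) ≠ 0 := by
    have := NeZero.ne (k + k)
    exact_mod_cast fun h => this (by omega)
  have h1 : ∑ s, rawWindow (k + k) (s + (k : ℤ)) ^ 2 = ∑ s, rawWindow (k + k) s ^ 2 :=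
    Equiv.sum_comp (Equiv.addRight ((k : ℤ) : ZMod (k + k))) fun s => rawWindow (k + k) s ^ 2
  have h2 : ∀ s, 1 / 2 ≤ rawWindow (k + k) (s + (k : ℤ)) ^ 2 + rawWindow (k + k) s ^ 2 := by
    intro s
    have : ((k : ℤ) : ℝ) * (2 * π / ((k + k : ℕ) : ℝ)) = π := by
      push_cast
      field_simp
      ring
    rw [rawWindow_add_int, this, cos_add_pi, rawWindow]
    nlinarith [sq_nonneg (cos (2 * π * s.val / ((k + k : ℕ) : ℝ)))]
  have h3 := Finset.sum_le_sum fun s (_ : s ∈ Finset.univ) => h2 s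
  rw [Finset.sum_add_distrib, h1] at h3
  simp only [Finset.sum_const, Finset.card_univ, ZMod.card, nsmul_eq_mul] at h3
  linarith

theorem sum_rawWindow_sq_pos (hM : Even M) : 0 < ∑ s, rawWindow M s ^ 2 := by
  have : (0 : ℝ) < M := Nat.cast_pos.2 (NeZero.pos M)
  linarith [le_sum_rawWindow_sq M hM]

theorem sum_window_sq (hM : Even M) : ∑ t, window M t ^ 2 = 1 := by
  have := sum_rawWindow_sq_pos M hM
  simp only [window, div_pow, sq_sqrt this.le]
  rw [← Finset.sum_div, div_self this.ne']

theorem window_zero : window M 0 = 0 := by simp [window, rawWindow_zero]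

theorem window_nonneg (t : ZMod M) : 0 ≤ window M t :=
  div_nonneg (rawWindow_nonneg M t) (sqrt_nonneg _)

theorem window_neg (t : ZMod M) : window M (-t) = window M t := by
  rw [window, rawWindow_neg, window]

theorem div_sqrt_sum_rawWindow_sq_le (hM : Even M) {x y : ℝ} (hx : |x| ≤ y) :
    |x / √(∑ s, rawWindow M s ^ 2)| ≤ 2 * y / √M := by
  have hM' : (0 : ℝ) < M := Nat.cast_pos.2 (NeZero.pos M)
  have h1 : √M / 2 ≤ √(∑ s, rawWindow M s ^ 2) := by
    refine le_sqrt_of_sq_le ?_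
    rw [div_pow, sq_sqrt hM'.le]
    have := le_sum_rawWindow_sq M hM
    linarith
  have h2 : 0 < √(M : ℝ) := sqrt_pos.2 hM'
  rw [abs_div, abs_of_nonneg (sqrt_nonneg _)]
  calc |x| / √(∑ s, rawWindow M s ^ 2) ≤ y / (√M / 2) :=
        div_le_div₀ ((abs_nonneg x).trans hx) hx (by positivity) h1
    _ = 2 * y / √M := by field_simp

/-- For the step `h = 2π / M` the second difference of `(1 - cos) / 2` is `cos * (1 - cos h)`, of
order `h²`; the normalization contributes `2 / √M`. -/
theorem abs_window_second_difference_le (hM : Even M) (t : ZMod M) :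
    |window M (t + 1) + window M (t - 1) - 2 * window M t| ≤ (2 * π / M) ^ 2 / √M := by
  have h : window M (t + 1) + window M (t - 1) - 2 * window M t
      = (cos (2 * π * t.val / M) * (1 - cos (2 * π / M))) / √(∑ s, rawWindow M s ^ 2) := by
    simp only [window, rawWindow_succ, rawWindow_pred]
    rw [rawWindow, cos_add, cos_sub]
    ring
  rw [h]
  refine (div_sqrt_sum_rawWindow_sq_le M hM (y := (2 * π / M) ^ 2 / 2) ?_).trans (le_of_eq ?_)
  · have h1 := cos_le_one (2 * π / M)
    have h2 := one_sub_sq_div_two_le_cos (x := 2 * π / M)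
    rw [abs_mul, abs_of_nonneg (by linarith : 0 ≤ 1 - cos (2 * π / M))]
    calc _ ≤ 1 * (1 - cos (2 * π / M)) :=
          mul_le_mul_of_nonneg_right (abs_cos_le_one _) (by linarith)
      _ ≤ _ := by linarith
  · ring

theorem abs_window_succ_sub_pred_le (hM : Even M) (t : ZMod M) :
    |window M (t + 1) - window M (t - 1)| ≤ 2 * (2 * π / M) / √M := by
  have h : window M (t + 1) - window M (t - 1)
      = (sin (2 * π * t.val / M) * sin (2 * π / M)) / √(∑ s, rawWindow M s ^ 2) := by
    simp only [window, rawWindow_succ, rawWindow_pred]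
    rw [cos_add, cos_sub]
    ring
  rw [h]
  refine div_sqrt_sum_rawWindow_sq_le M hM ?_
  rw [abs_mul]
  have h1 := abs_sin_le_one (2 * π * t.val / M)
  have h2 : |sin (2 * π / M)| ≤ |2 * π / M| := abs_sin_le_abs
  rw [abs_of_nonneg (by positivity : 0 ≤ 2 * π / (M : ℝ))] at h2
  calc _ ≤ 1 * |sin (2 * π / M)| := mul_le_mul_of_nonneg_right h1 (abs_nonneg _)
    _ ≤ _ := by linarith

/-- The clock is cyclic while `Z` need not be periodic. The two sides could differ only at the
wraparound `t + 1 = 0`, and there the window vanishes. -/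
theorem window_succ_smul {V : Type*} [AddCommGroup V] [Module ℝ V] (Z : ℤ → V) (t : ZMod M) :
    window M (t + 1) • Z (t + 1).val = window M (t + 1) • Z (t.val + 1) := by
  by_cases h : t.val + 1 < M
  · have h1 : (1 : ZMod M).val = 1 ∨ M = 1 := by
      rcases Nat.lt_or_ge 1 M with h | h
      · have : Fact (1 < M) := ⟨h⟩
        exact Or.inl (ZMod.val_one M)
      · have := NeZero.pos M
        omega
    rcases h1 with h1 | h1
    · rw [ZMod.val_add_of_lt (by omega), h1]
      simp
    · omega
  · have h2 : t + 1 = 0 := by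
      have h3 := ZMod.val_lt t
      have h4 : t.val + 1 = M := by omega
      have h5 : ((t.val + 1 : ℕ) : ZMod M) = 0 := by rw [h4, ZMod.natCast_self]
      simpa using h5
    rw [h2, window_zero, zero_smul, zero_smul]

theorem val_pred_of_ne_zero {t : ZMod M} (ht : t ≠ 0) : ((t - 1).val : ℤ) = t.val - 1 := by
  have h0 : t.val ≠ 0 := fun h => ht ((ZMod.val_eq_zero t).1 h)
  have h1 : t.val < M := ZMod.val_lt t
  have h2 : t - 1 = ((t.val - 1 : ℕ) : ZMod M) := by
    rw [Nat.cast_sub (by omega)]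
    simp
  rw [h2, ZMod.val_natCast, Nat.mod_eq_of_lt (by omega)]
  omega

theorem norm_window_phase_second_difference_le (hM : Even M) (φ : ℝ) (t : ZMod M) :
    ‖Complex.exp (-(φ * Complex.I)) * ((window M (t + 1) : ℂ) * Complex.exp ((t + 1).val * (φ * Complex.I)))
      + Complex.exp (φ * Complex.I) * ((window M (t - 1) : ℂ) * Complex.exp ((t - 1).val * (φ * Complex.I)))
      - 2 * ((window M t : ℂ) * Complex.exp (t.val * (φ * Complex.I)))‖ ≤ (2 * π / M) ^ 2 / √M := by
  have hn : ∀ k : ℕ, ‖Complex.exp (k * (φ * Complex.I))‖ = 1 := fun k => by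
    have : (k : ℂ) * (φ * Complex.I) = ((k * φ : ℝ) : ℂ) * Complex.I := by push_cast; ring
    rw [this, Complex.norm_exp_ofReal_mul_I]
  have hn1 : ‖Complex.exp (φ * Complex.I)‖ = 1 := Complex.norm_exp_ofReal_mul_I φ
  have hn2 : ‖Complex.exp (-(φ * Complex.I))‖ = 1 := by rw [Complex.exp_neg, norm_inv, hn1, inv_one]
  have hb := abs_window_second_difference_le M hM t
  -- At `t = 0` the neighbours lie at opposite ends of the range and their phases do not match.
  -- Since the window vanishes at `0` and is nonnegative, the triangle inequality still gives
  -- exactly its second difference.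
  by_cases ht : t = 0
  · subst ht
    rw [window_zero] at hb ⊢
    have h1 := window_nonneg M (0 + 1)
    have h2 := window_nonneg M (0 - 1)
    refine le_trans ?_ ((le_abs_self _).trans hb)
    simp only [Complex.ofReal_zero, zero_mul, mul_zero, sub_zero]
    refine (norm_add_le _ _).trans (le_of_eq ?_)
    rw [norm_mul, norm_mul, norm_mul, norm_mul, hn1, hn2, hn, hn, Complex.norm_real,
      Complex.norm_real, Real.norm_of_nonneg h1, Real.norm_of_nonneg h2]
    ring
  · have h1 := window_succ_smul M (fun k : ℤ => Complex.exp (k * (φ * Complex.I))) t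
    simp only [Complex.real_smul, Int.cast_natCast] at h1
    have h2 : ((t - 1).val : ℂ) = t.val - 1 := by exact_mod_cast val_pred_of_ne_zero M ht
    rw [h1, h2]
    have h3 : Complex.exp (-(φ * Complex.I)) * Complex.exp (φ * Complex.I) = 1 := by
      rw [← Complex.exp_add]; simp
    have h4 : Complex.exp (((t.val : ℤ) + 1 : ℤ) * (φ * Complex.I))
        = Complex.exp (t.val * (φ * Complex.I)) * Complex.exp (φ * Complex.I) := by
      rw [← Complex.exp_add]; push_cast; ring_nf
    have h5 : Complex.exp (((t.val : ℂ) - 1) * (φ * Complex.I))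
        = Complex.exp (t.val * (φ * Complex.I)) * Complex.exp (-(φ * Complex.I)) := by
      rw [← Complex.exp_add]; ring_nf
    have h6 : Complex.exp (-(φ * Complex.I)) * ((window M (t + 1) : ℂ)
          * Complex.exp (((t.val : ℤ) + 1 : ℤ) * (φ * Complex.I)))
        + Complex.exp (φ * Complex.I) * ((window M (t - 1) : ℂ)
          * Complex.exp (((t.val : ℂ) - 1) * (φ * Complex.I)))
        - 2 * ((window M t : ℂ) * Complex.exp (t.val * (φ * Complex.I)))
        = ((window M (t + 1) + window M (t - 1) - 2 * window M t : ℝ) : ℂ)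
          * Complex.exp (t.val * (φ * Complex.I)) := by
      rw [h4, h5]
      push_cast
      linear_combination ((window M (t + 1) : ℂ) + window M (t - 1))
        * Complex.exp (t.val * (φ * Complex.I)) * h3
    rw [h6, norm_mul, hn, mul_one, Complex.norm_real]
    exact hb

/-- The element of `ZMod M`, as an integer centred at `0`. -/
def centred (t : ZMod M) : ℤ := t.val - (M / 2 : ℕ)

theorem abs_centred_le (hM : Even M) (t : ZMod M) : |(centred M t : ℝ)| ≤ M / 2 := by
  obtain ⟨k, hk⟩ := hM
  have h1 : (t.val : ℝ) ≤ M := by exact_mod_cast (ZMod.val_lt t).le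
  have h2 : ((M / 2 : ℕ) : ℝ) = M / 2 := by
    rw [hk, show (k + k) / 2 = k by omega]
    push_cast; ring
  have h3 : (0 : ℝ) ≤ t.val := by positivity
  unfold centred
  rw [Int.cast_sub, Int.cast_natCast, Int.cast_natCast, h2, abs_le]
  constructor <;> linarith

/-- Symmetry under `t ↦ -t`, which changes the sign of the centred value. The exception is `t = 0`,
whose centred value `-M / 2` has no partner, but the window vanishes there. -/
theorem sum_window_sq_mul_centred (hM : Even M) : ∑ t, window M t ^ 2 * (centred M t : ℝ) = 0 := by
  have h : ∑ t, window M t ^ 2 * (centred M t : ℝ)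
      = -∑ t, window M t ^ 2 * (centred M t : ℝ) := by
    conv_lhs => rw [← Equiv.sum_comp (Equiv.neg (ZMod M))]
    rw [← Finset.sum_neg_distrib]
    refine Finset.sum_congr rfl fun t _ => ?_
    rw [Equiv.neg_apply, window_neg]
    by_cases ht : t = 0
    · simp [ht, window_zero]
    · have h1 : ((-t).val : ℤ) = M - t.val := by
        have : NeZero t := ⟨ht⟩
        rw [ZMod.val_neg_of_ne_zero]
        have := ZMod.val_lt t
        omega
      have h2 : centred M (-t) = -centred M t := by
        obtain ⟨k, hk⟩ := hM
        unfold centred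
        omega
      rw [h2]
      push_cast
      ring
  linarith

end Window

/-! ### Second moments of linear forms under product weights -/

section ProductWeights

variable {T : Type*} [Fintype T] {n : ℕ}

theorem sum_prod_pi (f : Fin n → T → ℝ) :
    ∑ u : Fin n → T, ∏ k, f k (u k) = ∏ k, ∑ t, f k t :=
  (Fintype.prod_sum f).symm

/-- Under product weights the coordinates are independent with mean zero, so the cross terms of the
square vanish and each diagonal term is at most `R²`. -/
theorem sum_prod_mul_linear_sq_le (π w : T → ℝ) (hπ : ∀ t, 0 ≤ π t) (hπ1 : ∑ t, π t = 1)
    (hw : ∑ t, π t * w t = 0) {R : ℝ} (hR : ∀ t, |w t| ≤ R) (c : Fin n → ℝ) :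
    ∑ u : Fin n → T, (∏ k, π (u k)) * (∑ k, c k * w (u k)) ^ 2 ≤ R ^ 2 * ∑ k, c k ^ 2 := by
  have hR0 : ∀ t, w t ^ 2 ≤ R ^ 2 := fun t => by
    rw [← sq_abs]
    exact pow_le_pow_left₀ (abs_nonneg _) (hR t) 2
  have h0 : ∀ k l : Fin n, ∑ u : Fin n → T, (∏ i, π (u i)) * (w (u k) * w (u l))
      = ∏ i, ∑ t, π t * ((if i = k then w t else 1) * (if i = l then w t else 1)) := by
    intro k l
    rw [← sum_prod_pi fun i t => π t * ((if i = k then w t else 1) * (if i = l then w t else 1))]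
    refine Finset.sum_congr rfl fun u _ => ?_
    rw [Finset.prod_mul_distrib, Finset.prod_mul_distrib]
    simp
  have h1 : ∀ k l : Fin n, k ≠ l →
      ∑ u : Fin n → T, (∏ i, π (u i)) * (w (u k) * w (u l)) = 0 := by
    intro k l hkl
    rw [h0]
    refine Finset.prod_eq_zero (Finset.mem_univ k) ?_
    simpa [hkl] using hw
  have h2 : ∀ k : Fin n, ∑ u : Fin n → T, (∏ i, π (u i)) * (w (u k) * w (u k)) ≤ R ^ 2 := by
    intro k
    rw [h0, Finset.prod_eq_single k]
    · calc ∑ t, π t * ((if k = k then w t else 1) * (if k = k then w t else 1))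
          ≤ ∑ t, π t * R ^ 2 := Finset.sum_le_sum fun t _ => by
            refine mul_le_mul_of_nonneg_left ?_ (hπ t)
            simpa [pow_two] using hR0 t
        _ = R ^ 2 := by rw [← Finset.sum_mul, hπ1, one_mul]
    · intro i _ hi
      simp [hi, hπ1]
    · simp
  have h3 : ∑ u : Fin n → T, (∏ k, π (u k)) * (∑ k, c k * w (u k)) ^ 2
      = ∑ k, ∑ l, c k * c l * ∑ u : Fin n → T, (∏ i, π (u i)) * (w (u k) * w (u l)) := by
    have h4 : ∀ u : Fin n → T, (∑ k, c k * w (u k)) ^ 2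
        = ∑ k, ∑ l, c k * w (u k) * (c l * w (u l)) := fun u => by rw [pow_two, Finset.sum_mul_sum]
    simp only [h4, Finset.mul_sum]
    rw [Finset.sum_comm]
    refine Finset.sum_congr rfl fun k _ => ?_
    rw [Finset.sum_comm]
    exact Finset.sum_congr rfl fun l _ => Finset.sum_congr rfl fun u _ => by ring
  rw [h3, Finset.mul_sum]
  refine Finset.sum_le_sum fun k _ => ?_
  rw [Finset.sum_eq_single k (fun l _ hl => by rw [h1 k l hl.symm, mul_zero]) (by simp)]
  rw [← pow_two, mul_comm]
  exact mul_le_mul_of_nonneg_right (h2 k) (sq_nonneg _)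

end ProductWeights

/-! ### Coherent phase estimation of a product of two reflections -/

section PhaseEstimation

variable {H : Type*} [NormedAddCommGroup H] [InnerProductSpace ℂ H]

/-- The parallelogram law for the unit vectors `Q Ψ` and `Q⁻¹ Ψ`, whose sum has norm `2 |c|`. -/
theorem norm_sq_apply_sub_inv_apply {Q : H ≃ₗᵢ[ℂ] H} {Ψ : H} (hΨ : ‖Ψ‖ = 1) {c : ℝ}
    (hQ : Q Ψ + Q⁻¹ Ψ = ((2 * c : ℝ) : ℂ) • Ψ) : ‖Q Ψ - Q⁻¹ Ψ‖ ^ 2 = 4 * (1 - c ^ 2) := by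
  have h := parallelogram_law_with_norm ℂ (Q Ψ) (Q⁻¹ Ψ)
  have h2 : ‖Q⁻¹ Ψ‖ = 1 := by rw [LinearIsometryEquiv.norm_map, hΨ]
  rw [hQ, norm_smul, Complex.norm_real, LinearIsometryEquiv.norm_map, h2, hΨ] at h
  have h3 : ‖2 * c‖ * ‖2 * c‖ = 4 * c ^ 2 := by
    rw [Real.norm_eq_abs, abs_mul_abs_self]; ring
  nlinarith

theorem norm_add_sq_le_two_mul (x y : H) : ‖x + y‖ ^ 2 ≤ 2 * (‖x‖ ^ 2 + ‖y‖ ^ 2) := by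
  have h := parallelogram_law_with_norm ℂ x y
  nlinarith [mul_self_nonneg ‖x - y‖]

/-- If the window were constant, the shifts would reproduce `(Q + Q⁻¹) / 2`, that is, the scalar
`c`. The defect splits into a second difference of the window along `Ψ` and a first difference along
`(Q - Q⁻¹) Ψ`. The latter vector has squared norm `4 (1 - c²)`, which is small when the flag is
rarely raised; this is what makes a small `p` cheap. -/
theorem norm_sq_window_average_le (M : ℕ) [NeZero M] (hM : Even M) {Q : H ≃ₗᵢ[ℂ] H} {Ψ : H}
    (hΨ : ‖Ψ‖ = 1) {c : ℝ} (hQ : Q Ψ + Q⁻¹ Ψ = ((2 * c : ℝ) : ℂ) • Ψ) (hc : c ^ 2 ≤ 1)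
    (t : ZMod M) :
    ‖(2⁻¹ : ℂ) • ((window M (t + 1) : ℂ) • (Q ^ (t + 1).val) Ψ
        + (window M (t - 1) : ℂ) • (Q ^ (t - 1).val) Ψ)
      - (c : ℂ) • ((window M t : ℂ) • (Q ^ t.val) Ψ)‖ ^ 2
    ≤ 2⁻¹ * ((2 * Real.pi / M) ^ 4 + 4 * (2 * Real.pi / M) ^ 2 * (1 - c ^ 2)) / M := by
  have hM' : (0 : ℝ) < M := Nat.cast_pos.2 (NeZero.pos M)
  set h : ℝ := 2 * Real.pi / M
  have hs : (window M (t + 1) + window M (t - 1) - 2 * window M t) ^ 2 ≤ h ^ 4 / M := by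
    rw [← sq_abs]
    refine (pow_le_pow_left₀ (abs_nonneg _) (abs_window_second_difference_le M hM t) 2).trans ?_
    rw [div_pow, Real.sq_sqrt hM'.le, ← pow_mul]
  have hd : (window M (t + 1) - window M (t - 1)) ^ 2 ≤ 4 * h ^ 2 / M := by
    rw [← sq_abs]
    refine (pow_le_pow_left₀ (abs_nonneg _) (abs_window_succ_sub_pred_le M hM t) 2).trans ?_
    rw [div_pow, Real.sq_sqrt hM'.le]
    refine le_of_eq ?_
    ring
  have hfin : 2⁻¹ * ((window M (t + 1) + window M (t - 1) - 2 * window M t) ^ 2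
        + (window M (t + 1) - window M (t - 1)) ^ 2 * (1 - c ^ 2))
      ≤ 2⁻¹ * (h ^ 4 + 4 * h ^ 2 * (1 - c ^ 2)) / M := by
    have := mul_le_mul_of_nonneg_right hd (by linarith : 0 ≤ 1 - c ^ 2)
    calc _ ≤ 2⁻¹ * (h ^ 4 / M + 4 * h ^ 2 / M * (1 - c ^ 2)) := by linarith
      _ = _ := by ring
  refine le_trans ?_ hfin
  by_cases ht : t = 0
  · subst ht
    rw [window_zero]
    have h1 := window_nonneg M (0 + 1)
    have h2 := window_nonneg M (0 - 1)
    have hn : ‖(2⁻¹ : ℂ) • ((window M (0 + 1) : ℂ) • (Q ^ (0 + 1 : ZMod M).val) Ψ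
        + (window M (0 - 1) : ℂ) • (Q ^ (0 - 1 : ZMod M).val) Ψ)
        - (c : ℂ) • (((0 : ℝ) : ℂ) • (Q ^ (0 : ZMod M).val) Ψ)‖
        ≤ 2⁻¹ * (window M (0 + 1) + window M (0 - 1)) := by
      rw [Complex.ofReal_zero, zero_smul, smul_zero, sub_zero, norm_smul]
      have := norm_add_le ((window M (0 + 1) : ℂ) • (Q ^ (0 + 1 : ZMod M).val) Ψ)
        ((window M (0 - 1) : ℂ) • (Q ^ (0 - 1 : ZMod M).val) Ψ)
      rw [norm_smul, norm_smul, LinearIsometryEquiv.norm_map, LinearIsometryEquiv.norm_map, hΨ,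
        Complex.norm_real, Complex.norm_real, Real.norm_of_nonneg h1, Real.norm_of_nonneg h2] at this
      norm_num
      norm_num at this
      linarith
    refine (pow_le_pow_left₀ (norm_nonneg _) hn 2).trans ?_
    have h3 : 0 ≤ (window M (0 + 1) - window M (0 - 1)) ^ 2 * (1 - c ^ 2) :=
      mul_nonneg (sq_nonneg _) (by linarith)
    nlinarith [sq_nonneg (window M (0 + 1) + window M (0 - 1))]
  · have h1 := window_succ_smul M (fun k : ℤ => (Q ^ k) Ψ) t
    have h2 := val_pred_of_ne_zero M ht
    simp only [← Complex.coe_smul] at h1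
    have e1 : (Q ^ ((t.val : ℤ) + 1)) Ψ = (Q ^ t.val) (Q Ψ) := by
      rw [zpow_add_one, zpow_natCast]; rfl
    have e2 : (Q ^ (t - 1).val) Ψ = (Q ^ t.val) (Q⁻¹ Ψ) := by
      rw [← zpow_natCast, h2, zpow_sub_one, zpow_natCast]; rfl
    rw [zpow_natCast, e1] at h1
    rw [h1, e2]
    have e3 : (2⁻¹ : ℂ) • ((window M (t + 1) : ℂ) • (Q ^ t.val) (Q Ψ)
        + (window M (t - 1) : ℂ) • (Q ^ t.val) (Q⁻¹ Ψ))
        - (c : ℂ) • ((window M t : ℂ) • (Q ^ t.val) Ψ)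
        = (Q ^ t.val) ((2⁻¹ : ℂ) • (((window M (t + 1) + window M (t - 1) - 2 * window M t) * c : ℝ) : ℂ)
          • Ψ + (2⁻¹ : ℂ) • (((window M (t + 1) - window M (t - 1)) / 2 : ℝ) : ℂ)
          • (Q Ψ - Q⁻¹ Ψ)) := by
      have e4 : Q Ψ = ((2 * c : ℝ) : ℂ) • Ψ - Q⁻¹ Ψ := by rw [← hQ]; abel
      rw [e4]
      simp only [map_add, map_sub, map_smul]
      push_cast
      module
    rw [e3, LinearIsometryEquiv.norm_map]
    refine (norm_add_sq_le_two_mul _ _).trans ?_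
    simp only [norm_smul, mul_pow, norm_sq_apply_sub_inv_apply hΨ hQ, hΨ, Complex.norm_real,
      Real.norm_eq_abs, sq_abs]
    have : ‖(2⁻¹ : ℂ)‖ = 2⁻¹ := by norm_num
    rw [this]
    have h3 : (window M (t + 1) + window M (t - 1) - 2 * window M t) ^ 2 * c ^ 2
        ≤ (window M (t + 1) + window M (t - 1) - 2 * window M t) ^ 2 :=
      mul_le_of_le_one_right (sq_nonneg _) hc
    nlinarith

theorem sum_norm_sq_window_average_le (M : ℕ) [NeZero M] (hM : Even M) {Q : H ≃ₗᵢ[ℂ] H} {Ψ : H}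
    (hΨ : ‖Ψ‖ = 1) {p : ℝ} (hQ : Q Ψ + Q⁻¹ Ψ = ((2 * (1 - 2 * p) : ℝ) : ℂ) • Ψ)
    (hp : 0 ≤ p) (hp1 : p ≤ 1) :
    ∑ t : ZMod M, ‖(2⁻¹ : ℂ) • ((window M (t + 1) : ℂ) • (Q ^ (t + 1).val) Ψ
        + (window M (t - 1) : ℂ) • (Q ^ (t - 1).val) Ψ)
      - ((1 - 2 * p : ℝ) : ℂ) • ((window M t : ℂ) • (Q ^ t.val) Ψ)‖ ^ 2
    ≤ 2⁻¹ * ((2 * Real.pi / M) ^ 4 + 16 * p * (2 * Real.pi / M) ^ 2) := by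
  have hM' : (0 : ℝ) < M := Nat.cast_pos.2 (NeZero.pos M)
  refine (Finset.sum_le_sum fun t _ => norm_sq_window_average_le M hM hΨ hQ (by nlinarith) t).trans ?_
  rw [Finset.sum_const, Finset.card_univ, ZMod.card, nsmul_eq_mul, mul_div_cancel₀ _ hM'.ne']
  have h1 : 1 - (1 - 2 * p) ^ 2 ≤ 4 * p := by nlinarith
  nlinarith [mul_le_mul_of_nonneg_left h1 (sq_nonneg (2 * Real.pi / M))]

/-- Applies the kernel `K` to the control register. -/
def kernelOp {T : Type*} [Fintype T] (K : Matrix T T ℂ) (φ : T → H) : T → H :=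
  fun t => ∑ t', K t t' • φ t'

/-- Applies `K` to the control register, in the frame given by the controlled isometries `g`. -/
def conjKernelOp {T : Type*} [Fintype T] (K : Matrix T T ℂ) (g : T → H ≃ₗᵢ[ℂ] H) (φ : T → H) :
    T → H :=
  fun t => (g t)⁻¹ (kernelOp K (fun t' => g t' (φ t')) t)

/-- The product of the reflection about `A e₀`, where `S` is the reflection about `e₀`, and of the
reflection `χ`. -/
def groverOp (A S χ : H ≃ₗᵢ[ℂ] H) : H ≃ₗᵢ[ℂ] H := A * S * A⁻¹ * χ

/-- With `Ψ = A e₀`, the reflection about `Ψ` gives `Q Ψ = 2 c Ψ - χ Ψ`. Since `Q⁻¹` begins with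
that reflection, which fixes `Ψ`, one has `Q⁻¹ Ψ = χ Ψ`. The sum is a multiple of `Ψ`. -/
theorem groverOp_add_inv {A S χ : H ≃ₗᵢ[ℂ] H} {e₀ : H}
    (he₀ : ‖e₀‖ = 1) (hS : ∀ x, S x = (2 * inner ℂ e₀ x) • e₀ - x) (hS2 : S * S = 1) (hχ : χ * χ = 1) {c : ℝ}
    (hc : inner ℂ (A e₀) (χ (A e₀)) = (c : ℂ)) :
    groverOp A S χ (A e₀) + (groverOp A S χ)⁻¹ (A e₀) = ((2 * c : ℝ) : ℂ) • A e₀ := by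
  have hinv : (groverOp A S χ)⁻¹ = χ * A * S * A⁻¹ := by
    rw [groverOp, mul_inv_rev, mul_inv_rev, mul_inv_rev, inv_inv, inv_eq_of_mul_eq_one_right hχ,
      inv_eq_of_mul_eq_one_right hS2, mul_assoc, mul_assoc]
  have hAA : ∀ x, A⁻¹ (A x) = x := fun x => A.symm_apply_apply x
  have hAA' : ∀ x, A (A⁻¹ x) = x := fun x => A.apply_symm_apply x
  have hin : inner ℂ e₀ (A⁻¹ (χ (A e₀))) = (c : ℂ) := by
    rw [← hc, ← LinearIsometryEquiv.inner_map_map A e₀, hAA']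
  have h1 : groverOp A S χ (A e₀) = ((2 * c : ℝ) : ℂ) • A e₀ - χ (A e₀) := by
    change A (S (A⁻¹ (χ (A e₀)))) = _
    rw [hS, hin, map_sub, map_smul, hAA']
    push_cast
    rfl
  have h2 : (groverOp A S χ)⁻¹ (A e₀) = χ (A e₀) := by
    rw [hinv]
    change χ (A (S (A⁻¹ (A e₀)))) = _
    have h3 : inner ℂ e₀ e₀ = (1 : ℂ) := by simp [inner_self_eq_norm_sq_to_K, he₀]
    have h4 : S e₀ = e₀ := by
      rw [hS, h3, mul_one, two_smul, add_sub_cancel_right]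
    rw [hAA, h4]
  rw [h1, h2, sub_add_cancel]

variable {X : Type*} [Fintype X]

theorem sum_norm_sq_kernelOp {T : Type*} [Fintype T] [DecidableEq T] (K : Matrix.unitaryGroup T ℂ)
    (φ : T → EuclideanSpace ℂ X) : ∑ t, ‖kernelOp K.1 φ t‖ ^ 2 = ∑ t, ‖φ t‖ ^ 2 := by
  simp only [EuclideanSpace.norm_sq_eq]
  rw [Finset.sum_comm, Finset.sum_comm (γ := T)]
  refine Finset.sum_congr rfl fun x _ => ?_
  rw [← sum_norm_sq_unitary_mulVec K (fun t => φ t x)]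
  refine Finset.sum_congr rfl fun t _ => ?_
  simp [kernelOp, Matrix.mulVec, dotProduct]

theorem sum_norm_sq_conjKernelOp {T : Type*} [Fintype T] [DecidableEq T]
    (K : Matrix.unitaryGroup T ℂ) (g : T → EuclideanSpace ℂ X ≃ₗᵢ[ℂ] EuclideanSpace ℂ X)
    (φ : T → EuclideanSpace ℂ X) : ∑ t, ‖conjKernelOp K.1 g φ t‖ ^ 2 = ∑ t, ‖φ t‖ ^ 2 := by
  simp only [conjKernelOp, LinearIsometryEquiv.norm_map]
  rw [sum_norm_sq_kernelOp]
  simp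

theorem sum_norm_sq_phaseUnitary_kernelOp_le {T : Type*} [AddCommGroup T] [Fintype T]
    [DecidableEq T] (e : T ≃ AddChar T ℂ) (a : T) (Λ c : ℝ) (φ : T → EuclideanSpace ℂ X) :
    ∑ t, ‖kernelOp (phaseUnitary e a Λ).1 φ t - Complex.exp ((Λ * (1 - c) / 2 : ℝ) * Complex.I) • φ t‖ ^ 2
      ≤ (Λ / 2) ^ 2 * ∑ t, ‖(2⁻¹ : ℂ) • (φ (t + a) + φ (t - a)) - (c : ℂ) • φ t‖ ^ 2 := by
  simp only [EuclideanSpace.norm_sq_eq]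
  rw [Finset.sum_comm, Finset.sum_comm (γ := T), Finset.mul_sum]
  refine Finset.sum_le_sum fun x _ => ?_
  have h := phaseUnitary_sub_phase_le e a Λ c (fun t => φ t x)
  refine (le_of_eq ?_).trans (h.trans (le_of_eq ?_))
  · refine Finset.sum_congr rfl fun t _ => ?_
    simp [kernelOp, Matrix.mulVec, dotProduct]
  · congr 1
    refine Finset.sum_congr rfl fun t _ => ?_
    congr 2
    simp
    ring

/-- The frame `Q ^ t * A` carries the windowed `e₀` to the windowed orbit `Q ^ t Ψ`, on which the
symmetrized clock shift is nearly `1 - 2 p`. The frame is isometric, so the error may be measured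
there. -/
theorem sum_norm_sq_conjKernelOp_sub_phase_le (M : ℕ) [NeZero M] (hM : Even M)
    (e : ZMod M ≃ AddChar (ZMod M) ℂ) (Λ : ℝ)
    {A S χ : EuclideanSpace ℂ X ≃ₗᵢ[ℂ] EuclideanSpace ℂ X} {e₀ : EuclideanSpace ℂ X}
    (he₀ : ‖e₀‖ = 1) (hS : ∀ x, S x = (2 * inner ℂ e₀ x) • e₀ - x) (hS2 : S * S = 1)
    (hχ : χ * χ = 1) {p : ℝ} (hp : 0 ≤ p) (hp1 : p ≤ 1)
    (hc : inner ℂ (A e₀) (χ (A e₀)) = ((1 - 2 * p : ℝ) : ℂ)) :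
    ∑ t : ZMod M, ‖conjKernelOp (phaseUnitary e 1 Λ).1 (fun t => groverOp A S χ ^ t.val * A)
        (fun t => (window M t : ℂ) • e₀) t
      - Complex.exp ((Λ * p : ℝ) * Complex.I) • ((window M t : ℂ) • e₀)‖ ^ 2
      ≤ (Λ / 2) ^ 2 * (2⁻¹ * ((2 * Real.pi / M) ^ 4 + 16 * p * (2 * Real.pi / M) ^ 2)) := by
  set Q := groverOp A S χ
  have hΨ : ‖A e₀‖ = 1 := by rw [LinearIsometryEquiv.norm_map, he₀]
  have hQ := groverOp_add_inv he₀ hS hS2 hχ hc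
  have h1 := sum_norm_sq_phaseUnitary_kernelOp_le e 1 Λ (1 - 2 * p)
    (fun t => (window M t : ℂ) • (Q ^ t.val) (A e₀))
  have h2 := sum_norm_sq_window_average_le M hM hΨ hQ hp hp1
  refine le_trans (le_of_eq ?_) (h1.trans (mul_le_mul_of_nonneg_left h2 (sq_nonneg _)))
  refine Finset.sum_congr rfl fun t _ => ?_
  congr 1
  rw [conjKernelOp, ← LinearIsometryEquiv.norm_map (Q ^ t.val * A)]
  have h3 : Λ * (1 - (1 - 2 * p)) / 2 = Λ * p := by ring
  have h4 : ∀ x, (Q ^ t.val * A) ((Q ^ t.val * A)⁻¹ x) = x :=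
    fun x => (Q ^ t.val * A).apply_symm_apply x
  rw [h3, map_sub, h4, map_smul, map_smul]
  simp only [map_smul]
  rfl

end PhaseEstimation

/-! ### Unitaries acting on a part of a register -/

section Unitaries

variable {B C D : Type*} [Fintype B] [DecidableEq B] [Fintype C] [DecidableEq C]
  [Fintype D]

open Classical in
/-- The unitary on `B ≃ C × D` that applies `M d` to the first factor, controlled by the second. -/
def controlledUnitary (e : B ≃ C × D) (M : D → Matrix.unitaryGroup C ℂ) :
    Matrix.unitaryGroup B ℂ :=
  ⟨(Matrix.blockDiagonal fun d => (M d).1).submatrix e e, by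
    rw [Matrix.mem_unitaryGroup_iff, Matrix.star_eq_conjTranspose, Matrix.conjTranspose_submatrix,
      Matrix.submatrix_mul_equiv, Matrix.blockDiagonal_conjTranspose, ← Matrix.blockDiagonal_mul]
    have : (fun d => (M d).1 * ((M d).1).conjTranspose) = 1 := by
      funext d
      exact Matrix.mem_unitaryGroup_iff.1 (M d).2
    rw [this, Matrix.blockDiagonal_one, Matrix.submatrix_one_equiv]⟩

open Classical in
theorem controlledUnitary_mulVec (e : B ≃ C × D) (M : D → Matrix.unitaryGroup C ℂ) (ψ : B → ℂ)
    (b : B) : (controlledUnitary e M).1.mulVec ψ b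
      = ∑ c, (M (e b).2).1 (e b).1 c * ψ (e.symm (c, (e b).2)) := by
  simp only [controlledUnitary, Matrix.mulVec, dotProduct]
  rw [← Equiv.sum_comp e.symm, Fintype.sum_prod_type]
  refine Finset.sum_congr rfl fun c _ => ?_
  simp [Matrix.blockDiagonal_apply]

/-- The unitary that permutes the basis labels. -/
def permUnitary (σ : B ≃ B) : Matrix.unitaryGroup B ℂ :=
  ⟨(1 : Matrix B B ℂ).submatrix σ (Equiv.refl B), by
    rw [Matrix.mem_unitaryGroup_iff, Matrix.star_eq_conjTranspose, Matrix.conjTranspose_submatrix,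
      Matrix.submatrix_mul_equiv]
    simp⟩

theorem permUnitary_mulVec (σ : B ≃ B) (ψ : B → ℂ) (b : B) :
    (permUnitary σ).1.mulVec ψ b = ψ (σ b) := by
  simp [permUnitary, Matrix.mulVec, dotProduct, Matrix.one_apply]

theorem exists_unitary_mulVec_single (b₀ : B) (v : B → ℂ) (hv : ∑ b, ‖v b‖ ^ 2 = 1) :
    ∃ U : Matrix.unitaryGroup B ℂ, U.1.mulVec (Pi.single b₀ 1) = v := by
  have hn : ‖(WithLp.toLp 2 v : EuclideanSpace ℂ B)‖ = 1 := by
    rw [EuclideanSpace.norm_eq, hv, Real.sqrt_one]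
  have ho : Orthonormal ℂ (({b₀} : Set B).domRestrict
      fun _ : B => (WithLp.toLp 2 v : EuclideanSpace ℂ B)) := by
    rw [orthonormal_iff_ite]
    rintro ⟨i, hi⟩ ⟨j, hj⟩
    have hij : (⟨i, hi⟩ : ({b₀} : Set B)) = ⟨j, hj⟩ := Subtype.ext (hi.trans hj.symm)
    rw [if_pos hij]
    change inner ℂ (WithLp.toLp 2 v : EuclideanSpace ℂ B) (WithLp.toLp 2 v) = 1
    simp [inner_self_eq_norm_sq_to_K, hn]
  obtain ⟨b, hb⟩ := ho.exists_orthonormalBasis_extension_of_card_eq (by simp)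
  refine ⟨⟨(EuclideanSpace.basisFun B ℂ).toBasis.toMatrix b,
    (EuclideanSpace.basisFun B ℂ).toMatrix_orthonormalBasis_mem_unitary b⟩, ?_⟩
  funext c
  rw [Matrix.mulVec_single_one]
  have := hb b₀ rfl
  simp [Module.Basis.toMatrix_apply, this]

/-- The isometry of the Euclidean space given by a unitary matrix. -/
def unitaryIso (U : Matrix.unitaryGroup B ℂ) : EuclideanSpace ℂ B ≃ₗᵢ[ℂ] EuclideanSpace ℂ B :=
  { toFun := fun x => WithLp.toLp 2 (U.1.mulVec x.ofLp)
    invFun := fun x => WithLp.toLp 2 ((U⁻¹).1.mulVec x.ofLp)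
    map_add' := fun x y => by simp [Matrix.mulVec_add]
    map_smul' := fun c x => by simp [Matrix.mulVec_smul]
    left_inv := fun x => congrArg (WithLp.toLp 2) (unitary_inv_mulVec_mulVec U x.ofLp)
    right_inv := fun x => congrArg (WithLp.toLp 2) (unitary_mulVec_inv_mulVec U x.ofLp)
    norm_map' := fun x => by
      rw [EuclideanSpace.norm_eq, EuclideanSpace.norm_eq x]
      exact congrArg Real.sqrt (sum_norm_sq_unitary_mulVec U x.ofLp) }

theorem unitaryIso_apply (U : Matrix.unitaryGroup B ℂ) (x : EuclideanSpace ℂ B) (b : B) :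
    unitaryIso U x b = U.1.mulVec x.ofLp b := rfl

end Unitaries

/-! ### Runs of a query algorithm -/

section Runs

variable {n m c₁ c₂ K : ℕ}
  (F : BitString m → (Fin n → FixedPoint c₁ c₂) → Fin n → FixedPoint c₁ c₂)
  (P : Matrix.unitaryGroup (BitString m) ℂ)
  (V : Matrix.unitaryGroup (Fin n → FixedPoint c₁ c₂) ℂ)

theorem fpXor_self (q : FixedPoint c₁ c₂) : fpXor q q = fpZero := by
  simp [fpXor, fpZero]

theorem fpXor_fpXor_cancel (q r : FixedPoint c₁ c₂) : fpXor (fpXor q r) r = q := by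
  simp [fpXor]

theorem fpXor_eq_right_iff (q r : FixedPoint c₁ c₂) : fpXor q r = r ↔ q = fpZero := by
  constructor
  · intro h
    rw [← fpXor_fpXor_cancel q r, h, fpXor_self]
  · rintro rfl
    simp [fpXor, fpZero]

/-- The state after a list of steps. -/
def run (L : List (Step n m c₁ c₂ K)) (ψ : Basis n m c₁ c₂ K → ℂ) : Basis n m c₁ c₂ K → ℂ :=
  L.foldl (fun ψ s => s.apply F P V ψ) ψ

theorem run_append (L L' : List (Step n m c₁ c₂ K)) (ψ : Basis n m c₁ c₂ K → ℂ) :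
    run F P V (L ++ L') ψ = run F P V L' (run F P V L ψ) := by
  simp [run]

/-- The step that undoes a step. -/
def Step.inv : Step n m c₁ c₂ K → Step n m c₁ c₂ K
  | .free U => .free U⁻¹
  | .query => .query
  | .loadX => .loadXInv
  | .loadXInv => .loadX
  | .loadV => .loadVInv
  | .loadVInv => .loadV

theorem Step.cost_inv (s : Step n m c₁ c₂ K) : s.inv.cost = s.cost := by
  cases s <;> rfl

theorem sum_star_unitary_mul {B : Type*} [Fintype B] [DecidableEq B]
    (U : Matrix.unitaryGroup B ℂ) (f : B → ℂ) (b : B) :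
    ∑ a, star (U.1 a b) * ∑ c, U.1 a c * f c = f b :=
  congrFun (unitary_inv_mulVec_mulVec U f) b

theorem sum_unitary_mul_star {B : Type*} [Fintype B] [DecidableEq B]
    (U : Matrix.unitaryGroup B ℂ) (f : B → ℂ) (b : B) :
    ∑ a, U.1 b a * ∑ c, star (U.1 c a) * f c = f b :=
  congrFun (unitary_mulVec_inv_mulVec U f) b

theorem Step.apply_inv_apply (s : Step n m c₁ c₂ K) (ψ : Basis n m c₁ c₂ K → ℂ) :
    s.inv.apply F P V (s.apply F P V ψ) = ψ := by
  cases s with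
  | free U => exact unitary_inv_mulVec_mulVec U ψ
  | query =>
    funext ⟨i, w, y, z⟩
    simp [Step.inv, Step.apply, fpXor_fpXor_cancel]
  | loadX =>
    funext ⟨i, w, y, z⟩
    exact sum_star_unitary_mul P (fun i' => ψ (i', w, y, z)) i
  | loadXInv =>
    funext ⟨i, w, y, z⟩
    exact sum_unitary_mul_star P (fun i' => ψ (i', w, y, z)) i
  | loadV =>
    funext ⟨i, w, y, z⟩
    exact sum_star_unitary_mul V (fun w' => ψ (i, w', y, z)) w
  | loadVInv =>
    funext ⟨i, w, y, z⟩
    exact sum_unitary_mul_star V (fun w' => ψ (i, w', y, z)) w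

/-- The list of steps that undoes a list of steps. -/
def invSteps (L : List (Step n m c₁ c₂ K)) : List (Step n m c₁ c₂ K) :=
  (L.map Step.inv).reverse

theorem run_invSteps_run (L : List (Step n m c₁ c₂ K)) (ψ : Basis n m c₁ c₂ K → ℂ) :
    run F P V (invSteps L) (run F P V L ψ) = ψ := by
  induction L generalizing ψ with
  | nil => rfl
  | cons s L ih =>
    have h1 : invSteps (s :: L) = invSteps L ++ [s.inv] := by simp [invSteps]
    have h2 : run F P V (s :: L) ψ = run F P V L (s.apply F P V ψ) := rfl
    rw [h1, h2, run_append, ih]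
    exact s.apply_inv_apply F P V ψ

/-- The number of queries of a list of steps. -/
def stepsCost (L : List (Step n m c₁ c₂ K)) : ℕ := (L.map Step.cost).sum

theorem stepsCost_append (L L' : List (Step n m c₁ c₂ K)) :
    stepsCost (L ++ L') = stepsCost L + stepsCost L' := by
  simp [stepsCost]

theorem stepsCost_invSteps (L : List (Step n m c₁ c₂ K)) :
    stepsCost (invSteps L) = stepsCost L := by
  have : Step.cost ∘ Step.inv = (Step.cost : Step n m c₁ c₂ K → ℕ) := funext Step.cost_inv
  simp [stepsCost, invSteps, this]

end Runs

/-! ### Operations realized by lists of steps -/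

section Realization

/-- The amplitudes of the flag qubit and of the input register. -/
abbrev FlagInput (m : ℕ) : Type := EuclideanSpace ℂ (Bool × BitString m)

variable {n m c₁ c₂ K : ℕ} {U T : Type}
  (ez : BitString K ≃ U × T × Bool) (enc : U → Fin n → FixedPoint c₁ c₂)

/-- The state with the given amplitudes for the point `u`, the clock `t`, the flag qubit and the
input register, in which the direction register holds `enc u` and the result register holds `0`. -/
def embedState (φ : U → T → FlagInput m) : Basis n m c₁ c₂ K → ℂ := fun (i, w, y, z) =>
  if w = enc (ez z).1 ∧ y = (fun _ => fpZero) then φ (ez z).1 (ez z).2.1 ((ez z).2.2, i) else 0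

/-- Applies isometries of the flag qubit and the input register, controlled by the point and the
clock. -/
def fiberOp (g : U → T → FlagInput m ≃ₗᵢ[ℂ] FlagInput m) (φ : U → T → FlagInput m) :
    U → T → FlagInput m :=
  fun u t => g u t (φ u t)

/-- The list `L` of steps acts on the embedded states as `op`. -/
def Realizes (F : BitString m → (Fin n → FixedPoint c₁ c₂) → Fin n → FixedPoint c₁ c₂)
    (P : Matrix.unitaryGroup (BitString m) ℂ)
    (V : Matrix.unitaryGroup (Fin n → FixedPoint c₁ c₂) ℂ) (L : List (Step n m c₁ c₂ K))
    (op : (U → T → FlagInput m) → U → T → FlagInput m) : Prop :=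
  ∀ φ, run F P V L (embedState ez enc φ) = embedState ez enc (op φ)

variable {F : BitString m → (Fin n → FixedPoint c₁ c₂) → Fin n → FixedPoint c₁ c₂}
    {P : Matrix.unitaryGroup (BitString m) ℂ}
    {V : Matrix.unitaryGroup (Fin n → FixedPoint c₁ c₂) ℂ}

variable {ez enc}

theorem Realizes.append {L L' : List (Step n m c₁ c₂ K)}
    {op op' : (U → T → FlagInput m) → U → T → FlagInput m} (h : Realizes ez enc F P V L op)
    (h' : Realizes ez enc F P V L' op') : Realizes ez enc F P V (L ++ L') (op' ∘ op) := by
  intro φ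
  rw [run_append, h, h']
  rfl

theorem Realizes.append_fiberOp {L L' : List (Step n m c₁ c₂ K)}
    {g g' : U → T → FlagInput m ≃ₗᵢ[ℂ] FlagInput m} (h : Realizes ez enc F P V L (fiberOp g))
    (h' : Realizes ez enc F P V L' (fiberOp g')) :
    Realizes ez enc F P V (L ++ L') (fiberOp fun u t => g' u t * g u t) :=
  h.append h'

theorem Realizes.invSteps {L : List (Step n m c₁ c₂ K)}
    {g : U → T → FlagInput m ≃ₗᵢ[ℂ] FlagInput m} (h : Realizes ez enc F P V L (fiberOp g)) :
    Realizes ez enc F P V (invSteps L) (fiberOp fun u t => (g u t)⁻¹) := by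
  intro φ
  have h1 : φ = fiberOp g (fiberOp (fun u t => (g u t)⁻¹) φ) := by
    funext u t
    exact ((g u t).apply_symm_apply _).symm
  conv_lhs => rw [h1]
  rw [← h, run_invSteps_run]

theorem Realizes.congr_fiberOp {L : List (Step n m c₁ c₂ K)}
    {g g' : U → T → FlagInput m ≃ₗᵢ[ℂ] FlagInput m} (h : Realizes ez enc F P V L (fiberOp g))
    (hg : ∀ u t, g u t = g' u t) : Realizes ez enc F P V L (fiberOp g') := by
  rwa [show g' = g from funext fun u => funext fun t => (hg u t).symm]

theorem realizes_nil : Realizes ez enc F P V [] (fiberOp fun _ _ => 1) := fun _ => rfl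

/-- The isometry of the flag qubit and the input register given by a unitary of the latter. -/
def inputIso (P : Matrix.unitaryGroup (BitString m) ℂ) : FlagInput m ≃ₗᵢ[ℂ] FlagInput m :=
  unitaryIso (controlledUnitary (Equiv.prodComm Bool (BitString m)) fun _ => P)

theorem inputIso_apply (x : FlagInput m) (b : Bool) (i : BitString m) :
    inputIso P x (b, i) = ∑ i', P.1 i i' * x (b, i') := by
  rw [inputIso, unitaryIso_apply, controlledUnitary_mulVec]
  rfl

theorem realizes_loadX :
    Realizes ez enc F P V [Step.loadX] (fiberOp fun _ _ => inputIso P) := by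
  intro φ
  funext ⟨i, w, y, z⟩
  change ∑ i', P.1 i i' * embedState ez enc φ (i', w, y, z) = _
  simp only [embedState, fiberOp, inputIso_apply]
  split_ifs <;> simp

/-- The isometry given by phases. -/
def phaseIso (d : Bool × BitString m → ℂ) (hd : ∀ x, ‖d x‖ = 1) :
    FlagInput m ≃ₗᵢ[ℂ] FlagInput m :=
  unitaryIso (diagUnitary d hd)

theorem phaseIso_apply (d : Bool × BitString m → ℂ) (hd : ∀ x, ‖d x‖ = 1) (x : FlagInput m)
    (j : Bool × BitString m) : phaseIso d hd x j = d j * x j := by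
  rw [phaseIso, unitaryIso_apply, diagUnitary_mulVec]

variable (ez c₁ c₂ n) in
/-- The step that applies phases, controlled by the point and the clock. -/
def phaseStep (d : U → T → Bool × BitString m → ℂ) (hd : ∀ u t x, ‖d u t x‖ = 1) :
    Step n m c₁ c₂ K :=
  .free (diagUnitary (fun b => d (ez b.2.2.2).1 (ez b.2.2.2).2.1 ((ez b.2.2.2).2.2, b.1))
    fun _ => hd _ _ _)

theorem realizes_phaseStep (d : U → T → Bool × BitString m → ℂ) (hd : ∀ u t x, ‖d u t x‖ = 1) :
    Realizes ez enc F P V [phaseStep n c₁ c₂ ez d hd]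
      (fiberOp fun u t => phaseIso (d u t) (hd u t)) := by
  intro φ
  funext ⟨i, w, y, z⟩
  change (diagUnitary _ _).1.mulVec _ _ = _
  rw [diagUnitary_mulVec]
  simp only [embedState, fiberOp, phaseIso_apply]
  split_ifs <;> simp

variable (ez c₁ c₂ n m) in
/-- Separates the clock from the other registers. -/
def clockEquiv : Basis n m c₁ c₂ K ≃
    T × (BitString m × (Fin n → FixedPoint c₁ c₂) × (Fin n → FixedPoint c₁ c₂) × U × Bool) where
  toFun b := ((ez b.2.2.2).2.1, b.1, b.2.1, b.2.2.1, (ez b.2.2.2).1, (ez b.2.2.2).2.2)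
  invFun x := (x.2.1, x.2.2.1, x.2.2.2.1, ez.symm (x.2.2.2.2.1, x.1, x.2.2.2.2.2))
  left_inv b := by simp
  right_inv x := by simp

variable (ez c₁ c₂ n m) in
/-- Separates the flag qubit from the other registers. -/
def flagEquiv : Basis n m c₁ c₂ K ≃
    Bool × (BitString m × (Fin n → FixedPoint c₁ c₂) × (Fin n → FixedPoint c₁ c₂) × U × T) where
  toFun b := ((ez b.2.2.2).2.2, b.1, b.2.1, b.2.2.1, (ez b.2.2.2).1, (ez b.2.2.2).2.1)
  invFun x := (x.2.1, x.2.2.1, x.2.2.2.1, ez.symm (x.2.2.2.2.1, x.2.2.2.2.2, x.1))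
  left_inv b := by simp
  right_inv x := by simp

variable (ez c₁ c₂ n m) in
/-- Separates the point from the other registers. -/
def pointEquiv : Basis n m c₁ c₂ K ≃
    U × (BitString m × (Fin n → FixedPoint c₁ c₂) × (Fin n → FixedPoint c₁ c₂) × T × Bool) where
  toFun b := ((ez b.2.2.2).1, b.1, b.2.1, b.2.2.1, (ez b.2.2.2).2.1, (ez b.2.2.2).2.2)
  invFun x := (x.2.1, x.2.2.1, x.2.2.2.1, ez.symm (x.1, x.2.2.2.2.1, x.2.2.2.2.2))
  left_inv b := by simp
  right_inv x := by simp

variable [Fintype U] [Fintype T]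

section Clock

variable [DecidableEq T]

variable (ez c₁ c₂ n m) in
/-- The step that applies a unitary to the clock. -/
def clockStep (W : Matrix.unitaryGroup T ℂ) : Step n m c₁ c₂ K :=
  .free (controlledUnitary (clockEquiv n m c₁ c₂ ez) fun _ => W)

theorem realizes_clockStep (W : Matrix.unitaryGroup T ℂ) :
    Realizes ez enc F P V [clockStep n m c₁ c₂ ez W] (fun φ u => kernelOp W.1 (φ u)) := by
  intro φ
  funext ⟨i, w, y, z⟩
  change (controlledUnitary _ _).1.mulVec _ _ = _
  rw [controlledUnitary_mulVec]
  simp only [clockEquiv, embedState, kernelOp, Equiv.coe_fn_mk, Equiv.coe_fn_symm_mk,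
    Equiv.apply_symm_apply]
  split_ifs <;> simp

end Clock

/-- The rotation of a qubit by the angle whose squared sine is `a`, clipped to `[0, 1]`. -/
def rotUnitary (a : ℝ) : Matrix.unitaryGroup Bool ℂ :=
  ⟨Matrix.of fun b b' => if b = b' then (√(1 - max 0 (min a 1)) : ℂ)
      else if b then (√(max 0 (min a 1)) : ℂ) else -(√(max 0 (min a 1)) : ℂ), by
    have h0 : 0 ≤ max 0 (min a 1) := le_max_left _ _
    have h1 : max 0 (min a 1) ≤ 1 := max_le zero_le_one (min_le_right _ _)
    have hc : (√(1 - max 0 (min a 1)) : ℂ) * (√(1 - max 0 (min a 1)) : ℂ)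
        = 1 - ((max 0 (min a 1) : ℝ) : ℂ) := by
      rw [← Complex.ofReal_mul, Real.mul_self_sqrt (by linarith)]
      push_cast
      rfl
    have hs : (√(max 0 (min a 1)) : ℂ) * (√(max 0 (min a 1)) : ℂ)
        = ((max 0 (min a 1) : ℝ) : ℂ) := by
      rw [← Complex.ofReal_mul, Real.mul_self_sqrt h0]
    rw [Matrix.mem_unitaryGroup_iff]
    ext b b'
    cases b <;> cases b' <;>
      simp [Matrix.mul_apply, hc, hs] <;> ring⟩

/-- The rotations of the flag qubit, controlled by the input register. -/
def rotIso (a : BitString m → ℝ) : FlagInput m ≃ₗᵢ[ℂ] FlagInput m :=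
  unitaryIso (controlledUnitary (Equiv.refl (Bool × BitString m)) fun i => rotUnitary (a i))

theorem rotIso_apply (a : BitString m → ℝ) (x : FlagInput m) (b : Bool) (i : BitString m) :
    rotIso a x (b, i) = ∑ b', (rotUnitary (a i)).1 b b' * x (b', i) := by
  rw [rotIso, unitaryIso_apply, controlledUnitary_mulVec]
  rfl

variable (ez m) in
/-- Rotates the flag qubit by an angle determined by the point and the result of a query. -/
def rotSteps (a : U → (Fin n → FixedPoint c₁ c₂) → ℝ) : List (Step n m c₁ c₂ K) :=
  [.query, .free (controlledUnitary (flagEquiv n m c₁ c₂ ez)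
    fun x => rotUnitary (a x.2.2.2.1 x.2.2.1)), .query]

/-- The first query writes the value into the zero result register, the rotation reads it, and the
second query erases it because exclusive or is an involution. -/
theorem realizes_rotSteps (a : U → (Fin n → FixedPoint c₁ c₂) → ℝ) :
    Realizes ez enc F P V (rotSteps m ez a)
      (fiberOp fun u _ => rotIso fun i => a u (F i (enc u))) := by
  intro φ
  funext ⟨i, w, y, z⟩
  change (controlledUnitary _ _).1.mulVec (Step.apply F P V .query _)
    (i, w, (fun j => fpXor (y j) (F i w j)), z) = _
  rw [controlledUnitary_mulVec]
  have hy : (fun j => fpXor (fpXor (y j) (F i w j)) (F i w j)) = y :=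
    funext fun j => fpXor_fpXor_cancel _ _
  simp only [flagEquiv, Step.apply, embedState, fiberOp, rotIso_apply, Equiv.coe_fn_mk,
    Equiv.coe_fn_symm_mk, Equiv.apply_symm_apply, hy]
  split_ifs with h
  · have h2 : (fun j => fpXor (y j) (F i w j)) = F i (enc (ez z).1) := by
      funext j
      rw [h.2, h.1]
      simp [fpXor, fpZero]
    rw [h2]
  · simp

/-- The phases `-1` on the raised flag. -/
def flagPhase (x : Bool × BitString m) : ℂ := if x.1 then -1 else 1

/-- The phases `-1` off the zero state. -/
def zeroPhase (x : Bool × BitString m) : ℂ := if x = (false, fun _ => false) then 1 else -1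

theorem norm_flagPhase (x : Bool × BitString m) : ‖flagPhase x‖ = 1 := by
  unfold flagPhase; split_ifs <;> simp

theorem norm_zeroPhase (x : Bool × BitString m) : ‖zeroPhase x‖ = 1 := by
  unfold zeroPhase; split_ifs <;> simp

/-- The reflection of the flag qubit. -/
def flagIso (m : ℕ) : FlagInput m ≃ₗᵢ[ℂ] FlagInput m := phaseIso flagPhase norm_flagPhase

/-- The reflection about the zero state of the flag qubit and the input register. -/
def zeroIso (m : ℕ) : FlagInput m ≃ₗᵢ[ℂ] FlagInput m := phaseIso zeroPhase norm_zeroPhase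

/-- Phases that are applied if `c` holds. -/
def condPhase (c : Prop) (d : Bool × BitString m → ℂ) (x : Bool × BitString m) : ℂ :=
  open Classical in if c then d x else 1

theorem norm_condPhase (c : Prop) {d : Bool × BitString m → ℂ} (hd : ∀ x, ‖d x‖ = 1)
    (x : Bool × BitString m) : ‖condPhase c d x‖ = 1 := by
  unfold condPhase; split_ifs <;> simp [hd]

theorem phaseIso_condPhase_of_true {c : Prop} (hc : c) {d : Bool × BitString m → ℂ}
    (hd : ∀ x, ‖d x‖ = 1) : phaseIso (condPhase c d) (norm_condPhase c hd) = phaseIso d hd := by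
  ext x j
  simp [phaseIso_apply, condPhase, hc]

theorem phaseIso_condPhase_of_false {c : Prop} (hc : ¬c) {d : Bool × BitString m → ℂ}
    (hd : ∀ x, ‖d x‖ = 1) : phaseIso (condPhase c d) (norm_condPhase c hd) = 1 := by
  ext x j
  simp [phaseIso_apply, condPhase, hc]

variable (ez m) in
/-- Prepares the flag qubit and the input register. -/
def prepSteps (a : U → (Fin n → FixedPoint c₁ c₂) → ℝ) : List (Step n m c₁ c₂ K) :=
  [.loadX] ++ rotSteps m ez a

/-- The isometry that prepares the flag qubit and the input register. -/
def prepIso (P : Matrix.unitaryGroup (BitString m) ℂ) (a : BitString m → ℝ) :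
    FlagInput m ≃ₗᵢ[ℂ] FlagInput m := rotIso a * inputIso P

theorem realizes_prepSteps (a : U → (Fin n → FixedPoint c₁ c₂) → ℝ) :
    Realizes ez enc F P V (prepSteps m ez a)
      (fiberOp fun u _ => prepIso P fun i => a u (F i (enc u))) :=
  realizes_loadX.append_fiberOp (realizes_rotSteps a)

variable (ez m) in
/-- A step of amplitude amplification, controlled by the clock being beyond `s`. -/
def groverSteps (τ : T → ℕ) (a : U → (Fin n → FixedPoint c₁ c₂) → ℝ) (s : ℕ) :
    List (Step n m c₁ c₂ K) :=
  [phaseStep n c₁ c₂ ez (fun _ t => condPhase (s < τ t) flagPhase)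
      (fun _ _ => norm_condPhase _ norm_flagPhase)] ++
    (invSteps (prepSteps m ez a) ++
      ([phaseStep n c₁ c₂ ez (fun _ t => condPhase (s < τ t) zeroPhase)
        (fun _ _ => norm_condPhase _ norm_zeroPhase)] ++ prepSteps m ez a))

/-- The walk operator of amplitude amplification. -/
def walkIso (P : Matrix.unitaryGroup (BitString m) ℂ) (a : BitString m → ℝ) :
    FlagInput m ≃ₗᵢ[ℂ] FlagInput m :=
  groverOp (prepIso P a) (zeroIso m) (flagIso m)

/-- Only the two reflections depend on the clock. When they are switched off, the preparation and
its inverse cancel, so the queries themselves need no control. -/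
theorem realizes_groverSteps (τ : T → ℕ) (a : U → (Fin n → FixedPoint c₁ c₂) → ℝ) (s : ℕ) :
    Realizes ez enc F P V (groverSteps m ez τ a s)
      (fiberOp fun u t => if s < τ t then walkIso P (fun i => a u (F i (enc u))) else 1) := by
  have h := (realizes_phaseStep (ez := ez) (enc := enc) (F := F) (P := P) (V := V)
      (fun _ t => condPhase (s < τ t) flagPhase)
      (fun _ _ => norm_condPhase _ norm_flagPhase)).append_fiberOp
    ((realizes_prepSteps a).invSteps.append_fiberOp
      ((realizes_phaseStep (fun _ t => condPhase (s < τ t) zeroPhase)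
        (fun _ _ => norm_condPhase _ norm_zeroPhase)).append_fiberOp (realizes_prepSteps a)))
  refine h.congr_fiberOp fun u t => ?_
  split_ifs with hs
  · rw [phaseIso_condPhase_of_true hs, phaseIso_condPhase_of_true hs]
    rfl
  · rw [phaseIso_condPhase_of_false hs norm_flagPhase,
      phaseIso_condPhase_of_false hs norm_zeroPhase]
    simp

variable (ez m) in
/-- Controlled powers of the walk operator. -/
def powerSteps (τ : T → ℕ) (a : U → (Fin n → FixedPoint c₁ c₂) → ℝ) :
    ℕ → List (Step n m c₁ c₂ K)
  | 0 => []
  | N + 1 => powerSteps τ a N ++ groverSteps m ez τ a N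

theorem realizes_powerSteps (τ : T → ℕ) (a : U → (Fin n → FixedPoint c₁ c₂) → ℝ) (N : ℕ) :
    Realizes ez enc F P V (powerSteps m ez τ a N)
      (fiberOp fun u t => walkIso P (fun i => a u (F i (enc u))) ^ min (τ t) N) := by
  induction N with
  | zero => exact realizes_nil.congr_fiberOp fun u t => by simp
  | succ N ih =>
    refine (ih.append_fiberOp (realizes_groverSteps τ a N)).congr_fiberOp fun u t => ?_
    split_ifs with h
    · rw [min_eq_right (by omega), min_eq_right (by omega), pow_succ']
    · rw [min_eq_left (by omega), min_eq_left (by omega), one_mul]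

theorem stepsCost_prepSteps (a : U → (Fin n → FixedPoint c₁ c₂) → ℝ) :
    stepsCost (prepSteps m ez a) = 2 := rfl

theorem stepsCost_powerSteps (τ : T → ℕ) (a : U → (Fin n → FixedPoint c₁ c₂) → ℝ) (N : ℕ) :
    stepsCost (powerSteps m ez τ a N) = 4 * N := by
  induction N with
  | zero => rfl
  | succ N ih =>
    have : stepsCost (groverSteps m ez τ a N) = 4 := rfl
    rw [powerSteps, stepsCost_append, ih, this]
    ring

section Stage

variable [DecidableEq T]

variable (ez m) in
/-- Coherent estimation of the phase of the walk operator, followed by the unitary `W` on the clock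
in the phase representation, and uncomputation. -/
def stageSteps (τ : T → ℕ) (N : ℕ) (a : U → (Fin n → FixedPoint c₁ c₂) → ℝ)
    (W : Matrix.unitaryGroup T ℂ) : List (Step n m c₁ c₂ K) :=
  (prepSteps m ez a ++ powerSteps m ez τ a N) ++ ([clockStep n m c₁ c₂ ez W] ++
    invSteps (prepSteps m ez a ++ powerSteps m ez τ a N))

theorem realizes_stageSteps {τ : T → ℕ} {N : ℕ} (hτ : ∀ t, τ t ≤ N)
    (a : U → (Fin n → FixedPoint c₁ c₂) → ℝ) (W : Matrix.unitaryGroup T ℂ) :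
    Realizes ez enc F P V (stageSteps m ez τ N a W)
      (fun φ u => conjKernelOp W.1 (fun t => walkIso P (fun i => a u (F i (enc u))) ^ τ t
        * prepIso P fun i => a u (F i (enc u))) (φ u)) := by
  have h1 : Realizes ez enc F P V (prepSteps m ez a ++ powerSteps m ez τ a N)
      (fiberOp fun u t => walkIso P (fun i => a u (F i (enc u))) ^ τ t
        * prepIso P fun i => a u (F i (enc u))) := by
    have := (realizes_prepSteps (ez := ez) (enc := enc) (F := F) (P := P) (V := V)
      a).append_fiberOp (realizes_powerSteps τ a N)
    simpa only [min_eq_left (hτ _)] using this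
  exact h1.append ((realizes_clockStep W).append h1.invSteps)

/-- A preparation costs two queries and a Grover step contains two preparations. Preparation and
powers together cost `2 + 4 N`, and they are run forwards and backwards. -/
theorem stepsCost_stageSteps (τ : T → ℕ) (N : ℕ) (a : U → (Fin n → FixedPoint c₁ c₂) → ℝ)
    (W : Matrix.unitaryGroup T ℂ) : stepsCost (stageSteps m ez τ N a W) = 8 * N + 4 := by
  have : stepsCost [clockStep n m c₁ c₂ ez W] = 0 := rfl
  rw [stageSteps, stepsCost_append, stepsCost_append (L := [_]), stepsCost_invSteps,
    stepsCost_append, stepsCost_prepSteps, stepsCost_powerSteps, this]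
  ring

end Stage

variable (ez enc m) in
/-- Uncomputes the direction register. -/
def xorEquiv : Basis n m c₁ c₂ K ≃ Basis n m c₁ c₂ K where
  toFun b := (b.1, fun j => fpXor (b.2.1 j) (enc (ez b.2.2.2).1 j), b.2.2)
  invFun b := (b.1, fun j => fpXor (b.2.1 j) (enc (ez b.2.2.2).1 j), b.2.2)
  left_inv b := by simp [fpXor_fpXor_cancel]
  right_inv b := by simp [fpXor_fpXor_cancel]

variable [DecidableEq U]

variable (ez enc m) in
/-- Uncomputes the direction register, then applies a unitary to the point. -/
def readoutSteps (W : Matrix.unitaryGroup U ℂ) : List (Step n m c₁ c₂ K) :=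
  [.free (permUnitary (xorEquiv m ez enc)),
    .free (controlledUnitary (pointEquiv n m c₁ c₂ ez) fun _ => W)]

/-- The direction register holds a copy of the point, which would destroy interference in a Fourier
transform of the point alone. It is erased first. -/
theorem run_readoutSteps (W : Matrix.unitaryGroup U ℂ) (φ : U → T → FlagInput m)
    (i : BitString m) (w y : Fin n → FixedPoint c₁ c₂) (z : BitString K) :
    run F P V (readoutSteps m ez enc W) (embedState ez enc φ) (i, w, y, z)
      = if w = (fun _ => fpZero) ∧ y = (fun _ => fpZero) then
          W.1.mulVec (fun u => φ u (ez z).2.1 ((ez z).2.2, i)) (ez z).1 else 0 := by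
  change (controlledUnitary _ _).1.mulVec ((permUnitary _).1.mulVec _) _ = _
  rw [controlledUnitary_mulVec]
  simp only [permUnitary_mulVec]
  have hw : ∀ u, (fun j => fpXor (w j) (enc u j)) = enc u ↔ w = fun _ => fpZero := by
    intro u
    rw [funext_iff, funext_iff]
    exact forall_congr' fun j => fpXor_eq_right_iff _ _
  simp only [pointEquiv, xorEquiv, embedState, Equiv.coe_fn_mk, Equiv.coe_fn_symm_mk,
    Equiv.apply_symm_apply, hw]
  split_ifs <;> simp [Matrix.mulVec, dotProduct]

end Realization

/-! ### The phase of a mean -/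

section Fiber

variable {m : ℕ}

/-- The zero state of the flag qubit and the input register. -/
def zeroState (m : ℕ) : FlagInput m := EuclideanSpace.single (false, fun _ => false) 1

theorem norm_zeroState : ‖zeroState m‖ = 1 := by simp [zeroState]

theorem zeroIso_eq (x : FlagInput m) :
    zeroIso m x = (2 * inner ℂ (zeroState m) x) • zeroState m - x := by
  ext j
  rw [zeroIso, phaseIso_apply]
  by_cases hj : j = (false, fun _ => false)
  · subst hj
    simp [zeroPhase, zeroState, EuclideanSpace.inner_single_left]
    ring
  · simp [zeroPhase, zeroState, hj]

theorem zeroIso_mul_self : zeroIso m * zeroIso m = 1 := by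
  ext x j
  change zeroIso m (zeroIso m x) j = x j
  rw [zeroIso, phaseIso_apply, phaseIso_apply]
  unfold zeroPhase
  split_ifs <;> simp

theorem flagIso_mul_self : flagIso m * flagIso m = 1 := by
  ext x j
  change flagIso m (flagIso m x) j = x j
  rw [flagIso, phaseIso_apply, phaseIso_apply]
  unfold flagPhase
  split_ifs <;> simp

/-- Clipping to `[0, 1]`. -/
def clip (a : ℝ) : ℝ := max 0 (min a 1)

theorem clip_nonneg (a : ℝ) : 0 ≤ clip a := le_max_left _ _

theorem clip_le_one (a : ℝ) : clip a ≤ 1 := max_le zero_le_one (min_le_right _ _)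

/-- The mean of the clipped values. -/
def clipMean (p : PMF (BitString m)) (a : BitString m → ℝ) : ℝ :=
  ∑ i, (p i).toReal * clip (a i)

theorem clipMean_nonneg (p : PMF (BitString m)) (a : BitString m → ℝ) : 0 ≤ clipMean p a :=
  Finset.sum_nonneg fun _ _ => mul_nonneg ENNReal.toReal_nonneg (clip_nonneg _)

theorem clipMean_le_one (p : PMF (BitString m)) (a : BitString m → ℝ) : clipMean p a ≤ 1 := by
  rw [← sum_toReal_pmf p]
  exact Finset.sum_le_sum fun _ _ =>
    mul_le_of_le_one_right ENNReal.toReal_nonneg (clip_le_one _)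

variable {p : PMF (BitString m)} {P : Matrix.unitaryGroup (BitString m) ℂ}

theorem prepIso_zeroState_apply (hP : LoadsInput P p) (a : BitString m → ℝ) (b : Bool)
    (i : BitString m) : prepIso P a (zeroState m) (b, i)
      = ((if b then √(clip (a i)) else √(1 - clip (a i)) : ℝ) : ℂ) * (√((p i).toReal) : ℝ) := by
  have h1 : ∀ b i, inputIso P (zeroState m) (b, i)
      = if b = false then ((√((p i).toReal) : ℝ) : ℂ) else 0 := by
    intro b i
    rw [inputIso_apply]
    by_cases hb : b = false
    · subst hb
      simp [zeroState, hP i]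
    · simp [zeroState, hb]
  change rotIso a (inputIso P (zeroState m)) (b, i) = _
  rw [rotIso_apply]
  simp only [h1]
  cases b <;> simp [rotUnitary, clip]

/-- The flag is raised with probability `clip (a i)` given `i`, so the expectation of the flag
reflection is one minus twice the mean probability. -/
theorem inner_prepIso_flagIso (hP : LoadsInput P p) (a : BitString m → ℝ) :
    inner ℂ (prepIso P a (zeroState m)) (flagIso m (prepIso P a (zeroState m)))
      = ((1 - 2 * clipMean p a : ℝ) : ℂ) := by
  rw [PiLp.inner_apply, Fintype.sum_prod_type]
  simp only [flagIso, phaseIso_apply, prepIso_zeroState_apply hP]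
  have h : ∀ i, ((p i).toReal : ℂ) = (√((p i).toReal) : ℂ) * (√((p i).toReal) : ℂ) := fun i => by
    rw [← Complex.ofReal_mul, Real.mul_self_sqrt ENNReal.toReal_nonneg]
  have h1 : ∀ i, ((clip (a i) : ℝ) : ℂ) = (√(clip (a i)) : ℂ) * (√(clip (a i)) : ℂ) := fun i => by
    rw [← Complex.ofReal_mul, Real.mul_self_sqrt (clip_nonneg _)]
  have h2 : ∀ i, 1 - ((clip (a i) : ℝ) : ℂ)
      = (√(1 - clip (a i)) : ℂ) * (√(1 - clip (a i)) : ℂ) := fun i => by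
    rw [← Complex.ofReal_mul, Real.mul_self_sqrt (sub_nonneg.2 (clip_le_one _))]
    push_cast; rfl
  have hr : ((1 - 2 * clipMean p a : ℝ) : ℂ)
      = ∑ i, ((p i).toReal : ℂ) * (1 - 2 * (clip (a i) : ℂ)) := by
    have : 1 - 2 * clipMean p a = ∑ i, (p i).toReal * (1 - 2 * clip (a i)) := by
      simp only [mul_sub, mul_one, Finset.sum_sub_distrib, sum_toReal_pmf, clipMean, Finset.mul_sum]
      congr 1
      exact Finset.sum_congr rfl fun i _ => by ring
    rw [this]
    push_cast
    rfl
  rw [Fintype.sum_bool, hr, ← Finset.sum_add_distrib]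
  refine Finset.sum_congr rfl fun i _ => ?_
  simp [flagPhase, abs_of_nonneg (Real.sqrt_nonneg _)]
  linear_combination (-(h2 i) + h1 i) * (√((p i).toReal) : ℂ) * (√((p i).toReal) : ℂ)
    - (1 - 2 * (clip (a i) : ℂ)) * h i

variable (M : ℕ) [NeZero M]

/-- One stage of the algorithm, for a fixed point. -/
def stageOp (P : Matrix.unitaryGroup (BitString m) ℂ) (a : BitString m → ℝ)
    (e : ZMod M ≃ AddChar (ZMod M) ℂ) (Λ : ℝ) (φ : ZMod M → FlagInput m) : ZMod M → FlagInput m :=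
  conjKernelOp (phaseUnitary e 1 Λ).1 (fun t => walkIso P a ^ t.val * prepIso P a) φ

variable {M}

theorem stageOp_sub (a : BitString m → ℝ) (e : ZMod M ≃ AddChar (ZMod M) ℂ) (Λ : ℝ)
    (φ ψ : ZMod M → FlagInput m) (t : ZMod M) :
    stageOp M P a e Λ (fun t => φ t - ψ t) t = stageOp M P a e Λ φ t - stageOp M P a e Λ ψ t := by
  simp [stageOp, conjKernelOp, kernelOp, smul_sub]

theorem stageOp_smul (a : BitString m → ℝ) (e : ZMod M ≃ AddChar (ZMod M) ℂ) (Λ : ℝ)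
    (c : ℂ) (φ : ZMod M → FlagInput m) :
    stageOp M P a e Λ (fun t => c • φ t) = fun t => c • stageOp M P a e Λ φ t := by
  funext t
  simp only [stageOp, conjKernelOp, kernelOp, map_smul, smul_comm _ c, ← Finset.smul_sum]

theorem sum_norm_sq_stageOp (a : BitString m → ℝ) (e : ZMod M ≃ AddChar (ZMod M) ℂ) (Λ : ℝ)
    (φ : ZMod M → FlagInput m) : ∑ t, ‖stageOp M P a e Λ φ t‖ ^ 2 = ∑ t, ‖φ t‖ ^ 2 :=
  sum_norm_sq_conjKernelOp _ _ _

variable (m M) in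
/-- The initial state of the clock, the flag qubit and the input register. -/
def clockState (t : ZMod M) : FlagInput m := (window M t : ℂ) • zeroState m

theorem sum_norm_sq_clockState (hM : Even M) : ∑ t, ‖clockState m M t‖ ^ 2 = 1 := by
  rw [← sum_window_sq M hM]
  refine Finset.sum_congr rfl fun t _ => ?_
  rw [clockState, norm_smul, norm_zeroState, mul_one, Complex.norm_real, Real.norm_eq_abs, sq_abs]

theorem sum_norm_sq_stageOp_sub_le (hM : Even M) (hP : LoadsInput P p) (a : BitString m → ℝ)
    (e : ZMod M ≃ AddChar (ZMod M) ℂ) (Λ : ℝ) :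
    ∑ t, ‖stageOp M P a e Λ (clockState m M) t
      - Complex.exp ((Λ * clipMean p a : ℝ) * Complex.I) • clockState m M t‖ ^ 2
      ≤ (Λ / 2) ^ 2 * (2⁻¹ * ((2 * Real.pi / M) ^ 4
        + 16 * clipMean p a * (2 * Real.pi / M) ^ 2)) :=
  sum_norm_sq_conjKernelOp_sub_phase_le M hM e Λ norm_zeroState zeroIso_eq zeroIso_mul_self
    flagIso_mul_self (clipMean_nonneg p a) (clipMean_le_one p a) (inner_prepIso_flagIso hP a)

/-- The two stages apply the phase `Λ` times the difference of two means. -/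
theorem sum_norm_sq_stageOp_stageOp_sub_le (hM : Even M) (hP : LoadsInput P p)
    (a a' : BitString m → ℝ) (e : ZMod M ≃ AddChar (ZMod M) ℂ) (Λ : ℝ) :
    ∑ t, ‖stageOp M P a' e (-Λ) (stageOp M P a e Λ (clockState m M)) t
      - Complex.exp ((Λ * (clipMean p a - clipMean p a') : ℝ) * Complex.I) • clockState m M t‖ ^ 2
      ≤ (Λ / 2) ^ 2 * (2 * (2 * Real.pi / M) ^ 4
        + 16 * (clipMean p a + clipMean p a') * (2 * Real.pi / M) ^ 2) := by
  have h1 := sum_norm_sq_stageOp_sub_le (M := M) hM hP a e Λ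
  have h2 := sum_norm_sq_stageOp_sub_le (M := M) hM hP a' e (-Λ)
  set z := Complex.exp ((Λ * clipMean p a : ℝ) * Complex.I)
  set z' := Complex.exp ((-Λ * clipMean p a' : ℝ) * Complex.I)
  have hz : ‖z‖ = 1 := Complex.norm_exp_ofReal_mul_I _
  have hzz : Complex.exp ((Λ * (clipMean p a - clipMean p a') : ℝ) * Complex.I) = z * z' := by
    rw [← Complex.exp_add]
    push_cast
    ring_nf
  -- The first stage returns the clock state up to a phase and an error. The second stage transports
  -- that error isometrically and adds its own error on the clock state.
  have h3 : ∀ t, stageOp M P a' e (-Λ) (stageOp M P a e Λ (clockState m M)) t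
      - (z * z') • clockState m M t
      = stageOp M P a' e (-Λ)
          (fun t => stageOp M P a e Λ (clockState m M) t - z • clockState m M t) t
        + z • (stageOp M P a' e (-Λ) (clockState m M) t - z' • clockState m M t) := by
    intro t
    rw [stageOp_sub, stageOp_smul, smul_sub, smul_smul]
    abel
  have h4 := sum_norm_sq_stageOp (P := P) a' e (-Λ)
    (fun t => stageOp M P a e Λ (clockState m M) t - z • clockState m M t)
  rw [hzz]
  calc _ ≤ ∑ t, (2 * (‖stageOp M P a' e (-Λ)
          (fun t => stageOp M P a e Λ (clockState m M) t - z • clockState m M t) t‖ ^ 2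
        + ‖stageOp M P a' e (-Λ) (clockState m M) t - z' • clockState m M t‖ ^ 2)) := by
        refine Finset.sum_le_sum fun t _ => ?_
        rw [h3]
        refine (norm_add_sq_le_two_mul _ _).trans ?_
        rw [norm_smul, hz, one_mul]
    _ ≤ _ := by
        rw [← Finset.mul_sum, Finset.sum_add_distrib, h4]
        have : (-Λ / 2) ^ 2 = (Λ / 2) ^ 2 := by ring
        rw [this] at h2
        linarith

end Fiber

/-! ### Reading out a product of phases -/

section Readout

open Complex

variable {n M : ℕ} [NeZero M]

/-- The window of several coordinates. -/
def pointWindow (n M : ℕ) [NeZero M] (u : Fin n → ZMod M) : ℝ := ∏ k, window M (u k)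

theorem sum_pointWindow_sq (hM : Even M) : ∑ u, pointWindow n M u ^ 2 = 1 := by
  simp only [pointWindow, ← Finset.prod_pow]
  rw [sum_prod_pi (fun _ t => window M t ^ 2)]
  simp [sum_window_sq M hM]

/-- Centring multiplies all three terms by the same phase of modulus one. -/
theorem norm_window_centred_phase_second_difference_le (hM : Even M) (φ : ℝ) (t : ZMod M) :
    ‖exp (-(φ * I)) * ((window M (t + 1) : ℂ) * exp ((φ * centred M (t + 1) : ℝ) * I))
      + exp (φ * I) * ((window M (t - 1) : ℂ) * exp ((φ * centred M (t - 1) : ℝ) * I))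
      - 2 * ((window M t : ℂ) * exp ((φ * centred M t : ℝ) * I))‖
      ≤ (2 * Real.pi / M) ^ 2 / √M := by
  have h : ∀ t : ZMod M, exp ((φ * centred M t : ℝ) * I)
      = exp ((-(φ * (M / 2 : ℕ)) : ℝ) * I) * exp (t.val * (φ * I)) := by
    intro t
    rw [← Complex.exp_add]
    congr 1
    simp only [centred, Int.cast_sub, Int.cast_natCast, Complex.ofReal_mul, Complex.ofReal_sub,
      Complex.ofReal_neg, Complex.ofReal_natCast]
    ring
  have h2 := norm_window_phase_second_difference_le M hM φ t
  simp only [h]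
  refine le_trans (le_of_eq ?_) h2
  rw [← one_mul (‖_ - 2 * ((window M t : ℂ) * exp (t.val * (φ * I)))‖),
    ← Complex.norm_exp_ofReal_mul_I (-(φ * (M / 2 : ℕ))), ← norm_mul]
  congr 1
  ring

/-- The windowed state with the phase `∑ φ k * w k`. -/
def phaseState (φ : Fin n → ℝ) (u : Fin n → ZMod M) : ℂ :=
  (pointWindow n M u : ℂ) * exp ((∑ k, φ k * centred M (u k) : ℝ) * I)

theorem phaseState_eq_prod (φ : Fin n → ℝ) (u : Fin n → ZMod M) :
    phaseState φ u = ∏ k, ((window M (u k) : ℂ) * exp ((φ k * centred M (u k) : ℝ) * I)) := by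
  rw [Finset.prod_mul_distrib, ← Complex.exp_sum, ← Finset.sum_mul, phaseState, pointWindow]
  push_cast
  rfl

/-- The phase state is a product, and the shift touches only its factor at `k`. That factor gives
the bound of the one-dimensional window; the others are normalized. -/
theorem sum_norm_sq_phaseState_second_difference_le (hM : Even M) (φ : Fin n → ℝ) (k : Fin n) :
    ∑ u : Fin n → ZMod M, ‖exp (-(φ k * I)) * phaseState φ (u + Pi.single k (1 : ZMod M))
      + exp (φ k * I) * phaseState φ (u - Pi.single k (1 : ZMod M)) - 2 * phaseState φ u‖ ^ 2
      ≤ (2 * Real.pi / M) ^ 4 := by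
  have hM' : (0 : ℝ) < M := Nat.cast_pos.2 (NeZero.pos M)
  set f : Fin n → ZMod M → ℂ :=
    fun l t => (window M t : ℂ) * exp ((φ l * centred M t : ℝ) * I) with hf
  have hfn : ∀ l t, ‖f l t‖ ^ 2 = window M t ^ 2 := fun l t => by
    rw [hf]
    simp only
    rw [norm_mul, Complex.norm_exp_ofReal_mul_I, mul_one, Complex.norm_real, Real.norm_eq_abs,
      sq_abs]
  have hsplit : ∀ (u : Fin n → ZMod M) (s : ZMod M), phaseState φ (u + Pi.single k s)
      = f k (u k + s) * ∏ l ∈ Finset.univ.erase k, f l (u l) := by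
    intro u s
    rw [phaseState_eq_prod, ← Finset.mul_prod_erase _ _ (Finset.mem_univ k)]
    congr 1
    · simp [hf]
    · refine Finset.prod_congr rfl fun l hl => ?_
      simp [hf, Finset.ne_of_mem_erase hl]
  have hkey : ∀ u : Fin n → ZMod M,
      ‖exp (-(φ k * I)) * phaseState φ (u + Pi.single k (1 : ZMod M))
        + exp (φ k * I) * phaseState φ (u - Pi.single k (1 : ZMod M)) - 2 * phaseState φ u‖ ^ 2
      ≤ (2 * Real.pi / M) ^ 4 / M * ∏ l, (if l = k then 1 else window M (u l) ^ 2) := by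
    intro u
    have h1 := hsplit u 1
    have h2 := hsplit u (-1)
    have h3 := hsplit u 0
    rw [Pi.single_neg, ← sub_eq_add_neg, ← sub_eq_add_neg] at h2
    rw [Pi.single_zero, add_zero, add_zero] at h3
    have h4 := norm_window_centred_phase_second_difference_le hM (φ k) (u k)
    rw [h1, h2, h3]
    have h5 : exp (-(φ k * I)) * (f k (u k + 1) * ∏ l ∈ Finset.univ.erase k, f l (u l))
        + exp (φ k * I) * (f k (u k - 1) * ∏ l ∈ Finset.univ.erase k, f l (u l))
        - 2 * (f k (u k) * ∏ l ∈ Finset.univ.erase k, f l (u l))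
        = (exp (-(φ k * I)) * f k (u k + 1) + exp (φ k * I) * f k (u k - 1) - 2 * f k (u k))
          * ∏ l ∈ Finset.univ.erase k, f l (u l) := by ring
    rw [h5, norm_mul, mul_pow, norm_prod, ← Finset.prod_pow,
      ← Finset.mul_prod_erase Finset.univ _ (Finset.mem_univ k), if_pos rfl, one_mul]
    refine mul_le_mul ((pow_le_pow_left₀ (norm_nonneg _) h4 2).trans (le_of_eq ?_)) (le_of_eq ?_)
      (Finset.prod_nonneg fun _ _ => sq_nonneg _) (by positivity)
    · rw [div_pow, Real.sq_sqrt hM'.le, ← pow_mul]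
    · refine Finset.prod_congr rfl fun l hl => ?_
      rw [hfn, if_neg (Finset.ne_of_mem_erase hl)]
  refine (Finset.sum_le_sum fun u _ => hkey u).trans (le_of_eq ?_)
  rw [← Finset.mul_sum, sum_prod_pi (fun l t => if l = k then (1 : ℝ) else window M t ^ 2),
    Finset.prod_eq_single k]
  · simp [hM'.ne']
  · intro l _ hl
    simp [hl, sum_window_sq M hM]
  · simp

open Classical in
/-- The Fourier transform of the phase state concentrates on characters near the phases. -/
theorem sum_far_fourier_phaseState_le (hM : Even M)
    (e : (Fin n → ZMod M) ≃ AddChar (Fin n → ZMod M) ℂ) (φ : Fin n → ℝ) {δ : ℝ} (hδ : 0 < δ) :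
    ∑ u, (if ∀ k, ‖e u (Pi.single k 1) - exp (φ k * I)‖ ≤ δ then 0 else
      ‖(fourierUnitary e).1.mulVec (phaseState φ) u‖ ^ 2)
      ≤ n * ((2 * Real.pi / M) / δ) ^ 4 := by
  -- Markov's inequality with fourth powers and a union bound: at a far character some chord exceeds
  -- `δ`.
  have h1 : ∀ u, (if ∀ k, ‖e u (Pi.single k 1) - exp (φ k * I)‖ ≤ δ then 0 else
      ‖(fourierUnitary e).1.mulVec (phaseState φ) u‖ ^ 2)
      ≤ ∑ k, (δ ^ 4)⁻¹ * (‖e u (Pi.single k 1) - exp (φ k * I)‖ ^ 4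
        * ‖(fourierUnitary e).1.mulVec (phaseState φ) u‖ ^ 2) := by
    intro u
    have hnn : ∀ k ∈ Finset.univ, 0 ≤ (δ ^ 4)⁻¹ * (‖e u (Pi.single k 1) - exp (φ k * I)‖ ^ 4
        * ‖(fourierUnitary e).1.mulVec (phaseState φ) u‖ ^ 2) := fun k _ => by positivity
    split_ifs with h
    · exact Finset.sum_nonneg hnn
    · push Not at h
      obtain ⟨k, hk⟩ := h
      refine le_trans ?_ (Finset.single_le_sum hnn (Finset.mem_univ k))
      rw [← mul_assoc]
      refine le_mul_of_one_le_left (sq_nonneg _) ?_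
      rw [inv_mul_eq_div, one_le_div (by positivity)]
      exact pow_le_pow_left₀ hδ.le hk.le 4
  refine (Finset.sum_le_sum fun u _ => h1 u).trans ?_
  rw [Finset.sum_comm]
  calc _ ≤ ∑ _k : Fin n, (δ ^ 4)⁻¹ * (2 * Real.pi / M) ^ 4 := by
        refine Finset.sum_le_sum fun k _ => ?_
        rw [← Finset.mul_sum, sum_chord_pow_four_fourier]
        exact mul_le_mul_of_nonneg_left (sum_norm_sq_phaseState_second_difference_le hM φ k)
          (by positivity)
    _ = _ := by
        rw [Finset.sum_const, Finset.card_univ, Fintype.card_fin, nsmul_eq_mul, div_pow]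
        ring

end Readout

/-! ### From the error of the state to the probability of success -/

section Success

open Complex

variable {n m M M' : ℕ} [NeZero M] [NeZero M']

theorem sum_sum_norm_sq_mulVec {U T X : Type*} [Fintype U] [DecidableEq U] [Fintype T] [Fintype X]
    (W : Matrix.unitaryGroup U ℂ) (Φ : U → T → EuclideanSpace ℂ X) :
    ∑ u, ∑ t, ∑ j, ‖W.1.mulVec (fun u' => Φ u' t j) u‖ ^ 2 = ∑ u, ∑ t, ‖Φ u t‖ ^ 2 := by
  simp only [EuclideanSpace.norm_sq_eq]
  rw [Finset.sum_comm]
  conv_rhs => rw [Finset.sum_comm]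
  refine Finset.sum_congr rfl fun t _ => ?_
  rw [Finset.sum_comm]
  conv_rhs => rw [Finset.sum_comm]
  exact Finset.sum_congr rfl fun j _ => sum_norm_sq_unitary_mulVec W fun u => Φ u t j

open Classical in
/-- If a state is close to the phase state, the Fourier readout is near the phases. -/
theorem le_sum_fourier_readout (hM : Even M) (hM' : Even M')
    (e : (Fin n → ZMod M) ≃ AddChar (Fin n → ZMod M) ℂ)
    (Φ : (Fin n → ZMod M) → ZMod M' → FlagInput m) (hΦ : ∑ u, ∑ t, ‖Φ u t‖ ^ 2 = 1)
    (φ : Fin n → ℝ) {E : ℝ}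
    (hE : ∑ u, ∑ t, ‖Φ u t - phaseState φ u • clockState m M' t‖ ^ 2 ≤ E) {δ : ℝ} (hδ : 0 < δ)
    (G : (Fin n → ZMod M) → Prop)
    (hG : ∀ u, (∀ k, ‖e u (Pi.single k 1) - exp (φ k * I)‖ ≤ δ) → G u) :
    1 - (2 * E + 2 * (n * ((2 * Real.pi / M) / δ) ^ 4)) ≤
      ∑ u, if G u then
        ∑ t, ∑ j, ‖(fourierUnitary e).1.mulVec (fun u' => Φ u' t j) u‖ ^ 2 else 0 := by
  set W := fourierUnitary e
  set Y : (Fin n → ZMod M) → ℝ := fun u => ∑ t, ∑ j, ‖W.1.mulVec (fun u' => Φ u' t j) u‖ ^ 2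
  set near : (Fin n → ZMod M) → Prop := fun u => ∀ k, ‖e u (Pi.single k 1) - exp (φ k * I)‖ ≤ δ
  have hY0 : ∀ u, 0 ≤ Y u := fun u =>
    Finset.sum_nonneg fun t _ => Finset.sum_nonneg fun j _ => sq_nonneg _
  have hY1 : ∑ u, Y u = 1 := by rw [← hΦ, ← sum_sum_norm_sq_mulVec W]
  set R : (Fin n → ZMod M) → ZMod M' → FlagInput m :=
    fun u t => Φ u t - phaseState φ u • clockState m M' t
  have hR : ∑ u, ∑ t, ∑ j, ‖W.1.mulVec (fun u' => R u' t j) u‖ ^ 2 ≤ E := by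
    rw [sum_sum_norm_sq_mulVec]
    exact hE
  have hx : ∑ t, ∑ j, ‖clockState m M' t j‖ ^ 2 = 1 := by
    rw [← sum_norm_sq_clockState (m := m) hM']
    simp only [EuclideanSpace.norm_sq_eq]
  -- The readout distribution is dominated by twice that of the ideal phase state plus twice that of
  -- the error. This is used only to bound the mass of far points.
  have hYle : ∀ u, Y u ≤ 2 * ∑ t, ∑ j, ‖W.1.mulVec (fun u' => R u' t j) u‖ ^ 2
      + 2 * ‖W.1.mulVec (phaseState φ) u‖ ^ 2 := by
    intro u
    have h1 : ∀ t j, W.1.mulVec (fun u' => Φ u' t j) u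
        = W.1.mulVec (fun u' => R u' t j) u
          + W.1.mulVec (phaseState φ) u * clockState m M' t j := by
      intro t j
      have : (fun u' => Φ u' t j)
          = (fun u' => R u' t j) + clockState m M' t j • phaseState φ := by
        funext u'
        simp [R, mul_comm]
      rw [this, Matrix.mulVec_add, Matrix.mulVec_smul, Pi.add_apply, Pi.smul_apply, smul_eq_mul,
        mul_comm]
    calc Y u ≤ ∑ t, ∑ j, (2 * ‖W.1.mulVec (fun u' => R u' t j) u‖ ^ 2
          + 2 * ‖W.1.mulVec (phaseState φ) u‖ ^ 2 * ‖clockState m M' t j‖ ^ 2) := by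
          refine Finset.sum_le_sum fun t _ => Finset.sum_le_sum fun j _ => ?_
          rw [h1]
          refine (norm_add_sq_le_two_mul _ _).trans (le_of_eq ?_)
          rw [norm_mul, mul_pow]
          ring
      _ = _ := by
          simp only [Finset.sum_add_distrib, ← Finset.mul_sum, hx, mul_one]
  have hfar := sum_far_fourier_phaseState_le hM e φ hδ
  have hsum : ∑ u, (if near u then 0 else Y u)
      ≤ 2 * E + 2 * (n * ((2 * Real.pi / M) / δ) ^ 4) := by
    calc _ ≤ ∑ u, (2 * ∑ t, ∑ j, ‖W.1.mulVec (fun u' => R u' t j) u‖ ^ 2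
          + 2 * (if near u then 0 else ‖W.1.mulVec (phaseState φ) u‖ ^ 2)) := by
          refine Finset.sum_le_sum fun u _ => ?_
          split_ifs
          · have : 0 ≤ ∑ t, ∑ j, ‖W.1.mulVec (fun u' => R u' t j) u‖ ^ 2 :=
              Finset.sum_nonneg fun t _ => Finset.sum_nonneg fun j _ => sq_nonneg _
            linarith
          · exact hYle u
      _ ≤ _ := by
          rw [Finset.sum_add_distrib, ← Finset.mul_sum, ← Finset.mul_sum]
          linarith
  have hle : ∑ u, (Y u - if near u then 0 else Y u) ≤ ∑ u, if G u then Y u else 0 := by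
    refine Finset.sum_le_sum fun u _ => ?_
    by_cases h : near u
    · rw [if_pos h, if_pos (hG u h), sub_zero]
    · rw [if_neg h, sub_self]
      split_ifs
      · exact hY0 u
      · exact le_rfl
  rw [Finset.sum_sub_distrib, hY1] at hle
  linarith

end Success

/-! ### Splitting into positive and negative parts -/

section Means

theorem clip_add_clip_neg_le (a : ℝ) : clip a + clip (-a) ≤ |a| := by
  unfold clip
  rcases le_total 0 a with h | h
  · rw [abs_of_nonneg h, max_eq_left (a := (0 : ℝ)) (b := min (-a) 1)
      ((min_le_left _ _).trans (by linarith)), add_zero]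
    exact max_le h (min_le_left _ _)
  · rw [abs_of_nonpos h, max_eq_left (a := (0 : ℝ)) (b := min a 1)
      ((min_le_left _ _).trans h), zero_add]
    exact max_le (by linarith) (min_le_left _ _)

/-- One of the two clips is zero, so their difference is `a` projected to `[-1, 1]`. Since `x` lies
in that interval, projecting does not increase the distance. -/
theorem abs_clip_sub_clip_neg_sub_le {a x ρ : ℝ} (hx : |x| ≤ 1) (h : |a - x| ≤ ρ) :
    |clip a - clip (-a) - x| ≤ ρ := by
  have h1 := abs_le.1 hx
  have h2 := abs_le.1 h
  unfold clip
  rw [abs_le]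
  rcases le_total 0 a with h0 | h0
  · rw [max_eq_left (a := (0 : ℝ)) (b := min (-a) 1) ((min_le_left _ _).trans (by linarith))]
    rcases le_total a 1 with h3 | h3
    · rw [min_eq_left h3, max_eq_right h0]
      constructor <;> linarith
    · rw [min_eq_right h3, max_eq_right zero_le_one]
      constructor <;> linarith
  · rw [max_eq_left (a := (0 : ℝ)) (b := min a 1) ((min_le_left _ _).trans h0)]
    rcases le_total (-a) 1 with h3 | h3
    · rw [min_eq_left h3, max_eq_right (by linarith)]
      constructor <;> linarith
    · rw [min_eq_right h3, max_eq_right zero_le_one]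
      constructor <;> linarith

variable {m : ℕ} {p : PMF (BitString m)}

/-- The left side is the total flag probability of the two stages, the quantity that governs their
error. -/
theorem clipMean_add_clipMean_neg_le {a x : BitString m → ℝ} {ρ : ℝ}
    (h : ∀ i ∈ p.support, |a i - x i| ≤ ρ) :
    clipMean p a + clipMean p (fun i => -a i) ≤ ∑ i, (p i).toReal * |x i| + ρ := by
  have : ρ = ∑ i, (p i).toReal * ρ := by rw [← Finset.sum_mul, sum_toReal_pmf, one_mul]
  rw [this, clipMean, clipMean, ← Finset.sum_add_distrib, ← Finset.sum_add_distrib]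
  refine Finset.sum_le_sum fun i _ => ?_
  by_cases hi : i ∈ p.support
  · rw [← mul_add, ← mul_add]
    refine mul_le_mul_of_nonneg_left ?_ ENNReal.toReal_nonneg
    have h1 := clip_add_clip_neg_le (a i)
    have h2 := abs_sub_abs_le_abs_sub (a i) (x i)
    linarith [h i hi]
  · have : p i = 0 := by simpa [PMF.mem_support_iff] using hi
    simp [this]

theorem abs_clipMean_sub_clipMean_neg_sub_le {a x : BitString m → ℝ} {ρ : ℝ}
    (h : ∀ i ∈ p.support, |a i - x i| ≤ ρ) (hx : ∀ i ∈ p.support, |x i| ≤ 1) :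
    |clipMean p a - clipMean p (fun i => -a i) - ∑ i, (p i).toReal * x i| ≤ ρ := by
  have h0 : ρ = ∑ i, (p i).toReal * ρ := by rw [← Finset.sum_mul, sum_toReal_pmf, one_mul]
  rw [h0, clipMean, clipMean, ← Finset.sum_sub_distrib, ← Finset.sum_sub_distrib]
  refine (Finset.abs_sum_le_sum_abs _ _).trans (Finset.sum_le_sum fun i _ => ?_)
  by_cases hi : i ∈ p.support
  · rw [← mul_sub, ← mul_sub, abs_mul, abs_of_nonneg ENNReal.toReal_nonneg]
    exact mul_le_mul_of_nonneg_left (abs_clip_sub_clip_neg_sub_le (hx i hi) (h i hi))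
      ENNReal.toReal_nonneg
  · have : p i = 0 := by simpa [PMF.mem_support_iff] using hi
    simp [this]

variable {n M : ℕ} [NeZero M]

/-- Cauchy–Schwarz against the second moment of a centred product weight. The typical size is `√n`
times that of one coordinate, against `n` times in the worst case; the saving in clock size comes
from here. -/
theorem sum_pointWindow_sq_mul_abs_le (hM : Even M) (c : Fin n → ℝ) (hc : ∀ k, |c k| ≤ 1) :
    ∑ u, pointWindow n M u ^ 2 * |∑ k, c k * (centred M (u k) : ℝ)| ≤ M / 2 * √n := by
  have h1 := sum_prod_mul_linear_sq_le (fun t => window M t ^ 2) (fun t => (centred M t : ℝ))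
    (fun t => sq_nonneg _) (sum_window_sq M hM) (sum_window_sq_mul_centred M hM)
    (abs_centred_le M hM) c
  have h2 : ∑ k, c k ^ 2 ≤ n := by
    calc ∑ k, c k ^ 2 ≤ ∑ _k : Fin n, (1 : ℝ) := Finset.sum_le_sum fun k _ => by
          rw [← sq_abs]
          exact pow_le_one₀ (abs_nonneg _) (hc k)
      _ = n := by simp
  have h3 := Finset.sum_mul_sq_le_sq_mul_sq Finset.univ (fun u => pointWindow n M u)
    (fun u => pointWindow n M u * |∑ k, c k * (centred M (u k) : ℝ)|)
  rw [sum_pointWindow_sq hM, one_mul] at h3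
  have h4 : ∑ u, (pointWindow n M u * |∑ k, c k * (centred M (u k) : ℝ)|) ^ 2
      ≤ (M / 2) ^ 2 * n := by
    refine le_trans (le_of_eq ?_) (h1.trans (mul_le_mul_of_nonneg_left h2 (sq_nonneg _)))
    refine Finset.sum_congr rfl fun u _ => ?_
    rw [mul_pow, sq_abs, pointWindow, Finset.prod_pow]
  refine abs_le_of_sq_le_sq' ?_ (by positivity) |>.2
  rw [mul_pow, Real.sq_sqrt (Nat.cast_nonneg n)]
  refine le_trans (le_of_eq ?_) (h3.trans h4)
  congr 1
  exact Finset.sum_congr rfl fun u _ => by ring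

end Means

/-! ### Fixed-point encodings of integers -/

section Encoding

variable {c₁ c₂ : ℕ}

theorem sum_testBit_eq (c k : ℕ) (hk : k < 2 ^ c) :
    (∑ j : Fin c, if k.testBit j then (2 : ℝ) ^ (j : ℕ) else 0) = k := by
  induction c generalizing k with
  | zero =>
    have : k = 0 := by simpa using hk
    simp [this]
  | succ c ih =>
    rw [Fin.sum_univ_succ]
    have h1 : ∀ j : Fin c, (if k.testBit (j.succ : Fin (c + 1)) then
        (2 : ℝ) ^ ((j.succ : Fin (c + 1)) : ℕ) else 0)
        = 2 * (if (k / 2).testBit j then (2 : ℝ) ^ (j : ℕ) else 0) := by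
      intro j
      rw [Fin.val_succ, Nat.testBit_succ]
      split_ifs
      · ring
      · simp
    simp only [h1]
    rw [← Finset.mul_sum, ih (k / 2) (by omega)]
    have h2 : (k : ℝ) = 2 * ((k / 2 : ℕ) : ℝ) + ((k % 2 : ℕ) : ℝ) := by
      exact_mod_cast (Nat.div_add_mod k 2).symm
    rw [h2]
    rcases Nat.mod_two_eq_zero_or_one k with h | h <;> simp [Nat.testBit_zero, h]
    ring

theorem exists_fpVal_eq_intCast (z : ℤ) (hz : z.natAbs < 2 ^ c₁) :
    ∃ q : FixedPoint c₁ c₂, fpVal q = z := by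
  refine ⟨(fun j => z.natAbs.testBit j, fun _ => false, decide (z < 0)), ?_⟩
  have h1 : (z.natAbs : ℝ) = |(z : ℝ)| := by rw [Nat.cast_natAbs, Int.cast_abs]
  simp only [fpVal, sum_testBit_eq c₁ z.natAbs hz, h1]
  by_cases h : z < 0
  · have : (z : ℝ) < 0 := by exact_mod_cast h
    simp [h, abs_of_neg this]
  · have : (0 : ℝ) ≤ z := by exact_mod_cast not_lt.1 h
    simp [h, abs_of_nonneg this]

open Classical in
/-- The inner product of the gradient and the direction `w`, read off from the forward gradient. -/
def decodeInner {n : ℕ} (w : Fin n → ℤ) (y : Fin n → FixedPoint c₁ c₂) : ℝ :=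
  if h : ∃ j, w j ≠ 0 then fpVal (y h.choose) / w h.choose else 0

/-- The direction is encoded exactly, so the only error is that of the oracle. Dividing by an
integer of modulus at least one does not enlarge it, and for `w = 0` the default `0` is the exact
value. -/
theorem abs_decodeInner_sub_le {n d m : ℕ}
    {F : BitString m → (Fin n → FixedPoint c₁ c₂) → Fin n → FixedPoint c₁ c₂}
    {f : EuclideanSpace ℝ (Fin n) → EuclideanSpace ℝ (Fin d) → ℝ}
    {θ : EuclideanSpace ℝ (Fin n)} {X : BitString m → EuclideanSpace ℝ (Fin d)}
    {p : PMF (BitString m)} (hF : Computes F f θ X p) {i : BitString m} (hi : i ∈ p.support)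
    (w : Fin n → ℤ) (q : Fin n → FixedPoint c₁ c₂) (hq : ∀ k, fpVal (q k) = w k)
    (hr : ∀ j, |(∑ k, grad f θ (X i) k * (w k : ℝ)) * w j| ≤ fpRange c₁ c₂) :
    |decodeInner w (F i q) - ∑ k, grad f θ (X i) k * (w k : ℝ)| ≤ (2 ^ c₂)⁻¹ := by
  have hfg : ∀ j, fwdGrad f θ (X i) (fun k => fpVal (q k)) j
      = (∑ k, grad f θ (X i) k * (w k : ℝ)) * w j := by
    intro j
    simp only [fwdGrad, inner_toLp_eq_sum, hq]
  unfold decodeInner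
  split_ifs with h
  · set j := h.choose
    have hj : w j ≠ 0 := h.choose_spec
    have hj1 : (1 : ℝ) ≤ |(w j : ℝ)| := by exact_mod_cast Int.one_le_abs hj
    have hj0 : (w j : ℝ) ≠ 0 := by exact_mod_cast hj
    have h1 := hF i hi q j (by rw [hfg]; exact hr j)
    rw [hfg] at h1
    have h2 : fpVal (F i q j) / (w j : ℝ) - ∑ k, grad f θ (X i) k * (w k : ℝ)
        = (fpVal (F i q j) - (∑ k, grad f θ (X i) k * (w k : ℝ)) * w j) / w j := by
      field_simp
    rw [h2, abs_div]
    exact (div_le_self (abs_nonneg _) hj1).trans h1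
  · push Not at h
    simp [h]

end Encoding

/-! ### Sums over the basis -/

section BasisSums

variable {n m c₁ c₂ K : ℕ}

theorem sum_basis_ite (f : BitString K → Fin n → FixedPoint c₁ c₂)
    (g : BitString K → BitString m → ℝ) :
    ∑ b : Basis n m c₁ c₂ K,
      (if b.2.1 = f b.2.2.2 ∧ b.2.2.1 = (fun _ => fpZero) then g b.2.2.2 b.1 else 0)
      = ∑ z, ∑ i, g z i := by
  rw [Finset.sum_comm, Fintype.sum_prod_type]
  refine Finset.sum_congr rfl fun i _ => ?_
  rw [Fintype.sum_prod_type]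
  simp only [Fintype.sum_prod_type]
  refine (Finset.sum_congr rfl fun w _ => Finset.sum_comm).trans (Finset.sum_comm.trans ?_)
  refine Finset.sum_congr rfl fun z _ => ?_
  rw [Finset.sum_eq_single (f z), Finset.sum_eq_single (fun _ => fpZero)]
  · simp
  · intro y _ hy
    simp [hy]
  · simp
  · intro w _ hw
    simp [hw]
  · simp

theorem sum_norm_sq_embedState {U T : Type} [Fintype U] [Fintype T] (ez : BitString K ≃ U × T × Bool)
    (enc : U → Fin n → FixedPoint c₁ c₂) (φ : U → T → FlagInput m) :
    ∑ b : Basis n m c₁ c₂ K, ‖embedState ez enc φ b‖ ^ 2 = ∑ u, ∑ t, ‖φ u t‖ ^ 2 := by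
  have h : ∀ b : Basis n m c₁ c₂ K, ‖embedState ez enc φ b‖ ^ 2
      = if b.2.1 = enc (ez b.2.2.2).1 ∧ b.2.2.1 = (fun _ => fpZero) then
        ‖φ (ez b.2.2.2).1 (ez b.2.2.2).2.1 ((ez b.2.2.2).2.2, b.1)‖ ^ 2 else 0 := by
    rintro ⟨i, w, y, z⟩
    simp only [embedState]
    split_ifs <;> simp
  simp only [h]
  rw [sum_basis_ite (fun z => enc (ez z).1)
    (fun z i => ‖φ (ez z).1 (ez z).2.1 ((ez z).2.2, i)‖ ^ 2), ← Equiv.sum_comp ez.symm]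
  simp only [Equiv.apply_symm_apply, Fintype.sum_prod_type, EuclideanSpace.norm_sq_eq]

open Classical in
theorem sum_readout {U T : Type} [Fintype U] [Fintype T] [DecidableEq U]
    (ez : BitString K ≃ U × T × Bool) (enc : U → Fin n → FixedPoint c₁ c₂)
    (F : BitString m → (Fin n → FixedPoint c₁ c₂) → Fin n → FixedPoint c₁ c₂)
    (P : Matrix.unitaryGroup (BitString m) ℂ)
    (V : Matrix.unitaryGroup (Fin n → FixedPoint c₁ c₂) ℂ)
    (W : Matrix.unitaryGroup U ℂ) (φ : U → T → FlagInput m) (G : U → Prop) :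
    ∑ b : Basis n m c₁ c₂ K, (if G (ez b.2.2.2).1 then
      ‖run F P V (readoutSteps m ez enc W) (embedState ez enc φ) b‖ ^ 2 else 0)
      = ∑ u, if G u then ∑ t, ∑ j, ‖W.1.mulVec (fun u' => φ u' t j) u‖ ^ 2 else 0 := by
  have h : ∀ b : Basis n m c₁ c₂ K, (if G (ez b.2.2.2).1 then
      ‖run F P V (readoutSteps m ez enc W) (embedState ez enc φ) b‖ ^ 2 else 0)
      = if b.2.1 = (fun _ => fpZero) ∧ b.2.2.1 = (fun _ => fpZero) then
        (if G (ez b.2.2.2).1 then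
          ‖W.1.mulVec (fun u => φ u (ez b.2.2.2).2.1 ((ez b.2.2.2).2.2, b.1)) (ez b.2.2.2).1‖ ^ 2
          else 0) else 0 := by
    rintro ⟨i, w, y, z⟩
    rw [run_readoutSteps]
    split_ifs <;> simp
  simp only [h]
  rw [sum_basis_ite (fun _ _ => fpZero) (fun z i => if G (ez z).1 then
      ‖W.1.mulVec (fun u => φ u (ez z).2.1 ((ez z).2.2, i)) (ez z).1‖ ^ 2 else 0),
    ← Equiv.sum_comp ez.symm]
  simp only [Equiv.apply_symm_apply, Fintype.sum_prod_type]
  refine Finset.sum_congr rfl fun u _ => ?_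
  split_ifs <;> simp

end BasisSums

/-! ### The estimator -/

section Estimator

variable {n m c₁ c₂ : ℕ}

/-- The chord is `2 |sin ((x - y) / 2)|`. As `|x - y| ≤ 2` there is no wraparound, and Jordan's
inequality applies with `2 / π ≥ 1 / 2`. -/
theorem abs_sub_le_of_norm_exp_sub_le {x y δ : ℝ} (hx : |x| ≤ 1) (hy : |y| ≤ 1)
    (h : ‖Complex.exp (x * Complex.I) - Complex.exp (y * Complex.I)‖ ≤ δ) : |x - y| ≤ 2 * δ := by
  have h1 : ‖Complex.exp (x * Complex.I) - Complex.exp (y * Complex.I)‖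
      = 2 * |Real.sin ((x - y) / 2)| := by
    have e : Complex.exp (x * Complex.I) - Complex.exp (y * Complex.I)
        = Complex.exp (y * Complex.I) * (Complex.exp (Complex.I * (x - y : ℝ)) - 1) := by
      rw [mul_sub, ← Complex.exp_add]
      push_cast
      ring_nf
    rw [e, norm_mul, Complex.norm_exp_ofReal_mul_I, one_mul, Complex.norm_exp_I_mul_ofReal_sub_one,
      norm_mul, Real.norm_eq_abs, Real.norm_eq_abs, abs_of_pos (by norm_num : (0 : ℝ) < 2)]
  have hxy : |x - y| ≤ 2 := (abs_sub _ _).trans (by linarith)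
  have h2 : |(x - y) / 2| ≤ Real.pi / 2 := by
    rw [abs_div, abs_of_pos (by norm_num : (0 : ℝ) < 2)]
    linarith [Real.pi_gt_three]
  have h3 := Real.mul_abs_le_abs_sin h2
  rw [abs_div, abs_of_pos (by norm_num : (0 : ℝ) < 2)] at h3
  have h4 : 1 / 2 ≤ 2 / Real.pi := by
    rw [div_le_div_iff₀ (by norm_num) Real.pi_pos]
    linarith [Real.pi_le_four]
  have h5 := mul_le_mul_of_nonneg_right h4 (by positivity : 0 ≤ |x - y| / 2)
  linarith

theorem natAbs_centred_lt {M : ℕ} [NeZero M] (hM : Even M) (t : ZMod M) :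
    (centred M t).natAbs < M := by
  have h1 := abs_centred_le M hM t
  have h2 : (0 : ℝ) < M := Nat.cast_pos.2 (NeZero.pos M)
  have h3 : ((centred M t).natAbs : ℝ) < M := by
    rw [Nat.cast_natAbs, Int.cast_abs]
    linarith
  exact_mod_cast h3

theorem abs_sum_mul_centred_le {M : ℕ} [NeZero M] (hM : Even M) {c : Fin n → ℝ} {R : ℝ}
    (hc : ∀ k, |c k| ≤ R) (u : Fin n → ZMod M) :
    |∑ k, c k * (centred M (u k) : ℝ)| ≤ n * (R * (M / 2)) := by
  refine (Finset.abs_sum_le_sum_abs _ _).trans ?_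
  calc _ ≤ ∑ _k : Fin n, R * ((M : ℝ) / 2) := Finset.sum_le_sum fun k _ => by
        rw [abs_mul]
        exact mul_le_mul (hc k) (abs_centred_le M hM _) (abs_nonneg _)
          ((abs_nonneg _).trans (hc k))
    _ = _ := by simp

/-- The error of the state before the readout. -/
def stateError (n M M' : ℕ) (ρ : ℝ) : ℝ :=
  2 * ((n * (M / 2) / 2) ^ 2 * (2 * (2 * Real.pi / M') ^ 4
    + 16 * ((M / 2 * √n + ρ) / (n * (M / 2))) * (2 * Real.pi / M') ^ 2)) + 2 * ρ ^ 2

/-- The state before the readout is close to the phase state. -/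
theorem sum_norm_sq_sub_phaseState_le {M M' : ℕ} [NeZero M] [NeZero M'] (hn : 1 ≤ n)
    (hM : Even M) (hM' : Even M') {p : PMF (BitString m)}
    {P : Matrix.unitaryGroup (BitString m) ℂ} (hP : LoadsInput P p)
    (e : ZMod M' ≃ AddChar (ZMod M') ℂ) {ρ : ℝ}
    (c : BitString m → Fin n → ℝ) (hc : ∀ i ∈ p.support, ∀ k, |c i k| ≤ 1)
    (b : (Fin n → ZMod M) → BitString m → ℝ)
    (hb : ∀ u, ∀ i ∈ p.support, |b u i - ∑ k, c i k * (centred M (u k) : ℝ)| ≤ ρ) :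
    ∑ u, ∑ t, ‖(pointWindow n M u : ℂ) •
        stageOp M' P (fun i => -(b u i / (n * (M / 2)))) e (-(n * (M / 2)))
          (stageOp M' P (fun i => b u i / (n * (M / 2))) e (n * (M / 2)) (clockState m M')) t
        - phaseState (fun k => ∑ i, (p i).toReal * c i k) u • clockState m M' t‖ ^ 2
      ≤ stateError n M M' ρ := by
  have hM0 : (0 : ℝ) < M := Nat.cast_pos.2 (NeZero.pos M)
  have hn0 : (0 : ℝ) < n := Nat.cast_pos.2 (by omega)
  set Λ : ℝ := n * (M / 2) with hΛ
  have hΛ0 : 0 < Λ := by positivity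
  set φ : Fin n → ℝ := fun k => ∑ i, (p i).toReal * c i k
  set h' : ℝ := 2 * Real.pi / M'
  set S : (Fin n → ZMod M) → ℝ :=
    fun u => clipMean p (fun i => b u i / Λ) + clipMean p (fun i => -(b u i / Λ))
  have hbx : ∀ u : Fin n → ZMod M, ∀ i ∈ p.support,
      |b u i / Λ - (∑ k, c i k * (centred M (u k) : ℝ)) / Λ| ≤ ρ / Λ := by
    intro u i hi
    rw [← sub_div, abs_div, abs_of_pos hΛ0]
    exact div_le_div_of_nonneg_right (hb u i hi) hΛ0.le
  have hx1 : ∀ u : Fin n → ZMod M, ∀ i ∈ p.support, |(∑ k, c i k * (centred M (u k) : ℝ)) / Λ| ≤ 1 := by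
    intro u i hi
    rw [abs_div, abs_of_pos hΛ0, div_le_one hΛ0]
    simpa [hΛ] using abs_sum_mul_centred_le hM (hc i hi) u
  -- Positive minus negative part recovers the signed mean, so the accumulated phase is linear in
  -- the point up to the rounding error `ρ`.
  have hphase : ∀ u : Fin n → ZMod M, |Λ * (clipMean p (fun i => b u i / Λ) - clipMean p (fun i => -(b u i / Λ)))
      - ∑ k, φ k * (centred M (u k) : ℝ)| ≤ ρ := by
    intro u
    have h1 := abs_clipMean_sub_clipMean_neg_sub_le (hbx u) (hx1 u)
    have h2 : ∑ k, φ k * (centred M (u k) : ℝ)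
        = Λ * ∑ i, (p i).toReal * ((∑ k, c i k * (centred M (u k) : ℝ)) / Λ) := by
      rw [Finset.mul_sum]
      simp only [φ, Finset.sum_mul]
      rw [Finset.sum_comm]
      refine Finset.sum_congr rfl fun i _ => ?_
      rw [mul_left_comm, mul_div_cancel₀ _ hΛ0.ne', Finset.mul_sum]
      exact Finset.sum_congr rfl fun k _ => by ring
    rw [h2, ← mul_sub, abs_mul, abs_of_pos hΛ0]
    calc _ ≤ Λ * (ρ / Λ) := mul_le_mul_of_nonneg_left h1 hΛ0.le
      _ = ρ := mul_div_cancel₀ _ hΛ0.ne'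
  -- Only the window average of the flag probabilities enters the final error. It is bounded for
  -- each input separately, then averaged over inputs.
  have hS : ∑ u : Fin n → ZMod M, pointWindow n M u ^ 2 * S u ≤ (M / 2 * √n + ρ) / Λ := by
    have h1 : ∀ u : Fin n → ZMod M, S u ≤ ∑ i, (p i).toReal * |(∑ k, c i k * (centred M (u k) : ℝ)) / Λ| + ρ / Λ :=
      fun u => clipMean_add_clipMean_neg_le (hbx u)
    calc _ ≤ ∑ u : Fin n → ZMod M, pointWindow n M u ^ 2 * (∑ i, (p i).toReal
          * |(∑ k, c i k * (centred M (u k) : ℝ)) / Λ| + ρ / Λ) :=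
          Finset.sum_le_sum fun u _ => mul_le_mul_of_nonneg_left (h1 u) (sq_nonneg _)
      _ = ∑ i, (p i).toReal * ((∑ u, pointWindow n M u ^ 2
          * |∑ k, c i k * (centred M (u k) : ℝ)|) / Λ) + ρ / Λ := by
          simp only [mul_add, Finset.sum_add_distrib, ← Finset.sum_mul, sum_pointWindow_sq hM,
            one_mul]
          congr 1
          simp only [Finset.mul_sum, Finset.sum_div]
          rw [Finset.sum_comm]
          refine Finset.sum_congr rfl fun i _ => Finset.sum_congr rfl fun u _ => ?_
          rw [← Finset.sum_div, abs_div, abs_of_pos hΛ0]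
          ring
      _ ≤ ∑ i, (p i).toReal * ((M / 2 * √n) / Λ) + ρ / Λ := by
          refine add_le_add_left (Finset.sum_le_sum fun i _ => ?_) _
          by_cases hi : i ∈ p.support
          · refine mul_le_mul_of_nonneg_left ?_ ENNReal.toReal_nonneg
            exact div_le_div_of_nonneg_right (sum_pointWindow_sq_mul_abs_le hM (c i) (hc i hi))
              hΛ0.le
          · have : p i = 0 := by simpa [PMF.mem_support_iff] using hi
            simp [this]
      _ = _ := by
          rw [← Finset.sum_mul, sum_toReal_pmf]
          ring
  have hu : ∀ u : Fin n → ZMod M, ∑ t, ‖(pointWindow n M u : ℂ) •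
        stageOp M' P (fun i => -(b u i / Λ)) e (-Λ)
          (stageOp M' P (fun i => b u i / Λ) e Λ (clockState m M')) t
        - phaseState φ u • clockState m M' t‖ ^ 2
      ≤ pointWindow n M u ^ 2 * (2 * ((Λ / 2) ^ 2 * (2 * h' ^ 4 + 16 * S u * h' ^ 2))
        + 2 * ρ ^ 2) := by
    intro u
    have h1 := sum_norm_sq_stageOp_stageOp_sub_le (M := M') hM' hP (fun i => b u i / Λ)
      (fun i => -(b u i / Λ)) e Λ
    set η := stageOp M' P (fun i => -(b u i / Λ)) e (-Λ)
          (stageOp M' P (fun i => b u i / Λ) e Λ (clockState m M'))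
    set γ := Λ * (clipMean p (fun i => b u i / Λ) - clipMean p (fun i => -(b u i / Λ)))
    set γ' := ∑ k, φ k * (centred M (u k) : ℝ)
    -- Two errors at a fixed point: the stages against their ideal phase `γ`, and `γ` against the
    -- linear phase `γ'`.
    have h2 : ∀ t, ‖(pointWindow n M u : ℂ) • η t - phaseState φ u • clockState m M' t‖ ^ 2
        ≤ pointWindow n M u ^ 2 * (2 * ‖η t - Complex.exp (γ * Complex.I) • clockState m M' t‖ ^ 2
          + 2 * ρ ^ 2 * ‖clockState m M' t‖ ^ 2) := by
      intro t
      have h3 : (pointWindow n M u : ℂ) • η t - phaseState φ u • clockState m M' t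
          = (pointWindow n M u : ℂ) • ((η t - Complex.exp (γ * Complex.I) • clockState m M' t)
            + (Complex.exp (γ * Complex.I) - Complex.exp (γ' * Complex.I)) • clockState m M' t) := by
        rw [phaseState, mul_smul, sub_smul, ← smul_sub]
        congr 1
        abel
      rw [h3, norm_smul, mul_pow, Complex.norm_real, Real.norm_eq_abs, sq_abs]
      refine mul_le_mul_of_nonneg_left ?_ (sq_nonneg _)
      refine (norm_add_sq_le_two_mul _ _).trans ?_
      rw [norm_smul, mul_pow]
      have h4 : ‖Complex.exp (γ * Complex.I) - Complex.exp (γ' * Complex.I)‖ ^ 2 ≤ ρ ^ 2 :=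
        pow_le_pow_left₀ (norm_nonneg _) ((norm_exp_mul_I_sub_le _ _).trans (hphase u)) 2
      nlinarith [sq_nonneg ‖clockState m M' t‖]
    refine (Finset.sum_le_sum fun t _ => h2 t).trans ?_
    rw [← Finset.mul_sum, Finset.sum_add_distrib, ← Finset.mul_sum, ← Finset.mul_sum,
      sum_norm_sq_clockState hM', mul_one]
    refine mul_le_mul_of_nonneg_left ?_ (sq_nonneg _)
    linarith
  refine (Finset.sum_le_sum fun u _ => hu u).trans ?_
  have h5 : ∑ u, pointWindow n M u ^ 2 * (2 * ((Λ / 2) ^ 2 * (2 * h' ^ 4 + 16 * S u * h' ^ 2))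
        + 2 * ρ ^ 2)
      = 2 * ((Λ / 2) ^ 2 * (2 * h' ^ 4 + 16 * (∑ u, pointWindow n M u ^ 2 * S u) * h' ^ 2))
        + 2 * ρ ^ 2 := by
    have h6 : ∀ u, pointWindow n M u ^ 2 * (2 * ((Λ / 2) ^ 2 * (2 * h' ^ 4 + 16 * S u * h' ^ 2))
        + 2 * ρ ^ 2) = pointWindow n M u ^ 2 * (2 * ((Λ / 2) ^ 2 * (2 * h' ^ 4)) + 2 * ρ ^ 2)
          + (pointWindow n M u ^ 2 * S u) * (2 * ((Λ / 2) ^ 2 * (16 * h' ^ 2))) := fun u => by ring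
    simp only [h6]
    rw [Finset.sum_add_distrib, ← Finset.sum_mul, ← Finset.sum_mul, sum_pointWindow_sq hM]
    ring
  rw [h5, stateError, ← hΛ]
  gcongr

open Classical in
/-- The estimate read off from a character: phases close to its values on the unit vectors. -/
def estimate {M : ℕ} [NeZero M] (s δ : ℝ) (χ : AddChar (Fin n → ZMod M) ℂ) : Fin n → ℝ :=
  if h : ∃ v : Fin n → ℝ, (∀ k, |v k| ≤ 1) ∧
      ∀ k, ‖χ (Pi.single k 1) - Complex.exp (v k * Complex.I)‖ ≤ δ then fun k => h.choose k / s
  else 0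

/-- The true phases are admissible in the choice, so the chosen ones lie within a chord of `2 δ` of
them, hence within `4 δ`. -/
theorem abs_estimate_sub_le {M : ℕ} [NeZero M] {s δ : ℝ} (hs : 0 < s)
    {χ : AddChar (Fin n → ZMod M) ℂ} {φ : Fin n → ℝ} (hφ : ∀ k, |φ k| ≤ 1)
    (h : ∀ k, ‖χ (Pi.single k 1) - Complex.exp (φ k * Complex.I)‖ ≤ δ) (k : Fin n) :
    |estimate s δ χ k - φ k / s| ≤ 4 * δ / s := by
  have hex : ∃ v : Fin n → ℝ, (∀ k, |v k| ≤ 1) ∧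
      ∀ k, ‖χ (Pi.single k 1) - Complex.exp (v k * Complex.I)‖ ≤ δ := ⟨φ, hφ, h⟩
  rw [estimate, dif_pos hex]
  obtain ⟨h1, h2⟩ := hex.choose_spec
  have h3 : ‖Complex.exp (hex.choose k * Complex.I) - Complex.exp (φ k * Complex.I)‖ ≤ 2 * δ := by
    calc _ = ‖(χ (Pi.single k 1) - Complex.exp (φ k * Complex.I))
          - (χ (Pi.single k 1) - Complex.exp (hex.choose k * Complex.I))‖ := by
          congr 1
          ring
      _ ≤ _ := (norm_sub_le _ _).trans (by linarith [h k, h2 k])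
  have h4 := abs_sub_le_of_norm_exp_sub_le (h1 k) (hφ k) h3
  rw [← sub_div, abs_div, abs_of_pos hs]
  exact div_le_div_of_nonneg_right (by linarith) hs.le

/-- Both cyclic groups have order a power of two, so point, clock and flag fill a register of qubits
exactly. -/
theorem exists_equiv_bitString (n r r' : ℕ) : ∃ K : ℕ,
    Nonempty (BitString K ≃ (Fin n → ZMod (2 ^ r)) × ZMod (2 ^ r') × Bool) := by
  refine ⟨r * n + (r' + 1), ⟨Fintype.equivOfCardEq ?_⟩⟩
  simp only [Fintype.card_pi, Fintype.card_bool, Finset.prod_const, Finset.card_univ,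
    Fintype.card_fin, Fintype.card_prod, ZMod.card]
  rw [pow_add, pow_mul, pow_succ]

/-- The estimator of the mean gradient, with clock size `2 ^ r'` and window size `2 ^ r`. -/
theorem exists_estimator (m : ℕ) {r r' : ℕ} (hn : 1 ≤ n) (hr : 1 ≤ r) (hr' : 1 ≤ r')
    (hrc : r ≤ c₁) {s δ : ℝ} (hs : 0 < s) (hδ : 0 < δ)
    (hrange : n * (s⁻¹ * ((2 : ℝ) ^ r / 2)) * (2 ^ r / 2) ≤ fpRange c₁ c₂) :
    ∃ A : QueryAlgorithm n m c₁ c₂, A.queries = 16 * 2 ^ r' + 8 ∧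
      ∀ (d : ℕ) (f : EuclideanSpace ℝ (Fin n) → EuclideanSpace ℝ (Fin d) → ℝ)
        (θ : EuclideanSpace ℝ (Fin n)) (X : BitString m → EuclideanSpace ℝ (Fin d))
        (p : PMF (BitString m)) (_ : ∀ i ∈ p.support, ∀ k, |grad f θ (X i) k| ≤ s⁻¹)
        (F : BitString m → (Fin n → FixedPoint c₁ c₂) → Fin n → FixedPoint c₁ c₂)
        (P : Matrix.unitaryGroup (BitString m) ℂ)
        (V : Matrix.unitaryGroup (Fin n → FixedPoint c₁ c₂) ℂ),
        Computes F f θ X p → LoadsInput P p →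
        1 - (2 * stateError n (2 ^ r) (2 ^ r') (s * (2 ^ c₂)⁻¹)
            + 2 * (n * ((2 * Real.pi / (2 ^ r : ℕ)) / δ) ^ 4))
          ≤ A.prob F P V {y | ∀ k, |y k - fwdGradMean f θ X p k| ≤ 4 * δ / s} := by
  classical
  obtain ⟨K, ⟨ez⟩⟩ := exists_equiv_bitString n r r'
  have hM : Even (2 ^ r) := (Nat.even_pow' (by omega)).2 even_two
  have hM' : Even (2 ^ r') := (Nat.even_pow' (by omega)).2 even_two
  set M := 2 ^ r with hMdef
  set M' := 2 ^ r' with hMdef'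
  have hcast : (M : ℝ) = 2 ^ r := by rw [hMdef]; push_cast; rfl
  have henc : ∀ t : ZMod M, ∃ q : FixedPoint c₁ c₂, fpVal q = centred M t := fun t =>
    exists_fpVal_eq_intCast _ ((natAbs_centred_lt hM t).trans_le
      (Nat.pow_le_pow_right (by norm_num) hrc))
  choose enc₁ henc₁ using henc
  let enc : (Fin n → ZMod M) → Fin n → FixedPoint c₁ c₂ := fun u k => enc₁ (u k)
  -- Any labelling of the characters will do, since the output is computed from the character and
  -- not from its label.
  let e : (Fin n → ZMod M) ≃ AddChar (Fin n → ZMod M) ℂ :=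
    Fintype.equivOfCardEq AddChar.card_eq.symm
  let e' : ZMod M' ≃ AddChar (ZMod M') ℂ := Fintype.equivOfCardEq AddChar.card_eq.symm
  -- A bound for the rescaled inner products: `n` coordinates, each a coefficient in `[-1, 1]` times
  -- an integer of modulus at most `M / 2`.
  set Λ : ℝ := n * (M / 2) with hΛ
  let b : (Fin n → ZMod M) → (Fin n → FixedPoint c₁ c₂) → ℝ :=
    fun u y => s * decodeInner (fun k => centred M (u k)) y
  let φ₀ : (Fin n → ZMod M) → ZMod M' → FlagInput m :=
    fun u t => (pointWindow n M u : ℂ) • clockState m M' t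
  have hφ₀ : ∑ u, ∑ t, ‖φ₀ u t‖ ^ 2 = 1 := by
    simp only [φ₀, norm_smul, mul_pow, ← Finset.mul_sum, sum_norm_sq_clockState hM', mul_one,
      Complex.norm_real, Real.norm_eq_abs, sq_abs, sum_pointWindow_sq hM]
  -- The initial state depends on neither the loss nor the input law, so a query-free unitary
  -- prepares it.
  obtain ⟨U₀, hU₀⟩ := exists_unitary_mulVec_single
    ((fun _ => false, fun _ => fpZero, fun _ => fpZero, fun _ => false) : Basis n m c₁ c₂ K)
    (embedState ez enc φ₀) (by rw [sum_norm_sq_embedState, hφ₀])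
  let L₁ := stageSteps m ez ZMod.val M' (fun u y => b u y / Λ) (phaseUnitary e' 1 Λ)
  let L₂ := stageSteps m ez ZMod.val M' (fun u y => -(b u y / Λ)) (phaseUnitary e' 1 (-Λ))
  let L₃ := readoutSteps m ez enc (fourierUnitary e)
  let A : QueryAlgorithm n m c₁ c₂ :=
    { workspace := K
      steps := [.free U₀] ++ ((L₁ ++ L₂) ++ L₃)
      output := fun x => estimate s δ (e (ez x.2.2.2).1) }
  refine ⟨A, ?_, ?_⟩
  · change stepsCost ([.free U₀] ++ ((L₁ ++ L₂) ++ L₃)) = _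
    have h0 : stepsCost [Step.free U₀] = 0 := rfl
    have h3 : stepsCost L₃ = 0 := rfl
    rw [stepsCost_append, stepsCost_append (L := L₁ ++ L₂), stepsCost_append (L := L₁), h0, h3,
      stepsCost_stageSteps, stepsCost_stageSteps]
    ring
  intro d f θ X p hgrad F P V hF hP
  let c : BitString m → Fin n → ℝ := fun i k => s * grad f θ (X i) k
  have hc : ∀ i ∈ p.support, ∀ k, |c i k| ≤ 1 := by
    intro i hi k
    rw [abs_mul, abs_of_pos hs]
    calc _ ≤ s * s⁻¹ := mul_le_mul_of_nonneg_left (hgrad i hi k) hs.le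
      _ = 1 := mul_inv_cancel₀ hs.ne'
  have hb : ∀ u, ∀ i ∈ p.support,
      |b u (F i (enc u)) - ∑ k, c i k * (centred M (u k) : ℝ)| ≤ s * (2 ^ c₂)⁻¹ := by
    intro u i hi
    have h1 := abs_decodeInner_sub_le hF hi (fun k => centred M (u k)) (enc u)
      (fun k => henc₁ (u k)) (fun j => by
        rw [abs_mul]
        refine le_trans ?_ hrange
        rw [← hcast]
        exact mul_le_mul (abs_sum_mul_centred_le hM (hgrad i hi) u) (abs_centred_le M hM _)
          (abs_nonneg _) (by positivity))
    have h2 : ∑ k, c i k * (centred M (u k) : ℝ)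
        = s * ∑ k, grad f θ (X i) k * (centred M (u k) : ℝ) := by
      rw [Finset.mul_sum]
      exact Finset.sum_congr rfl fun k _ => by ring
    rw [h2, ← mul_sub, abs_mul, abs_of_pos hs]
    exact mul_le_mul_of_nonneg_left h1 hs.le
  let Φ : (Fin n → ZMod M) → ZMod M' → FlagInput m := fun u =>
    stageOp M' P (fun i => -(b u (F i (enc u)) / Λ)) e' (-Λ)
      (stageOp M' P (fun i => b u (F i (enc u)) / Λ) e' Λ (φ₀ u))
  have hfinal : A.finalState F P V = run F P V L₃ (embedState ez enc Φ) := by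
    have h1 : A.finalState F P V = run F P V ((L₁ ++ L₂) ++ L₃) (U₀.1.mulVec A.initState) := rfl
    have h2 : U₀.1.mulVec A.initState = embedState ez enc φ₀ := hU₀
    have h3 := (realizes_stageSteps (ez := ez) (enc := enc) (F := F) (P := P) (V := V)
      (fun t : ZMod M' => (ZMod.val_lt t).le) (fun u y => b u y / Λ)
      (phaseUnitary e' 1 Λ)).append (realizes_stageSteps (fun t : ZMod M' => (ZMod.val_lt t).le)
        (fun u y => -(b u y / Λ)) (phaseUnitary e' 1 (-Λ)))
    rw [h1, h2, run_append, h3]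
    rfl
  have hΦ : ∀ u t, Φ u t = (pointWindow n M u : ℂ) •
      stageOp M' P (fun i => -(b u (F i (enc u)) / Λ)) e' (-Λ)
        (stageOp M' P (fun i => b u (F i (enc u)) / Λ) e' Λ (clockState m M')) t := by
    intro u t
    simp only [Φ, φ₀, stageOp_smul]
  have hΦ1 : ∑ u, ∑ t, ‖Φ u t‖ ^ 2 = 1 := by
    rw [← hφ₀]
    refine Finset.sum_congr rfl fun u _ => ?_
    rw [sum_norm_sq_stageOp, sum_norm_sq_stageOp]
  have hE := sum_norm_sq_sub_phaseState_le (M := M) (M' := M') hn hM hM' hP e'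
    c hc (fun u i => b u (F i (enc u))) hb
  simp only [← hΛ, ← hΦ] at hE
  have hφ : ∀ k, ∑ i, (p i).toReal * c i k = s * fwdGradMean f θ X p k := by
    intro k
    rw [fwdGradMean_eq_sum, Finset.mul_sum]
    exact Finset.sum_congr rfl fun i _ => by ring
  have hφ1 : ∀ k, |∑ i, (p i).toReal * c i k| ≤ 1 := by
    intro k
    rw [← sum_toReal_pmf p]
    refine (Finset.abs_sum_le_sum_abs _ _).trans (Finset.sum_le_sum fun i _ => ?_)
    rw [abs_mul, abs_of_nonneg ENNReal.toReal_nonneg]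
    by_cases hi : i ∈ p.support
    · exact mul_le_of_le_one_right ENNReal.toReal_nonneg (hc i hi k)
    · have : p i = 0 := by simpa [PMF.mem_support_iff] using hi
      simp [this]
  have hmain := le_sum_fourier_readout hM hM' e Φ hΦ1 _ hE hδ
    (fun u => estimate s δ (e u) ∈ {y : Fin n → ℝ |
      ∀ k, |y k - fwdGradMean f θ X p k| ≤ 4 * δ / s}) (by
      intro u hu k
      have h1 := abs_estimate_sub_le hs hφ1 hu k
      rwa [hφ, mul_div_cancel_left₀ _ hs.ne'] at h1)
  refine hmain.trans (le_of_eq ?_)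
  rw [← sum_readout (K := K) (c₁ := c₁) (c₂ := c₂) ez enc F P V (fourierUnitary e) Φ]
  rw [QueryAlgorithm.prob, hfinal]
  refine Finset.sum_congr rfl fun x _ => ?_
  rw [Set.indicator_apply]
  rfl

end Estimator

/-! ### Choice of the parameters -/

section Main

variable {c₁ c₂ n m : ℕ}

theorem exists_pow_two_near {x : ℝ} (hx : 1 ≤ x) :
    ∃ r : ℕ, 1 ≤ r ∧ x ≤ 2 ^ r ∧ (2 : ℝ) ^ r ≤ 2 * x := by
  obtain ⟨k, h1, h2⟩ := exists_nat_pow_near hx (one_lt_two : (1 : ℝ) < 2)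
  exact ⟨k + 1, by omega, h2.le, by rw [pow_succ]; linarith⟩

/-- With `q = n ^ (1/4)` all the sizes involved are polynomial in `q`, `M` and their inverses. -/
theorem exists_fourth_root (hn : 1 ≤ n) : ∃ q : ℝ, 1 ≤ q ∧ q ^ 4 = n ∧ q ^ 2 = √n := by
  have h0 : (1 : ℝ) ≤ n := by exact_mod_cast hn
  have h2 : √(√n) ^ 2 = √(n : ℝ) := Real.sq_sqrt (Real.sqrt_nonneg _)
  refine ⟨√(√n), ?_, ?_, h2⟩
  · rw [Real.one_le_sqrt, Real.one_le_sqrt]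
    exact h0
  · rw [show 4 = 2 * 2 by norm_num, pow_mul, h2, Real.sq_sqrt (by positivity)]

/-- The hypothesis on `M'` gives `Λ h' ≤ q π / 512 ≤ q / 160`, the averaged flag probability is at
most `2 / q²`, and `h' ≤ 1 / (50 q)`. The powers of `q` cancel in `Λ² h'⁴` and in the probability
times `Λ² h'²`. -/
theorem stateError_le {M M' : ℕ} {q ρ : ℝ} (hq : 1 ≤ q) (hq4 : q ^ 4 = n) (hq2 : q ^ 2 = √n)
    (hM : 1 ≤ M) (hM' : 512 * q ^ 3 * M ≤ M') (hρ0 : 0 ≤ ρ) (hρ : ρ ≤ 1 / 100) :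
    stateError n M M' ρ ≤ 1 / 1000 := by
  have hM1 : (1 : ℝ) ≤ M := by exact_mod_cast hM
  have hq0 : 0 < q := by linarith
  have hM'0 : (0 : ℝ) < M' := lt_of_lt_of_le (by positivity) hM'
  rw [stateError, ← hq2, ← hq4]
  set Λ : ℝ := q ^ 4 * (M / 2)
  set h' : ℝ := 2 * Real.pi / M'
  have hΛ0 : 0 < Λ := by positivity
  have hh0 : 0 ≤ h' := by positivity
  have hΛh : Λ * h' ≤ q / 160 := by
    have : Λ * h' = q ^ 4 * M * Real.pi / M' := by
      simp only [Λ, h']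
      ring
    rw [this, div_le_iff₀ hM'0]
    have h1 : q / 160 * (512 * q ^ 3 * M) ≤ q / 160 * M' :=
      mul_le_mul_of_nonneg_left hM' (by positivity)
    have h2 : q ^ 4 * M * Real.pi ≤ q ^ 4 * M * 3.2 :=
      mul_le_mul_of_nonneg_left (by linarith [Real.pi_lt_d2]) (by positivity)
    nlinarith
  have hh : h' ≤ 1 / (50 * q) := by
    rw [div_le_div_iff₀ hM'0 (by positivity)]
    have h1 : 1 ≤ q ^ 2 * M := by nlinarith [one_le_pow₀ hq (n := 2)]
    have h2 : 512 * q * 1 ≤ 512 * q * (q ^ 2 * M) := mul_le_mul_of_nonneg_left h1 (by positivity)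
    have h3 : Real.pi * q ≤ 3.2 * q :=
      mul_le_mul_of_nonneg_right (by linarith [Real.pi_lt_d2]) hq0.le
    nlinarith
  have ha : (M / 2 * q ^ 2 + ρ) / Λ ≤ 2 / q ^ 2 := by
    rw [div_le_div_iff₀ hΛ0 (by positivity)]
    have h1 : 1 / 100 ≤ (M : ℝ) / 2 * q ^ 2 := by nlinarith [one_le_pow₀ hq (n := 2)]
    have h2 : ρ * q ^ 2 ≤ (M / 2 * q ^ 2) * q ^ 2 :=
      mul_le_mul_of_nonneg_right (hρ.trans h1) (by positivity)
    simp only [Λ]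
    nlinarith
  have hsq : Λ ^ 2 * h' ^ 2 ≤ q ^ 2 / 25600 := by
    rw [← mul_pow]
    calc _ ≤ (q / 160) ^ 2 := pow_le_pow_left₀ (by positivity) hΛh 2
      _ = _ := by ring
  have hhsq : h' ^ 2 ≤ 1 / (2500 * q ^ 2) := by
    calc _ ≤ (1 / (50 * q)) ^ 2 := pow_le_pow_left₀ hh0 hh 2
      _ = _ := by ring
  have h1 : Λ ^ 2 * h' ^ 4 ≤ 1 / 64000000 := by
    calc Λ ^ 2 * h' ^ 4 = (Λ ^ 2 * h' ^ 2) * h' ^ 2 := by ring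
      _ ≤ q ^ 2 / 25600 * (1 / (2500 * q ^ 2)) :=
        mul_le_mul hsq hhsq (by positivity) (by positivity)
      _ = _ := by field_simp; norm_num
  have h2 : (M / 2 * q ^ 2 + ρ) / Λ * (Λ ^ 2 * h' ^ 2) ≤ 2 / 25600 := by
    calc _ ≤ 2 / q ^ 2 * (q ^ 2 / 25600) := mul_le_mul ha hsq (by positivity) (by positivity)
      _ = _ := by field_simp
  have h3 : ρ ^ 2 ≤ 1 / 10000 := by
    calc _ ≤ (1 / 100 : ℝ) ^ 2 := pow_le_pow_left₀ hρ0 hρ 2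
      _ = _ := by norm_num
  nlinarith

/-- The window is wide enough that each coordinate fails with probability of order `1 / n`: the
ratio is at most `8 * 3.2 / (256 q) = 1 / (10 q)`, and `q ^ 4 = n` absorbs the union bound. -/
theorem readoutError_le {M : ℕ} {q δ : ℝ} (hq : 1 ≤ q) (hq4 : q ^ 4 = n) (hM0 : 1 ≤ M) (hδ : 0 < δ)
    (hM : 256 * q / δ ≤ M) :
    2 * (n * ((2 * Real.pi / M) / (δ / 4)) ^ 4) ≤ 1 / 1000 := by
  have hM1 : (0 : ℝ) < M := by exact_mod_cast hM0
  have hq0 : 0 < q := by linarith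
  have h1 : (2 * Real.pi / M) / (δ / 4) ≤ 1 / (10 * q) := by
    rw [div_div, div_le_div_iff₀ (by positivity) (by positivity)]
    have h2 : 256 * q ≤ M * δ := (div_le_iff₀ hδ).1 hM
    have h3 : Real.pi * q ≤ 3.2 * q :=
      mul_le_mul_of_nonneg_right (by linarith [Real.pi_lt_d2]) hq0.le
    nlinarith
  calc _ ≤ 2 * (q ^ 4 * (1 / (10 * q)) ^ 4) := by
        rw [hq4]
        have := pow_le_pow_left₀ (by positivity) h1 4
        gcongr
    _ ≤ _ := by
        field_simp
        norm_num

theorem abs_grad_le {d : ℕ} {f : EuclideanSpace ℝ (Fin n) → EuclideanSpace ℝ (Fin d) → ℝ}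
    {θ : EuclideanSpace ℝ (Fin n)} {X : BitString m → EuclideanSpace ℝ (Fin d)}
    {p : PMF (BitString m)} {g : ℝ} (hg : gMax f θ X p ≤ g) {i : BitString m}
    (hi : i ∈ p.support) (k : Fin n) : |grad f θ (X i) k| ≤ √g :=
  Real.abs_le_sqrt ((sq_grad_le_gMax f θ X p hi k).trans hg)

theorem norm_fwdGradMean_le {d : ℕ}
    {f : EuclideanSpace ℝ (Fin n) → EuclideanSpace ℝ (Fin d) → ℝ}
    {θ : EuclideanSpace ℝ (Fin n)} {X : BitString m → EuclideanSpace ℝ (Fin d)}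
    {p : PMF (BitString m)} {g : ℝ} (hg : gMax f θ X p ≤ g) : ‖fwdGradMean f θ X p‖ ≤ √g := by
  refine (pi_norm_le_iff_of_nonneg (Real.sqrt_nonneg g)).2 fun k => ?_
  rw [fwdGradMean_eq_sum, Real.norm_eq_abs]
  calc _ ≤ ∑ i, (p i).toReal * √g := by
        refine (Finset.abs_sum_le_sum_abs _ _).trans (Finset.sum_le_sum fun i _ => ?_)
        rw [abs_mul, abs_of_nonneg ENNReal.toReal_nonneg]
        by_cases hi : i ∈ p.support
        · exact mul_le_mul_of_nonneg_left (abs_grad_le hg hi k) ENNReal.toReal_nonneg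
        · have : p i = 0 := by simpa [PMF.mem_support_iff] using hi
          simp [this]
    _ = √g := by rw [← Finset.sum_mul, sum_toReal_pmf, one_mul]

/-- The algorithm that outputs `0` without any query. -/
def zeroAlgorithm (n m c₁ c₂ : ℕ) : QueryAlgorithm n m c₁ c₂ where
  workspace := 0
  steps := []
  output := fun _ => 0

theorem queries_zeroAlgorithm : (zeroAlgorithm n m c₁ c₂).queries = 0 := rfl

theorem prob_zeroAlgorithm
    (F : BitString m → (Fin n → FixedPoint c₁ c₂) → Fin n → FixedPoint c₁ c₂)
    (P : Matrix.unitaryGroup (BitString m) ℂ)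
    (V : Matrix.unitaryGroup (Fin n → FixedPoint c₁ c₂) ℂ) {S : Set (Fin n → ℝ)}
    (hS : (0 : Fin n → ℝ) ∈ S) : (zeroAlgorithm n m c₁ c₂).prob F P V S = 1 := by
  have h1 : (zeroAlgorithm n m c₁ c₂).output ⁻¹' S = Set.univ :=
    Set.eq_univ_of_forall fun _ => hS
  rw [QueryAlgorithm.prob, h1, Set.indicator_univ]
  change ∑ b, ‖(zeroAlgorithm n m c₁ c₂).initState b‖ ^ 2 = 1
  rw [QueryAlgorithm.initState, Finset.sum_eq_single_of_mem _ (Finset.mem_univ _)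
    (fun b _ hb => by rw [Pi.single_eq_of_ne hb]; simp)]
  simp

theorem prob_mono (A : QueryAlgorithm n m c₁ c₂)
    (F : BitString m → (Fin n → FixedPoint c₁ c₂) → Fin n → FixedPoint c₁ c₂)
    (P : Matrix.unitaryGroup (BitString m) ℂ)
    (V : Matrix.unitaryGroup (Fin n → FixedPoint c₁ c₂) ℂ) {S T : Set (Fin n → ℝ)}
    (hST : S ⊆ T) : A.prob F P V S ≤ A.prob F P V T :=
  Finset.sum_le_sum fun _ _ =>
    Set.indicator_le_indicator_of_subset (Set.preimage_mono hST) (fun _ => sq_nonneg _) _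

theorem exists_le_two_pow (x : ℝ) : ∃ N : ℕ, ∀ c, N ≤ c → x ≤ 2 ^ c := by
  obtain ⟨N, hN⟩ := pow_unbounded_of_one_lt x (one_lt_two : (1 : ℝ) < 2)
  exact ⟨N, fun c hc => hN.le.trans (pow_le_pow_right₀ one_le_two hc)⟩

/-- The mean of the forward gradient is estimated with `O(n √g / ε)` queries, where `g` bounds
`gMax`. -/
theorem exists_queryAlgorithm (hn : 1 ≤ n) {g ε : ℝ} (hε : 0 < ε) (hεg : ε < √g) :
    ∃ c₀ : ℕ, ∀ c₁ c₂ m : ℕ, c₀ ≤ c₁ → c₀ ≤ c₂ →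
      ∃ A : QueryAlgorithm n m c₁ c₂,
        (A.queries : ℝ) ≤ 24 * 1024 * 512 * (n * √g / ε) ∧
        ∀ (d : ℕ) (f : EuclideanSpace ℝ (Fin n) → EuclideanSpace ℝ (Fin d) → ℝ)
          (θ : EuclideanSpace ℝ (Fin n)) (X : BitString m → EuclideanSpace ℝ (Fin d))
          (p : PMF (BitString m)), gMax f θ X p ≤ g →
          ∀ (F : BitString m → (Fin n → FixedPoint c₁ c₂) → Fin n → FixedPoint c₁ c₂)
            (P : Matrix.unitaryGroup (BitString m) ℂ)
            (V : Matrix.unitaryGroup (Fin n → FixedPoint c₁ c₂) ℂ),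
            Computes F f θ X p → LoadsInput P p →
            (0.99 : ℝ) ≤ A.prob F P V {y | ‖y - fwdGradMean f θ X p‖ ≤ ε} := by
  have hg0 : 0 < √g := hε.trans hεg
  -- The relative accuracy. The estimator is run with scale `(√g)⁻¹` and chord `δ / 4`, so that its
  -- error `4 (δ / 4) √g` is `ε`.
  set δ : ℝ := ε / √g with hδ
  have hδ0 : 0 < δ := by positivity
  have hδ1 : δ ≤ 1 := (div_le_one hg0).2 hεg.le
  obtain ⟨q, hq, hq4, hq2⟩ := exists_fourth_root hn
  have hq0 : 0 < q := by linarith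
  obtain ⟨r, hr, hr1, hr2⟩ := exists_pow_two_near (x := 256 * q / δ)
    ((one_le_div hδ0).2 (by linarith))
  have hr0 : (1 : ℝ) ≤ 2 ^ r := one_le_pow₀ one_le_two
  obtain ⟨r', hr', hr1', hr2'⟩ := exists_pow_two_near (x := 512 * q ^ 3 * 2 ^ r) (by
    nlinarith [one_le_pow₀ hq (n := 3)])
  -- `N₁` makes every forward gradient on the grid fit into the encoding, with `1` to spare for the
  -- `2^{-c₂}` missing from the range. `N₂` makes the rescaled rounding error at most `1 / 100`.
  obtain ⟨N₁, hN₁⟩ := exists_le_two_pow (n * (√g * ((2 : ℝ) ^ r / 2)) * (2 ^ r / 2) + 1)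
  obtain ⟨N₂, hN₂⟩ := exists_le_two_pow (100 * (√g)⁻¹)
  refine ⟨max r (max N₁ N₂), fun c₁ c₂ m hc₁ hc₂ => ?_⟩
  simp only [max_le_iff] at hc₁ hc₂
  have hrange : n * (((√g)⁻¹)⁻¹ * ((2 : ℝ) ^ r / 2)) * (2 ^ r / 2) ≤ fpRange c₁ c₂ := by
    rw [inv_inv, fpRange]
    have h1 := hN₁ c₁ hc₁.2.1
    have h2 : ((2 : ℝ) ^ c₂)⁻¹ ≤ 1 := inv_le_one_of_one_le₀ (one_le_pow₀ one_le_two)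
    linarith
  obtain ⟨A, hA, hprob⟩ := exists_estimator (c₁ := c₁) (c₂ := c₂) m hn hr hr' hc₁.1
    (inv_pos.2 hg0) (div_pos hδ0 four_pos) hrange
  refine ⟨A, ?_, fun d f θ X p hg F P V hF hP => ?_⟩
  · rw [hA]
    push_cast
    have h1 : (1 : ℝ) ≤ 2 ^ r' := one_le_pow₀ one_le_two
    calc (16 * 2 ^ r' + 8 : ℝ) ≤ 24 * 2 ^ r' := by linarith
      -- Each rounding to a power of two costs a factor of at most `2`. The factor `q ^ 3` of the
      -- clock and the `q` of the grid combine to `q ^ 4 = n`.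
      _ ≤ 24 * (2 * (512 * q ^ 3 * (2 * (256 * q / δ)))) := by gcongr; exact hr2'.trans (by gcongr)
      _ = 24 * 1024 * 512 * (q ^ 4 / δ) := by ring
      _ = _ := by rw [hq4, hδ, div_div_eq_mul_div]
  · have h1 := hprob d f θ X p (fun i hi k => by rw [inv_inv]; exact abs_grad_le hg hi k) F P V hF hP
    have h2 : stateError n (2 ^ r) (2 ^ r') ((√g)⁻¹ * (2 ^ c₂)⁻¹) ≤ 1 / 1000 := by
      refine stateError_le hq hq4 hq2 Nat.one_le_two_pow (by push_cast; exact hr1')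
        (by positivity) ?_
      rw [← div_eq_mul_inv, div_le_iff₀ (by positivity)]
      linarith [hN₂ c₂ hc₂.2.2]
    have h3 := readoutError_le (M := 2 ^ r) hq hq4 Nat.one_le_two_pow hδ0 (by push_cast; exact hr1)
    have h4 : 4 * (δ / 4) / (√g)⁻¹ = ε := by
      rw [hδ]
      field_simp
    rw [h4] at h1
    refine le_trans (le_trans ?_ h1) (prob_mono A F P V fun y hy => ?_)
    -- The failure probability is at most `2 / 1000 + 1 / 1000`.
    · linarith
    · exact (pi_norm_le_iff_of_nonneg hε.le).2 hy

end Main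

end FwdGrad

end

theorem mainTheorem3 :
    (∀ (d n m : ℕ) (f : EuclideanSpace ℝ (Fin n) → EuclideanSpace ℝ (Fin d) → ℝ)
      (θ : EuclideanSpace ℝ (Fin n)) (X : FwdGrad.BitString m → EuclideanSpace ℝ (Fin d))
      (p : PMF (FwdGrad.BitString m)), FwdGrad.DiffAtParams f θ X p →
      ∀ j : Fin n,
        MemLp (FwdGrad.fwdGradCoord f θ X j) 2 (FwdGrad.jointLaw p n) ∧
        variance (FwdGrad.fwdGradCoord f θ X j) (FwdGrad.jointLaw p n)
          ≤ ((n : ℝ) + 2) * FwdGrad.gMax f θ X p) ∧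
    ∃ C : ℝ, 0 < C ∧ ∀ (d n : ℕ) (g ε : ℝ), 1 ≤ d → 0 ≤ g → 0 < ε →
      ∃ c₀ : ℕ, ∀ c₁ c₂ m : ℕ, c₀ ≤ c₁ → c₀ ≤ c₂ →
        ∃ A : FwdGrad.QueryAlgorithm n m c₁ c₂,
          (A.queries : ℝ) ≤ C * ((n : ℝ) * √((d : ℝ) * g) / ε) ∧
          ∀ (f : EuclideanSpace ℝ (Fin n) → EuclideanSpace ℝ (Fin d) → ℝ)
            (θ : EuclideanSpace ℝ (Fin n)) (X : FwdGrad.BitString m → EuclideanSpace ℝ (Fin d))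
            (p : PMF (FwdGrad.BitString m)),
            FwdGrad.DiffAtParams f θ X p → FwdGrad.gMax f θ X p ≤ g →
            ∀ (F : FwdGrad.BitString m → (Fin n → FwdGrad.FixedPoint c₁ c₂) →
                Fin n → FwdGrad.FixedPoint c₁ c₂)
              (P : Matrix.unitaryGroup (FwdGrad.BitString m) ℂ)
              (V : Matrix.unitaryGroup (Fin n → FwdGrad.FixedPoint c₁ c₂) ℂ),
              FwdGrad.Computes F f θ X p → FwdGrad.LoadsInput P p → FwdGrad.LoadsGauss V →
              (0.99 : ℝ) ≤
                A.prob F P V {y | ‖y - FwdGrad.fwdGradMean f θ X p‖ ≤ ε} := by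
  refine ⟨fun d n m f θ X p _ j => ⟨FwdGrad.memLp_fwdGradCoord f θ X p j,
    FwdGrad.variance_fwdGradCoord_le f θ X p j⟩, 24 * 1024 * 512, by norm_num,
    fun d n g ε hd hg hε => ?_⟩
  -- Otherwise the mean, of sup norm at most `√g`, is already within `ε` of `0`, or the space is
  -- trivial; no query is then needed.
  by_cases h : 1 ≤ n ∧ ε < √g
  · obtain ⟨c₀, hc₀⟩ := FwdGrad.exists_queryAlgorithm h.1 hε h.2
    refine ⟨c₀, fun c₁ c₂ m h₁ h₂ => ?_⟩
    obtain ⟨A, hA, hprob⟩ := hc₀ c₁ c₂ m h₁ h₂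
    refine ⟨A, hA.trans ?_, fun f θ X p _ hgm F P V hF hP _ =>
      hprob d f θ X p hgm F P V hF hP⟩
    have hd1 : (1 : ℝ) ≤ d := by exact_mod_cast hd
    gcongr
    exact le_mul_of_one_le_left hg hd1
  · refine ⟨0, fun c₁ c₂ m _ _ => ⟨FwdGrad.zeroAlgorithm n m c₁ c₂, ?_,
      fun f θ X p _ hgm F P V _ _ _ => ?_⟩⟩
    · rw [FwdGrad.queries_zeroAlgorithm]
      push_cast
      positivity
    · rw [FwdGrad.prob_zeroAlgorithm]
      · norm_num
      · rw [Set.mem_ofPred_eq, zero_sub, norm_neg]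
        rcases Nat.eq_zero_or_pos n with rfl | hn
        · rw [Subsingleton.elim (FwdGrad.fwdGradMean f θ X p) 0, norm_zero]
          exact hε.le
        · exact (FwdGrad.norm_fwdGradMean_le hgm).trans (not_lt.1 fun h' => h ⟨hn, h'⟩)
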